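/- **Setting.** Let $\mu$ be a $\sigma$-finite measure on a measurable space $\mathcal X$, let $\Theta\subseteq\mathbb R^p$ be measurable (for instance a rectangle), and let $f(\cdot\mid\theta)$, $\theta\in\Theta$, be probability densities with respect to $\mu$, jointly measurable in $(x,\theta)$ and strictly positive on $\mathcal X$. For each $\theta$, $X_1,X_2,\ldots$ are i.i.d. with density $f(\cdot\mid\theta)$; write $P_\theta$, $E_\theta$ for probability and expectation, $X$ for a single observation, $f_n(\theta)=\prod_{i=1}^n f(X_i\mid\theta)$ and $\ell_n(\theta)=\log f_n(\theta)$. Let $\pi\ge 0$ be a measurable, possibly improper, prior density on $\Theta$, positive and differentiable on the interior $\Theta^\circ$, and let $$\hat\theta^{B}_n=\frac{\int_\Theta\theta\,\pi(\theta)f_n(\theta)\,d\theta}{\int_\Theta\pi(\theta)f_n(\theta)\,d\theta}$$ be the posterior mean. Write $\partial_r=\partial/\partial\theta_r$, let $$I_{rs}(\theta)=E_\theta\{\partial_r\log f(X\mid\theta)\,\partial_s\log f(X\mid\theta)\}$$ be the Fisher information matrix and $I^{rs}(\theta)$ the entries of its inverse $I^{-1}(\theta)$. **Assumptions.** "Locally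 dominated near $\theta$" means bounded in absolute value, for all parameter values in some neighbourhood of $\theta$, by one integrable function of $x$. For every $\theta\in\Theta^\circ$ and all indices $r,s,t$: 1. $\log f(x\mid\cdot)$ is three times continuously differentiable on $\Theta^\circ$ for every $x$; $\partial_r f$, $\partial_r\partial_s f$ and $\partial_t\{f\,\partial_r\partial_s\log f\}$ are locally dominated near $\theta$ with respect to $\mu$; $\partial_r\partial_s\partial_t\log f$ is locally dominated near $\theta$ with respect to the law of $X$ under $\theta$; $\partial_r\log f(X\mid\theta)$ and $\partial_r\partial_s\log f(X\mid\theta)$ have finite second moments under $\theta$; $I(\theta)$ is non-singular. 2. For every $\delta>0$ there is $\varepsilon>0$ such that, with $P_\theta$-probability tending to $1$, $\ell_n(\theta')-\ell_n(\theta)\le-\varepsilon n$ for all $\theta'\in\Theta$ with $|\theta'-\theta|\ge\delta$. 3. There is $m\ge 0$ such that $\int_\Theta(1+|\theta'|)\,\pi(\theta')f_m(\theta')\,d\theta'<\infty$ $P_\theta$-almost surely. 4. $E_\theta|\hat\theta^B_n|<\infty$ for all large $n$; and, for the remainder $R_n$ defined by $$\hat\theta^B_n=\theta+\frac1n I^{-1}(\theta)\Big[\frac{\partial}{\partial\theta}\{\log\pi(\theta)+2\ell_n(\theta)\}+\frac12\sum_{r,s}I^{rs}(\theta)A_{n,rs}(\theta)\Big]+R_n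 ,$$ if $R_n=o_p(n^{-1})$ under $P_\theta$, then $E_\theta(R_n)=o(n^{-1})$. Here the vector $A_{n,rs}$ has components $$A_{n,rsv}=K_{vrs}+\frac2n\,(\partial_v\partial_r\ell_n)(\partial_s\ell_n)+\frac1n\sum_{t,u}I^{tu}(\partial_s\ell_n)(\partial_u\ell_n)K_{rtv},\qquad K_{rst}(\theta)=E_\theta\{\partial_r\partial_s\partial_t\log f(X\mid\theta)\}.$$ That $R_n=o_p(n^{-1})$ is not assumed. **Conclusion.** For every $\theta\in\Theta^\circ$, $$E_\theta(\hat\theta^B_n)-\theta=\frac1n I^{-1}(\theta)\Big\{\frac{\partial\log\pi(\theta)}{\partial\theta}-\sum_{r=1}^p\sum_{s=1}^p I^{rs}(\theta)\,\frac{\partial}{\partial\theta_s}\begin{bmatrix}I_{1r}(\theta)\\ \vdots\\ I_{pr}(\theta)\end{bmatrix}\Big\}+o(n^{-1})\qquad(n\to\infty).$$ Consequently, for each $\theta\in\Theta^\circ$, the bias at $\theta$ is $o(n^{-1})$ if and only if $$\frac{\partial\log\pi(\theta)}{\partial\theta_t}=\sum_{r=1}^p\sum_{s=1}^p I^{rs}(\theta)\frac{\partial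 I_{tr}(\theta)}{\partial\theta_s}\qquad(t=1,\ldots,p),$$ and the prior is asymptotically unbiased (bias $o(n^{-1})$ at every $\theta\in\Theta^\circ$) if and only if these equations hold at every $\theta\in\Theta^\circ$. -/

import Mathlib

open MeasureTheory Filter Topology Asymptotics

namespace IIDBayes

noncomputable section

/-- The partial derivative `∂g/∂θ_i` of a real function on `ℝ^p`. -/
def pd {p : ℕ} (i : Fin p) (g : (Fin p → ℝ) → ℝ) (θ : Fin p → ℝ) : ℝ :=
  lineDeriv ℝ g θ (Pi.single i 1)

/-! In all that follows `f θ x` is the density `f(x ∣ θ)` of one observation with respect to `μ`. -/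

/-- The distribution of one observation. -/
def law {p : ℕ} {𝒳 : Type*} [MeasurableSpace 𝒳] (μ : Measure 𝒳)
    (f : (Fin p → ℝ) → 𝒳 → ℝ) (θ : Fin p → ℝ) : Measure 𝒳 :=
  μ.withDensity (fun x => ENNReal.ofReal (f θ x))

/-- The joint distribution of an i.i.d. sequence `X₁ = ω 0, X₂ = ω 1, …`. -/
def sampleLaw {p : ℕ} {𝒳 : Type*} [MeasurableSpace 𝒳] (μ : Measure 𝒳)
    (f : (Fin p → ℝ) → 𝒳 → ℝ) (θ : Fin p → ℝ) : Measure (ℕ → 𝒳) :=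
  Measure.infinitePi (fun _ : ℕ => law μ f θ)

/-- The log density `log f(x ∣ θ)` of one observation, as a function of `θ`. -/
def logDensity {p : ℕ} {𝒳 : Type*} (f : (Fin p → ℝ) → 𝒳 → ℝ) (x : 𝒳) (θ : Fin p → ℝ) : ℝ :=
  Real.log (f θ x)

/-- The joint density `f_n(x₁, …, x_n ∣ θ) = ∏ f(x_i ∣ θ)` of the first `n` observations. -/
def jointDensity {p : ℕ} {𝒳 : Type*} (f : (Fin p → ℝ) → 𝒳 → ℝ) (n : ℕ) (ω : ℕ → 𝒳)
    (θ : Fin p → ℝ) : ℝ :=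
  ∏ i ∈ Finset.range n, f θ (ω i)

/-- The log-likelihood `ℓ_n(θ)`. -/
def logLik {p : ℕ} {𝒳 : Type*} (f : (Fin p → ℝ) → 𝒳 → ℝ) (n : ℕ) (ω : ℕ → 𝒳)
    (θ : Fin p → ℝ) : ℝ :=
  Real.log (jointDensity f n ω θ)

/-- The Bayes estimator (posterior mean) for the prior density `π` (possibly improper) on `Θ`. -/
def bayes {p : ℕ} {𝒳 : Type*} (f : (Fin p → ℝ) → 𝒳 → ℝ) (Θ : Set (Fin p → ℝ))
    (π : (Fin p → ℝ) → ℝ) (n : ℕ) (ω : ℕ → 𝒳) : Fin p → ℝ :=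
  (∫ θ in Θ, π θ * jointDensity f n ω θ)⁻¹ • ∫ θ in Θ, (π θ * jointDensity f n ω θ) • θ

/-- The bias `E(θ̂^B) - θ` of the Bayes estimator under the parameter value `θ`. -/
def bias {p : ℕ} {𝒳 : Type*} [MeasurableSpace 𝒳] (μ : Measure 𝒳)
    (f : (Fin p → ℝ) → 𝒳 → ℝ) (Θ : Set (Fin p → ℝ)) (π : (Fin p → ℝ) → ℝ)
    (θ : Fin p → ℝ) (n : ℕ) : Fin p → ℝ :=
  (∫ ω, bayes f Θ π n ω ∂(sampleLaw μ f θ)) - θ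

/-- The Fisher information matrix of one observation,
`I_{rs}(θ) = E{∂_r log f(X ∣ θ) ∂_s log f(X ∣ θ)}`. -/
def fisher {p : ℕ} {𝒳 : Type*} [MeasurableSpace 𝒳] (μ : Measure 𝒳)
    (f : (Fin p → ℝ) → 𝒳 → ℝ) (θ : Fin p → ℝ) : Matrix (Fin p) (Fin p) ℝ :=
  Matrix.of fun r s =>
    ∫ x, pd r (logDensity f x) θ * pd s (logDensity f x) θ ∂(law μ f θ)

/-- `φ_t(θ) = ∑_{r,s} I^{rs}(θ) ∂I_{tr}(θ)/∂θ_s`, where `I^{rs}` are the entries of `I⁻¹`. -/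
def phi {p : ℕ} {𝒳 : Type*} [MeasurableSpace 𝒳] (μ : Measure 𝒳)
    (f : (Fin p → ℝ) → 𝒳 → ℝ) (θ : Fin p → ℝ) (t : Fin p) : ℝ :=
  ∑ r, ∑ s, (fisher μ f θ)⁻¹ r s * pd s (fun θ' => fisher μ f θ' t r) θ

/-- The gradient of the log prior density. -/
def gradLogPrior {p : ℕ} (π : (Fin p → ℝ) → ℝ) (θ : Fin p → ℝ) (t : Fin p) : ℝ :=
  pd t (fun θ' => Real.log (π θ')) θ

/-! ### The stochastic expansion of the Bayes estimator and its remainder -/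

/-- `I_{n,rs}(θ) = n⁻¹ ∂_r ℓ_n(θ) ∂_s ℓ_n(θ)`. -/
def In {p : ℕ} {𝒳 : Type*} (f : (Fin p → ℝ) → 𝒳 → ℝ) (θ : Fin p → ℝ) (n : ℕ) (ω : ℕ → 𝒳)
    (r s : Fin p) : ℝ :=
  (n : ℝ)⁻¹ * (pd r (logLik f n ω) θ * pd s (logLik f n ω) θ)

/-- `J_{n,rs,t}(θ) = n⁻¹ ∂_r ∂_s ℓ_n(θ) ∂_t ℓ_n(θ)`. -/
def Jn {p : ℕ} {𝒳 : Type*} (f : (Fin p → ℝ) → 𝒳 → ℝ) (θ : Fin p → ℝ) (n : ℕ) (ω : ℕ → 𝒳)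
    (r s t : Fin p) : ℝ :=
  (n : ℝ)⁻¹ * (pd r (pd s (logLik f n ω)) θ * pd t (logLik f n ω) θ)

/-- `K_{rst}(θ) = E{∂_r ∂_s ∂_t log f(X ∣ θ)}`. -/
def K {p : ℕ} {𝒳 : Type*} [MeasurableSpace 𝒳] (μ : Measure 𝒳)
    (f : (Fin p → ℝ) → 𝒳 → ℝ) (θ : Fin p → ℝ) (r s t : Fin p) : ℝ :=
  ∫ x, pd r (pd s (pd t (logDensity f x))) θ ∂(law μ f θ)

/-- `A_{n,rsv} = K_{vrs} + 2 J_{n,vr,s} + ∑_{t,u} I^{tu} I_{n,su} K_{rtv}`. -/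
def An {p : ℕ} {𝒳 : Type*} [MeasurableSpace 𝒳] (μ : Measure 𝒳)
    (f : (Fin p → ℝ) → 𝒳 → ℝ) (θ : Fin p → ℝ) (n : ℕ) (ω : ℕ → 𝒳) (r s v : Fin p) : ℝ :=
  K μ f θ v r s + 2 * Jn f θ n ω v r s
    + ∑ t, ∑ u, (fisher μ f θ)⁻¹ t u * In f θ n ω s u * K μ f θ r t v

/-- The remainder `R_n` in the expansion
`θ̂^B = θ + n⁻¹ I⁻¹(θ) [∂/∂θ {log π(θ) + 2 ℓ_n(θ)} + ½ ∑_{r,s} I^{rs}(θ) A_{n,rs}(θ)] + R_n`. -/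
def remainder {p : ℕ} {𝒳 : Type*} [MeasurableSpace 𝒳] (μ : Measure 𝒳)
    (f : (Fin p → ℝ) → 𝒳 → ℝ) (Θ : Set (Fin p → ℝ)) (π : (Fin p → ℝ) → ℝ)
    (θ : Fin p → ℝ) (n : ℕ) (ω : ℕ → 𝒳) : Fin p → ℝ :=
  bayes f Θ π n ω - θ
    - (n : ℝ)⁻¹ • (fisher μ f θ)⁻¹.mulVec (fun v =>
        gradLogPrior π θ v + 2 * pd v (logLik f n ω) θ
          + (1 / 2) * ∑ r, ∑ s, (fisher μ f θ)⁻¹ r s * An μ f θ n ω r s v)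

/-- Expectations are compatible with the expansion at `θ`: the Bayes estimator has an expectation
for all large `n`, and if the remainder is `o_p(n⁻¹)`, then its expectation is `o(n⁻¹)`. That the
remainder is `o_p(n⁻¹)` is not part of this condition. -/
def ExpectationOfRemainder {p : ℕ} {𝒳 : Type*} [MeasurableSpace 𝒳] (μ : Measure 𝒳)
    (f : (Fin p → ℝ) → 𝒳 → ℝ) (Θ : Set (Fin p → ℝ)) (π : (Fin p → ℝ) → ℝ)
    (θ : Fin p → ℝ) : Prop :=
  (∀ᶠ n : ℕ in atTop, Integrable (bayes f Θ π n) (sampleLaw μ f θ)) ∧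
  (TendstoInMeasure (sampleLaw μ f θ) (fun (n : ℕ) ω => (n : ℝ) • remainder μ f Θ π θ n ω)
      atTop (fun _ => 0) →
    (fun n : ℕ => ∫ ω, remainder μ f Θ π θ n ω ∂(sampleLaw μ f θ))
      =o[atTop] (fun n : ℕ => (n : ℝ)⁻¹))

/-! ### Regularity conditions -/

/-- The functions `g θ'`, for `θ'` near `θ`, have a common `ν`-integrable bound. -/
def LocallyDominated {p : ℕ} {𝒳 : Type*} [MeasurableSpace 𝒳] (ν : Measure 𝒳)
    (g : (Fin p → ℝ) → 𝒳 → ℝ) (θ : Fin p → ℝ) : Prop :=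
  ∃ U ∈ 𝓝 θ, ∃ b : 𝒳 → ℝ, Integrable b ν ∧ ∀ᵐ x ∂ν, ∀ θ' ∈ U, |g θ' x| ≤ b x

/-- A regular i.i.d. model with parameter space `Θ` and densities `f(· ∣ θ)` with respect
to `μ`. -/
structure RegularModel {p : ℕ} {𝒳 : Type*} [MeasurableSpace 𝒳] (μ : Measure 𝒳)
    (f : (Fin p → ℝ) → 𝒳 → ℝ) (Θ : Set (Fin p → ℝ)) : Prop where
  measurable : Measurable (Function.uncurry f)
  pos : ∀ θ ∈ Θ, ∀ x, 0 < f θ x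
  prob : ∀ θ ∈ Θ, ∫⁻ x, ENNReal.ofReal (f θ x) ∂μ = 1
  smooth : ∀ x, ContDiffOn ℝ 3 (logDensity f x) (interior Θ)
  /-- Differentiation and integration can be interchanged: once and twice in `∫ f(x ∣ θ) dμ`,
  and once in `E{∂_r ∂_s log f(X ∣ θ)}`. -/
  dom_one : ∀ θ ∈ interior Θ, ∀ r, LocallyDominated μ (fun θ' x => pd r (fun η => f η x) θ') θ
  dom_two : ∀ θ ∈ interior Θ, ∀ r s,
    LocallyDominated μ (fun θ' x => pd r (pd s (fun η => f η x)) θ') θ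
  dom_hess : ∀ θ ∈ interior Θ, ∀ r s t,
    LocallyDominated μ (fun θ' x => pd t (fun η => f η x * pd r (pd s (logDensity f x)) η) θ') θ
  /-- The third derivatives of the log density are locally dominated under each `θ`. -/
  dom_third : ∀ θ ∈ interior Θ, ∀ r s t,
    LocallyDominated (law μ f θ) (fun θ' x => pd r (pd s (pd t (logDensity f x))) θ') θ
  score_sq : ∀ θ ∈ interior Θ, ∀ r, MemLp (fun x => pd r (logDensity f x) θ) 2 (law μ f θ)
  hess_sq : ∀ θ ∈ interior Θ, ∀ r s,
    MemLp (fun x => pd r (pd s (logDensity f x)) θ) 2 (law μ f θ)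
  fisher_nonsing : ∀ θ ∈ interior Θ, IsUnit (fisher μ f θ).det
  /-- Identifiability: outside each neighbourhood of the true value `θ` the log-likelihood is,
  with probability tending to one, smaller than at `θ` by a multiple of `n`. -/
  separated : ∀ θ ∈ interior Θ, ∀ δ > 0, ∃ ε > 0,
    Tendsto (fun n : ℕ => sampleLaw μ f θ
      {ω | ∃ θ' ∈ Θ, δ ≤ ‖θ' - θ‖ ∧ -(ε * n) < logLik f n ω θ' - logLik f n ω θ}) atTop (𝓝 0)

/-- A prior density on `Θ` (possibly improper), positive and differentiable in the interior, whose
posterior is proper and has a finite mean once the sample is large enough. -/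
structure RegularPrior {p : ℕ} {𝒳 : Type*} [MeasurableSpace 𝒳] (μ : Measure 𝒳)
    (f : (Fin p → ℝ) → 𝒳 → ℝ) (Θ : Set (Fin p → ℝ)) (π : (Fin p → ℝ) → ℝ) : Prop where
  measurable : Measurable π
  nonneg : ∀ θ ∈ Θ, 0 ≤ π θ
  pos : ∀ θ ∈ interior Θ, 0 < π θ
  diff : ∀ θ ∈ interior Θ, DifferentiableAt ℝ π θ
  proper : ∀ θ ∈ interior Θ, ∃ m : ℕ, ∀ᵐ ω ∂(sampleLaw μ f θ),
    IntegrableOn (fun θ' => (1 + ‖θ'‖) * (π θ' * jointDensity f m ω θ')) Θ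

/-! ### Second-order unbiasedness -/

/-- The Bayes estimator is second-order unbiased at `θ`: its bias at `θ` is `o(n⁻¹)`. -/
def SecondOrderUnbiasedAt {p : ℕ} {𝒳 : Type*} [MeasurableSpace 𝒳] (μ : Measure 𝒳)
    (f : (Fin p → ℝ) → 𝒳 → ℝ) (Θ : Set (Fin p → ℝ)) (π : (Fin p → ℝ) → ℝ)
    (θ : Fin p → ℝ) : Prop :=
  (fun n : ℕ => bias μ f Θ π θ n) =o[atTop] (fun n : ℕ => (n : ℝ)⁻¹)

/-- The prior is asymptotically unbiased: its Bayes estimator is second-order unbiased at every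
interior parameter value. -/
def AsymptoticallyUnbiased {p : ℕ} {𝒳 : Type*} [MeasurableSpace 𝒳] (μ : Measure 𝒳)
    (f : (Fin p → ℝ) → 𝒳 → ℝ) (Θ : Set (Fin p → ℝ)) (π : (Fin p → ℝ) → ℝ) : Prop :=
  ∀ θ ∈ interior Θ, SecondOrderUnbiasedAt μ f Θ π θ

end

end IIDBayes

namespace IIDBayes

/-! ### Partial derivatives -/

/-! The bracket in the expansion of the posterior mean has an expectation that can be computed
exactly. The bias formula therefore follows once the remainder is shown to be `o_p(n⁻¹)`, because
`ExpectationOfRemainder` then passes from the remainder to its expectation.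

Exact expectation: the score is centred and distinct observations are independent, so only diagonal
terms survive in the products of sums. Differentiating the information in its Hessian form gives
`∂_s I_{vr} = -(K_{svr} + E{∂_v∂_r log f ∂_s log f})` (`pd_fisher`), hence `E A_{n,rsv} = -2 ∂_s
I_{vr}` (`integral_An`), and the bracket has mean `∂ log π - φ` (`integral_expansion`).

Remainder: write `η = θ + t/√n` around the true value. The log-likelihood ratio is `z·t - ½ t·It`
plus `n^{-1/2}` times a polynomial whose quadratic part is the fluctuation of the Hessian and whose
cubic part has coefficients `K`. Including the slope of the prior, the posterior weight is `exp(z·t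
- ½ t·It)(1 + n^{-1/2} q(t))` to first order. Stein's identity gives `cov(t, q) = I⁻¹ E∇q` under the
Gaussian law, so the rescaled posterior mean is `I⁻¹z + n^{-1/2} I⁻¹ E∇q + o(n^{-1/2})`
(`integral_sub_mul_cubicPoly`, `LaplaceSetting.tendsto_mean`), and `cubicMean_add_score` recognises
the bracket in it.

The Laplace step is deterministic: it is carried out along one sample path and only along those `n`
at which score and Hessian are bounded and the likelihood is separated
(`RegularModel.laplaceSetting`). Score and Hessian are merely tight, so all estimates are uniform
over bounded values instead of relying on limits. These good events have probability close to one,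
and `tendstoInMeasure_zero_of_ae_on` converts pathwise convergence on them into convergence in
probability. -/

lemma pd_congr {p : ℕ} {i : Fin p} {g h : (Fin p → ℝ) → ℝ} {θ : Fin p → ℝ} (hgh : g =ᶠ[𝓝 θ] h) :
    pd i g θ = pd i h θ :=
  hgh.lineDeriv_eq

lemma pd_eq_fderiv {p : ℕ} {i : Fin p} {g : (Fin p → ℝ) → ℝ} {θ : Fin p → ℝ}
    (hg : DifferentiableAt ℝ g θ) : pd i g θ = fderiv ℝ g θ (Pi.single i 1) :=
  hg.lineDeriv_eq_fderiv

lemma fderiv_eq_sum_pd {p : ℕ} {g : (Fin p → ℝ) → ℝ} {θ : Fin p → ℝ}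
    (hg : DifferentiableAt ℝ g θ) (h : Fin p → ℝ) :
    fderiv ℝ g θ h = ∑ i, h i * pd i g θ := by
  conv_lhs => rw [pi_eq_sum_univ' h]
  rw [map_sum]
  refine Finset.sum_congr rfl fun i _ => ?_
  rw [map_smul, pd_eq_fderiv hg, smul_eq_mul]

lemma contDiffOn_pd {p : ℕ} {i : Fin p} {g : (Fin p → ℝ) → ℝ} {U : Set (Fin p → ℝ)}
    (hU : IsOpen U) {n m : WithTop ℕ∞} (hg : ContDiffOn ℝ n g U) (hmn : m + 1 ≤ n) :
    ContDiffOn ℝ m (pd i g) U := by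
  have h1 : ContDiffOn ℝ m (fun θ => fderiv ℝ g θ (Pi.single i 1)) U :=
    (hg.fderiv_of_isOpen hU hmn).clm_apply contDiffOn_const
  refine h1.congr fun θ hθ => pd_eq_fderiv ?_
  exact (hg.differentiableOn (by
    rintro rfl
    simp at hmn)).differentiableAt (hU.mem_nhds hθ)

lemma pd_sum {p : ℕ} {ι : Type*} {i : Fin p} {s : Finset ι} {g : ι → (Fin p → ℝ) → ℝ}
    {θ : Fin p → ℝ} (hg : ∀ j ∈ s, DifferentiableAt ℝ (g j) θ) :
    pd i (fun η => ∑ j ∈ s, g j η) θ = ∑ j ∈ s, pd i (g j) θ := by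
  rw [pd_eq_fderiv (DifferentiableAt.fun_sum hg), fderiv_fun_sum hg, sum_apply]
  exact Finset.sum_congr rfl fun j hj => (pd_eq_fderiv (hg j hj)).symm

lemma pd_mul {p : ℕ} {i : Fin p} {g h : (Fin p → ℝ) → ℝ} {θ : Fin p → ℝ}
    (hg : DifferentiableAt ℝ g θ) (hh : DifferentiableAt ℝ h θ) :
    pd i (fun η => g η * h η) θ = pd i g θ * h θ + g θ * pd i h θ := by
  rw [pd_eq_fderiv hg, pd_eq_fderiv hh, pd_eq_fderiv (hg.fun_mul hh), fderiv_fun_mul hg hh]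
  simp
  ring

lemma pd_exp {p : ℕ} {i : Fin p} {g : (Fin p → ℝ) → ℝ} {θ : Fin p → ℝ}
    (hg : DifferentiableAt ℝ g θ) :
    pd i (fun η => Real.exp (g η)) θ = Real.exp (g θ) * pd i g θ := by
  rw [pd_eq_fderiv hg, pd_eq_fderiv hg.exp, fderiv_exp hg]
  simp

lemma pd_comm {p : ℕ} {i j : Fin p} {g : (Fin p → ℝ) → ℝ} {U : Set (Fin p → ℝ)}
    (hU : IsOpen U) (hg : ContDiffOn ℝ 2 g U) {θ : Fin p → ℝ} (hθ : θ ∈ U) :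
    pd i (pd j g) θ = pd j (pd i g) θ := by
  have hd : DifferentiableOn ℝ g U := hg.differentiableOn (by norm_num)
  have hf : DifferentiableAt ℝ (fderiv ℝ g) θ :=
    ((hg.fderiv_of_isOpen hU (m := 1) (by norm_num)).differentiableOn
      (by norm_num)).differentiableAt (hU.mem_nhds hθ)
  have key : ∀ a b : Fin p, pd a (pd b g) θ
      = fderiv ℝ (fderiv ℝ g) θ (Pi.single a 1) (Pi.single b 1) := by
    intro a b
    have : pd b g =ᶠ[𝓝 θ] fun η => fderiv ℝ g η (Pi.single b 1) := by
      filter_upwards [hU.mem_nhds hθ] with η hη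
      exact pd_eq_fderiv (hd.differentiableAt (hU.mem_nhds hη))
    rw [pd_congr this, pd_eq_fderiv (hf.clm_apply (differentiableAt_const _)),
      fderiv_clm_apply hf (differentiableAt_const _)]
    simp
  rw [key, key]
  exact ((hg.contDiffAt (hU.mem_nhds hθ)).isSymmSndFDerivAt (by simp)).eq _ _

lemma hasDerivAt_comp_line {p : ℕ} {g : (Fin p → ℝ) → ℝ} {θ h : Fin p → ℝ} {s : ℝ}
    (hg : DifferentiableAt ℝ g (θ + s • h)) :
    HasDerivAt (fun s : ℝ => g (θ + s • h)) (∑ i, h i * pd i g (θ + s • h)) s := by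
  rw [← fderiv_eq_sum_pd hg]
  have h1 : HasDerivAt (fun s : ℝ => θ + s • h) h s := by
    simpa using ((hasDerivAt_id s).smul_const h).const_add θ
  exact hg.hasFDerivAt.comp_hasDerivAt s h1

/-- Taylor's formula of order three with Lagrange remainder on the unit interval. -/
lemma taylor_three_unitInterval {φ φ₁ φ₂ φ₃ : ℝ → ℝ}
    (h₁ : ∀ s ∈ Set.Icc (0 : ℝ) 1, HasDerivAt φ (φ₁ s) s)
    (h₂ : ∀ s ∈ Set.Icc (0 : ℝ) 1, HasDerivAt φ₁ (φ₂ s) s)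
    (h₃ : ∀ s ∈ Set.Icc (0 : ℝ) 1, HasDerivAt φ₂ (φ₃ s) s) :
    ∃ ξ ∈ Set.Ioo (0 : ℝ) 1, φ 1 = φ 0 + φ₁ 0 + φ₂ 0 / 2 + φ₃ ξ / 6 := by
  -- With this `c`, the difference of `φ` and its quadratic Taylor polynomial plus `c s³` vanishes
  -- at both `0` and `1`. Its first two derivatives vanish at `0`, so Rolle's theorem applies three
  -- times and ends at a point where `φ₃ = 6c`.
  set c : ℝ := φ 1 - φ 0 - φ₁ 0 - φ₂ 0 / 2 with hc
  have d₁ : ∀ s ∈ Set.Icc (0 : ℝ) 1, HasDerivAt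
      (fun s => φ s - φ 0 - φ₁ 0 * s - φ₂ 0 / 2 * s ^ 2 - c * s ^ 3)
      (φ₁ s - φ₁ 0 - φ₂ 0 * s - 3 * c * s ^ 2) s := by
    intro s hs
    have := ((((h₁ s hs).sub_const (φ 0)).sub ((hasDerivAt_id s).const_mul (φ₁ 0))).sub
      ((hasDerivAt_pow 2 s).const_mul (φ₂ 0 / 2))).sub ((hasDerivAt_pow 3 s).const_mul c)
    exact this.congr_deriv (by norm_num; try ring)
  have d₂ : ∀ s ∈ Set.Icc (0 : ℝ) 1, HasDerivAt
      (fun s => φ₁ s - φ₁ 0 - φ₂ 0 * s - 3 * c * s ^ 2)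
      (φ₂ s - φ₂ 0 - 6 * c * s) s := by
    intro s hs
    have := (((h₂ s hs).sub_const (φ₁ 0)).sub ((hasDerivAt_id s).const_mul (φ₂ 0))).sub
      ((hasDerivAt_pow 2 s).const_mul (3 * c))
    exact this.congr_deriv (by norm_num; try ring)
  have d₃ : ∀ s ∈ Set.Icc (0 : ℝ) 1, HasDerivAt
      (fun s => φ₂ s - φ₂ 0 - 6 * c * s) (φ₃ s - 6 * c) s := by
    intro s hs
    have := ((h₃ s hs).sub_const (φ₂ 0)).sub ((hasDerivAt_id s).const_mul (6 * c))
    exact this.congr_deriv (by norm_num; try ring)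
  obtain ⟨ξ₁, hξ₁, e₁⟩ := exists_hasDerivAt_eq_zero one_pos
    (fun s hs => (d₁ s hs).continuousAt.continuousWithinAt) (by simp [hc])
    (fun s hs => d₁ s ⟨hs.1.le, hs.2.le⟩)
  obtain ⟨ξ₂, hξ₂, e₂⟩ := exists_hasDerivAt_eq_zero hξ₁.1
    (fun s hs => (d₂ s ⟨hs.1, hs.2.trans hξ₁.2.le⟩).continuousAt.continuousWithinAt)
    (by rw [e₁]; simp)
    (fun s hs => d₂ s ⟨hs.1.le, hs.2.le.trans hξ₁.2.le⟩)
  have h2 : ξ₂ ≤ 1 := hξ₂.2.le.trans hξ₁.2.le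
  obtain ⟨ξ₃, hξ₃, e₃⟩ := exists_hasDerivAt_eq_zero hξ₂.1
    (fun s hs => (d₃ s ⟨hs.1, hs.2.trans h2⟩).continuousAt.continuousWithinAt)
    (by rw [e₂]; simp)
    (fun s hs => d₃ s ⟨hs.1.le, hs.2.le.trans h2⟩)
  refine ⟨ξ₃, ⟨hξ₃.1, hξ₃.2.trans_le h2⟩, ?_⟩
  linarith

/-- Taylor's formula of order three with Lagrange remainder, in terms of partial derivatives. -/
lemma taylor_three {p : ℕ} {g : (Fin p → ℝ) → ℝ} {U : Set (Fin p → ℝ)} (hU : IsOpen U)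
    (hg : ContDiffOn ℝ 3 g U) {θ h : Fin p → ℝ} (hseg : ∀ s ∈ Set.Icc (0 : ℝ) 1, θ + s • h ∈ U) :
    ∃ ξ ∈ Set.Ioo (0 : ℝ) 1, g (θ + h) = g θ + ∑ v, h v * pd v g θ
      + (∑ u, ∑ v, h u * h v * pd u (pd v g) θ) / 2
      + (∑ t, ∑ u, ∑ v, h t * h u * h v * pd t (pd u (pd v g)) (θ + ξ • h)) / 6 := by
  have g1 : ∀ v, ContDiffOn ℝ 2 (pd v g) U := fun v => contDiffOn_pd hU hg (by norm_num)
  have g2 : ∀ u v, ContDiffOn ℝ 1 (pd u (pd v g)) U :=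
    fun u v => contDiffOn_pd hU (g1 v) (by norm_num)
  have D : ∀ {n : WithTop ℕ∞} {k : (Fin p → ℝ) → ℝ}, ContDiffOn ℝ n k U → n ≠ 0 →
      ∀ s ∈ Set.Icc (0 : ℝ) 1, HasDerivAt (fun s : ℝ => k (θ + s • h))
        (∑ i, h i * pd i k (θ + s • h)) s := fun hk hn s hs =>
    hasDerivAt_comp_line ((hk.differentiableOn hn).differentiableAt (hU.mem_nhds (hseg s hs)))
  obtain ⟨ξ, hξ, e⟩ := taylor_three_unitInterval (φ := fun s => g (θ + s • h))
    (φ₁ := fun s => ∑ v, h v * pd v g (θ + s • h))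
    (φ₂ := fun s => ∑ v, h v * ∑ u, h u * pd u (pd v g) (θ + s • h))
    (φ₃ := fun s => ∑ v, h v * ∑ u, h u * ∑ t, h t * pd t (pd u (pd v g)) (θ + s • h))
    (D hg (by norm_num))
    (fun s hs => HasDerivAt.fun_sum fun v _ => (D (g1 v) (by norm_num) s hs).const_mul _)
    (fun s hs => HasDerivAt.fun_sum fun v _ => (HasDerivAt.fun_sum fun u _ =>
      (D (g2 u v) (by norm_num) s hs).const_mul _).const_mul _)
  refine ⟨ξ, hξ, ?_⟩
  simp only [one_smul, zero_smul, add_zero] at e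
  rw [e]
  congr 2
  · congr 1
    simp only [Finset.mul_sum]
    rw [Finset.sum_comm]
    exact Finset.sum_congr rfl fun _ _ => Finset.sum_congr rfl fun _ _ => by ring
  · simp only [Finset.mul_sum]
    rw [Finset.sum_comm]
    rw [show (∑ y, ∑ x, ∑ i, h x * (h y * (h i * pd i (pd y (pd x g)) (θ + ξ • h))))
      = ∑ y, ∑ i, ∑ x, h x * (h y * (h i * pd i (pd y (pd x g)) (θ + ξ • h))) from
      Finset.sum_congr rfl fun _ _ => Finset.sum_comm]
    rw [Finset.sum_comm]
    exact Finset.sum_congr rfl fun _ _ => Finset.sum_congr rfl fun _ _ =>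
      Finset.sum_congr rfl fun _ _ => by ring

/-! ### Differentiation under the integral sign -/

/-- The partial derivative is the pointwise limit of difference quotients with steps `1/(n+N+1)`.
The offset `N` keeps the shifted parameters inside `U`, where measurability is known. -/
lemma measurable_pd_param {p : ℕ} {𝒳 : Type*} [MeasurableSpace 𝒳] {U : Set (Fin p → ℝ)}
    (hU : IsOpen U) {G : (Fin p → ℝ) → 𝒳 → ℝ} (hm : ∀ θ ∈ U, Measurable (G θ))
    (hd : ∀ x, ∀ θ ∈ U, DifferentiableAt ℝ (fun η => G η x) θ) (i : Fin p) {θ : Fin p → ℝ}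
    (hθ : θ ∈ U) : Measurable fun x => pd i (fun η => G η x) θ := by
  have h0 : Tendsto (fun n : ℕ => ((n : ℝ) + 1)⁻¹) atTop (𝓝[>] 0) := by
    refine tendsto_nhdsWithin_iff.2 ⟨?_, Eventually.of_forall fun n => ?_⟩
    · simpa using tendsto_one_div_add_atTop_nhds_zero_nat (𝕜 := ℝ)
    · simp only [Set.mem_Ioi]; positivity
  have h1 : ∀ᶠ n : ℕ in atTop, θ + ((n : ℝ) + 1)⁻¹ • (Pi.single i 1 : Fin p → ℝ) ∈ U := by
    have : Tendsto (fun n : ℕ => θ + ((n : ℝ) + 1)⁻¹ • (Pi.single i 1 : Fin p → ℝ)) atTop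
        (𝓝 (θ + (0 : ℝ) • (Pi.single i 1 : Fin p → ℝ))) :=
      ((h0.mono_right nhdsWithin_le_nhds).smul_const _).const_add θ
    rw [zero_smul, add_zero] at this
    exact this.eventually (hU.mem_nhds hθ)
  obtain ⟨N, hN⟩ := eventually_atTop.1 h1
  refine measurable_of_tendsto_metrizable (f := fun (n : ℕ) x => (((n + N : ℕ) : ℝ) + 1)⁻¹⁻¹ •
    (G (θ + (((n + N : ℕ) : ℝ) + 1)⁻¹ • (Pi.single i 1 : Fin p → ℝ)) x - G θ x))
    (fun n => Measurable.fun_const_smul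
      (Measurable.fun_sub (hm _ (hN _ (Nat.le_add_left _ _))) (hm _ hθ)) _) ?_
  rw [tendsto_pi_nhds]
  intro x
  have h2 := ((hd x θ hθ).lineDifferentiableAt (v := Pi.single i 1)).hasLineDerivAt
  exact (h2.tendsto_slope_zero_right.comp h0).comp (tendsto_add_atTop_nat N)

/-- Dominated differentiation on the line `t ↦ θ + t e_i`. Only the partial derivative in that one
direction has to be dominated, which matches the form of the regularity conditions. -/
lemma hasLineDerivAt_integral {p : ℕ} {𝒳 : Type*} [MeasurableSpace 𝒳] {μ : Measure 𝒳}
    {U : Set (Fin p → ℝ)} (hU : IsOpen U) {G : (Fin p → ℝ) → 𝒳 → ℝ}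
    (hm : ∀ θ ∈ U, Measurable (G θ))
    (hd : ∀ x, ∀ θ ∈ U, DifferentiableAt ℝ (fun η => G η x) θ) {i : Fin p} {θ : Fin p → ℝ}
    (hθ : θ ∈ U) (hint : Integrable (G θ) μ)
    (hdom : LocallyDominated μ (fun θ' x => pd i (fun η => G η x) θ') θ) :
    Integrable (fun x => pd i (fun η => G η x) θ) μ ∧
      HasLineDerivAt ℝ (fun η => ∫ x, G η x ∂μ) (∫ x, pd i (fun η => G η x) θ ∂μ) θ
        (Pi.single i 1) := by
  obtain ⟨V, hV, b, hb, hbound⟩ := hdom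
  have hc : Continuous fun t : ℝ => θ + t • (Pi.single i 1 : Fin p → ℝ) := by fun_prop
  have hc0 : Tendsto (fun t : ℝ => θ + t • (Pi.single i 1 : Fin p → ℝ)) (𝓝 0) (𝓝 θ) := by
    simpa using hc.tendsto 0
  have hs : {t : ℝ | θ + t • (Pi.single i 1 : Fin p → ℝ) ∈ U ∩ V} ∈ 𝓝 (0 : ℝ) :=
    hc0 (inter_mem (hU.mem_nhds hθ) hV)
  have key := hasDerivAt_integral_of_dominated_loc_of_deriv_le (μ := μ) (𝕜 := ℝ)
    (F := fun t x => G (θ + t • (Pi.single i 1 : Fin p → ℝ)) x) (x₀ := (0 : ℝ)) (bound := b)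
    (F' := fun t x => pd i (fun η => G η x) (θ + t • (Pi.single i 1 : Fin p → ℝ))) hs
    (by
      filter_upwards [hs] with t ht
      exact (hm _ ht.1).aestronglyMeasurable)
    (by simpa using hint)
    (by simpa using (measurable_pd_param hU hm hd i hθ).aestronglyMeasurable)
    (by
      filter_upwards [hbound] with x hx t ht
      exact hx _ ht.2)
    hb
    (by
      refine Eventually.of_forall fun x t ht => ?_
      have h2 := (((hd x _ ht.1).lineDifferentiableAt (v := Pi.single i 1)).hasLineDerivAt)
      -- A line derivative is a derivative at `0`. Writing `0` as `t - t` lets a translation move it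
      -- to `t`.
      have h3 : HasDerivAt (fun s : ℝ => G (θ + t • (Pi.single i 1 : Fin p → ℝ)
          + s • (Pi.single i 1 : Fin p → ℝ)) x)
          (pd i (fun η => G η x) (θ + t • (Pi.single i 1 : Fin p → ℝ))) (t - t) := by
        rw [sub_self]; exact h2
      have h4 := h3.comp_sub_const t t
      refine h4.congr_of_eventuallyEq (Eventually.of_forall fun s => ?_)
      simp only
      congr 1
      rw [add_assoc, ← add_smul]
      congr 2
      ring)
  simp only [zero_smul, add_zero] at key
  exact key

/-! ### The law of an observation -/

section Law

variable {p : ℕ} {𝒳 : Type*} [MeasurableSpace 𝒳] {μ : Measure 𝒳}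
  {f : (Fin p → ℝ) → 𝒳 → ℝ} {Θ : Set (Fin p → ℝ)}

lemma RegularModel.measurable_density (hm : RegularModel μ f Θ) (θ : Fin p → ℝ) :
    Measurable (f θ) :=
  hm.measurable.comp measurable_prodMk_left

lemma RegularModel.isProbabilityMeasure_law (hm : RegularModel μ f Θ) {θ : Fin p → ℝ}
    (hθ : θ ∈ Θ) : IsProbabilityMeasure (law μ f θ) :=
  ⟨by rw [law, withDensity_apply _ MeasurableSet.univ, Measure.restrict_univ, hm.prob θ hθ]⟩

lemma RegularModel.integral_law (hm : RegularModel μ f Θ) {θ : Fin p → ℝ} (hθ : θ ∈ Θ)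
    (g : 𝒳 → ℝ) : ∫ x, g x ∂(law μ f θ) = ∫ x, f θ x * g x ∂μ := by
  rw [law, integral_withDensity_eq_integral_toReal_smul
    (hm.measurable_density θ).ennreal_ofReal (Eventually.of_forall fun x => ENNReal.ofReal_lt_top)]
  simp only [ENNReal.toReal_ofReal (hm.pos θ hθ _).le, smul_eq_mul]

lemma RegularModel.integrable_law_iff (hm : RegularModel μ f Θ) {θ : Fin p → ℝ} (hθ : θ ∈ Θ)
    (g : 𝒳 → ℝ) : Integrable g (law μ f θ) ↔ Integrable (fun x => f θ x * g x) μ := by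
  rw [law, integrable_withDensity_iff_integrable_smul'
    (hm.measurable_density θ).ennreal_ofReal (Eventually.of_forall fun x => ENNReal.ofReal_lt_top)]
  simp only [ENNReal.toReal_ofReal (hm.pos θ hθ _).le, smul_eq_mul]

lemma RegularModel.density_eq_exp (hm : RegularModel μ f Θ) {θ : Fin p → ℝ} (hθ : θ ∈ Θ)
    (x : 𝒳) : f θ x = Real.exp (logDensity f x θ) :=
  (Real.exp_log (hm.pos θ hθ x)).symm

lemma RegularModel.density_eventuallyEq (hm : RegularModel μ f Θ) {θ : Fin p → ℝ}
    (hθ : θ ∈ interior Θ) (x : 𝒳) :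
    (fun η => f η x) =ᶠ[𝓝 θ] fun η => Real.exp (logDensity f x η) := by
  filter_upwards [isOpen_interior.mem_nhds hθ] with η hη
  exact hm.density_eq_exp (interior_subset hη) x

lemma RegularModel.smooth_one (hm : RegularModel μ f Θ) (x : 𝒳) (r : Fin p) :
    ContDiffOn ℝ 2 (pd r (logDensity f x)) (interior Θ) :=
  contDiffOn_pd isOpen_interior (hm.smooth x) (by norm_num)

lemma RegularModel.smooth_two (hm : RegularModel μ f Θ) (x : 𝒳) (r s : Fin p) :
    ContDiffOn ℝ 1 (pd r (pd s (logDensity f x))) (interior Θ) :=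
  contDiffOn_pd isOpen_interior (hm.smooth_one x s) (by norm_num)

lemma RegularModel.smooth_three (hm : RegularModel μ f Θ) (x : 𝒳) (r s t : Fin p) :
    ContDiffOn ℝ 0 (pd r (pd s (pd t (logDensity f x)))) (interior Θ) :=
  contDiffOn_pd isOpen_interior (hm.smooth_two x s t) (by norm_num)

lemma RegularModel.diff_zero (hm : RegularModel μ f Θ) (x : 𝒳) {θ : Fin p → ℝ}
    (hθ : θ ∈ interior Θ) : DifferentiableAt ℝ (logDensity f x) θ :=
  ((hm.smooth x).differentiableOn (by norm_num)).differentiableAt (isOpen_interior.mem_nhds hθ)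

lemma RegularModel.diff_one (hm : RegularModel μ f Θ) (x : 𝒳) (r : Fin p) {θ : Fin p → ℝ}
    (hθ : θ ∈ interior Θ) : DifferentiableAt ℝ (pd r (logDensity f x)) θ :=
  ((hm.smooth_one x r).differentiableOn (by norm_num)).differentiableAt
    (isOpen_interior.mem_nhds hθ)

lemma RegularModel.diff_two (hm : RegularModel μ f Θ) (x : 𝒳) (r s : Fin p) {θ : Fin p → ℝ}
    (hθ : θ ∈ interior Θ) : DifferentiableAt ℝ (pd r (pd s (logDensity f x))) θ :=
  ((hm.smooth_two x r s).differentiableOn (by norm_num)).differentiableAt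
    (isOpen_interior.mem_nhds hθ)

lemma RegularModel.diff_density (hm : RegularModel μ f Θ) (x : 𝒳) {θ : Fin p → ℝ}
    (hθ : θ ∈ interior Θ) : DifferentiableAt ℝ (fun η => f η x) θ :=
  (hm.diff_zero x hθ).exp.congr_of_eventuallyEq (hm.density_eventuallyEq hθ x)

lemma RegularModel.pd_density (hm : RegularModel μ f Θ) (x : 𝒳) (r : Fin p) {θ : Fin p → ℝ}
    (hθ : θ ∈ interior Θ) :
    pd r (fun η => f η x) θ = f θ x * pd r (logDensity f x) θ := by
  rw [pd_congr (hm.density_eventuallyEq hθ x), pd_exp (hm.diff_zero x hθ),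
    hm.density_eq_exp (interior_subset hθ)]

lemma RegularModel.pd_density_eventuallyEq (hm : RegularModel μ f Θ) (x : 𝒳) (r : Fin p)
    {θ : Fin p → ℝ} (hθ : θ ∈ interior Θ) :
    pd r (fun η => f η x) =ᶠ[𝓝 θ] fun η => f η x * pd r (logDensity f x) η := by
  filter_upwards [isOpen_interior.mem_nhds hθ] with η hη
  exact hm.pd_density x r hη

lemma RegularModel.diff_pd_density (hm : RegularModel μ f Θ) (x : 𝒳) (r : Fin p)
    {θ : Fin p → ℝ} (hθ : θ ∈ interior Θ) : DifferentiableAt ℝ (pd r (fun η => f η x)) θ :=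
  ((hm.diff_density x hθ).mul (hm.diff_one x r hθ)).congr_of_eventuallyEq
    (hm.pd_density_eventuallyEq x r hθ)

lemma RegularModel.pd_pd_density (hm : RegularModel μ f Θ) (x : 𝒳) (r s : Fin p)
    {θ : Fin p → ℝ} (hθ : θ ∈ interior Θ) :
    pd r (pd s (fun η => f η x)) θ = f θ x * (pd r (logDensity f x) θ * pd s (logDensity f x) θ)
      + f θ x * pd r (pd s (logDensity f x)) θ := by
  rw [pd_congr (hm.pd_density_eventuallyEq x s hθ),
    pd_mul (hm.diff_density x hθ) (hm.diff_one x s hθ), hm.pd_density x r hθ]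
  ring

lemma RegularModel.measurable_logDensity (hm : RegularModel μ f Θ) (θ : Fin p → ℝ) :
    Measurable fun x => logDensity f x θ :=
  (hm.measurable_density θ).log

lemma RegularModel.measurable_score (hm : RegularModel μ f Θ) (r : Fin p) {θ : Fin p → ℝ}
    (hθ : θ ∈ interior Θ) : Measurable fun x => pd r (logDensity f x) θ :=
  measurable_pd_param (G := fun η x => logDensity f x η) isOpen_interior
    (fun η _ => hm.measurable_logDensity η) (fun x _ hη => hm.diff_zero x hη) r hθ

lemma RegularModel.measurable_hess (hm : RegularModel μ f Θ) (r s : Fin p) {θ : Fin p → ℝ}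
    (hθ : θ ∈ interior Θ) : Measurable fun x => pd r (pd s (logDensity f x)) θ :=
  measurable_pd_param (G := fun η x => pd s (logDensity f x) η) isOpen_interior
    (fun _ hη => hm.measurable_score s hη) (fun x _ hη => hm.diff_one x s hη) r hθ

lemma RegularModel.measurable_third (hm : RegularModel μ f Θ) (r s t : Fin p) {θ : Fin p → ℝ}
    (hθ : θ ∈ interior Θ) : Measurable fun x => pd r (pd s (pd t (logDensity f x))) θ :=
  measurable_pd_param (G := fun η x => pd s (pd t (logDensity f x)) η) isOpen_interior
    (fun _ hη => hm.measurable_hess s t hη) (fun x _ hη => hm.diff_two x s t hη) r hθ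

lemma RegularModel.integrable_density (hm : RegularModel μ f Θ) {θ : Fin p → ℝ}
    (hθ : θ ∈ Θ) : Integrable (f θ) μ := by
  have := hm.isProbabilityMeasure_law hθ
  simpa using (hm.integrable_law_iff hθ (fun _ => 1)).1 (integrable_const 1)

lemma RegularModel.integral_density (hm : RegularModel μ f Θ) {θ : Fin p → ℝ}
    (hθ : θ ∈ Θ) : ∫ x, f θ x ∂μ = 1 := by
  have := hm.isProbabilityMeasure_law hθ
  simpa using (hm.integral_law hθ (fun _ => 1)).symm

/-! ### Identities for the Fisher information -/

lemma RegularModel.integrable_pd_density (hm : RegularModel μ f Θ) (r : Fin p) {θ : Fin p → ℝ}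
    (hθ : θ ∈ interior Θ) : Integrable (fun x => pd r (fun η => f η x) θ) μ :=
  (hasLineDerivAt_integral isOpen_interior (fun η _ => hm.measurable_density η)
    (fun x _ hη => hm.diff_density x hη) hθ (hm.integrable_density (interior_subset hθ))
    (hm.dom_one θ hθ r)).1

/-- Differentiate `∫ f = 1`, which holds on a neighbourhood of an interior point. -/
lemma RegularModel.integral_pd_density (hm : RegularModel μ f Θ) (r : Fin p) {θ : Fin p → ℝ}
    (hθ : θ ∈ interior Θ) : ∫ x, pd r (fun η => f η x) θ ∂μ = 0 := by
  have h1 := (hasLineDerivAt_integral isOpen_interior (fun η _ => hm.measurable_density η)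
    (fun x _ hη => hm.diff_density x hη) hθ (hm.integrable_density (interior_subset hθ))
    (hm.dom_one θ hθ r)).2
  have h2 : (fun η => ∫ x, f η x ∂μ) =ᶠ[𝓝 θ] fun _ => (1 : ℝ) := by
    filter_upwards [isOpen_interior.mem_nhds hθ] with η hη
    exact hm.integral_density (interior_subset hη)
  have h3 := h1.lineDeriv
  rw [h2.lineDeriv_eq] at h3
  simpa [lineDeriv] using h3.symm

lemma RegularModel.integral_score (hm : RegularModel μ f Θ) (r : Fin p) {θ : Fin p → ℝ}
    (hθ : θ ∈ interior Θ) : ∫ x, pd r (logDensity f x) θ ∂(law μ f θ) = 0 := by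
  rw [hm.integral_law (interior_subset hθ), ← hm.integral_pd_density r hθ]
  simp only [hm.pd_density _ r hθ]

lemma RegularModel.integral_pd_pd_density (hm : RegularModel μ f Θ) (r s : Fin p)
    {θ : Fin p → ℝ} (hθ : θ ∈ interior Θ) :
    ∫ x, pd r (pd s (fun η => f η x)) θ ∂μ = 0 := by
  have h1 := (hasLineDerivAt_integral (G := fun η x => pd s (fun η => f η x) η) isOpen_interior
    (fun η hη => measurable_pd_param isOpen_interior (fun η _ => hm.measurable_density η)
      (fun x _ hη => hm.diff_density x hη) s hη)
    (fun x _ hη => hm.diff_pd_density x s hη) hθ (hm.integrable_pd_density s hθ)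
    (hm.dom_two θ hθ r s)).2
  have h2 : (fun η => ∫ x, pd s (fun η => f η x) η ∂μ) =ᶠ[𝓝 θ] fun _ => (0 : ℝ) := by
    filter_upwards [isOpen_interior.mem_nhds hθ] with η hη
    exact hm.integral_pd_density s hη
  have h3 := h1.lineDeriv
  rw [h2.lineDeriv_eq] at h3
  simpa [lineDeriv] using h3.symm

lemma RegularModel.integrable_score_mul (hm : RegularModel μ f Θ) (r s : Fin p)
    {θ : Fin p → ℝ} (hθ : θ ∈ interior Θ) :
    Integrable (fun x => pd r (logDensity f x) θ * pd s (logDensity f x) θ) (law μ f θ) :=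
  (hm.score_sq θ hθ r).integrable_mul (hm.score_sq θ hθ s)

lemma RegularModel.integrable_hess (hm : RegularModel μ f Θ) (r s : Fin p)
    {θ : Fin p → ℝ} (hθ : θ ∈ interior Θ) :
    Integrable (fun x => pd r (pd s (logDensity f x)) θ) (law μ f θ) := by
  have := hm.isProbabilityMeasure_law (interior_subset hθ)
  exact (hm.hess_sq θ hθ r s).integrable (by norm_num)

/-- The information identity. -/
lemma RegularModel.fisher_eq_neg_integral_hess (hm : RegularModel μ f Θ) (r s : Fin p)
    {θ : Fin p → ℝ} (hθ : θ ∈ interior Θ) :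
    fisher μ f θ r s = -∫ x, pd r (pd s (logDensity f x)) θ ∂(law μ f θ) := by
  have hθ' := interior_subset hθ
  have h0 := hm.integral_pd_pd_density r s hθ
  simp only [hm.pd_pd_density _ r s hθ] at h0
  rw [integral_add ((hm.integrable_law_iff hθ' _).1 (hm.integrable_score_mul r s hθ))
    ((hm.integrable_law_iff hθ' _).1 (hm.integrable_hess r s hθ)), ← hm.integral_law hθ',
    ← hm.integral_law hθ'] at h0
  simp only [fisher, Matrix.of_apply]
  linarith

lemma RegularModel.integrable_hess_mul_score (hm : RegularModel μ f Θ) (r s t : Fin p)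
    {θ : Fin p → ℝ} (hθ : θ ∈ interior Θ) :
    Integrable (fun x => pd r (pd s (logDensity f x)) θ * pd t (logDensity f x) θ) (law μ f θ) :=
  (hm.hess_sq θ hθ r s).integrable_mul (hm.score_sq θ hθ t)

lemma RegularModel.integrable_third (hm : RegularModel μ f Θ) (r s t : Fin p)
    {θ : Fin p → ℝ} (hθ : θ ∈ interior Θ) :
    Integrable (fun x => pd r (pd s (pd t (logDensity f x))) θ) (law μ f θ) := by
  obtain ⟨V, hV, b, hb, hbound⟩ := hm.dom_third θ hθ r s t
  refine hb.mono' (hm.measurable_third r s t hθ).aestronglyMeasurable ?_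
  filter_upwards [hbound] with x hx
  exact hx θ (mem_of_mem_nhds hV)

/-- The information is differentiated as `-∫ f ∂_r∂_s log f`, not as a product of scores: this is
the integrand that `dom_hess` controls, and the product rule then yields just the two terms that
reappear in the expectation of `A_n`. -/
lemma RegularModel.pd_fisher (hm : RegularModel μ f Θ) (r s t : Fin p)
    {θ : Fin p → ℝ} (hθ : θ ∈ interior Θ) :
    pd t (fun θ' => fisher μ f θ' r s) θ = -(K μ f θ t r s
      + ∫ x, pd r (pd s (logDensity f x)) θ * pd t (logDensity f x) θ ∂(law μ f θ)) := by
  have hθ' := interior_subset hθ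
  have h1 := (hasLineDerivAt_integral (μ := μ)
    (G := fun η x => f η x * pd r (pd s (logDensity f x)) η) isOpen_interior
    (fun η hη => (hm.measurable_density η).mul (hm.measurable_hess r s hη))
    (fun x _ hη => (hm.diff_density x hη).mul (hm.diff_two x r s hη)) hθ
    ((hm.integrable_law_iff hθ' _).1 (hm.integrable_hess r s hθ))
    (hm.dom_hess θ hθ r s t)).2.lineDeriv
  have h2 : (fun θ' => fisher μ f θ' r s)
      =ᶠ[𝓝 θ] -(fun η => ∫ x, f η x * pd r (pd s (logDensity f x)) η ∂μ) := by
    filter_upwards [isOpen_interior.mem_nhds hθ] with η hη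
    rw [hm.fisher_eq_neg_integral_hess r s hη, hm.integral_law (interior_subset hη), Pi.neg_apply]
  rw [pd_congr h2]
  have h3 : pd t (-(fun η => ∫ x, f η x * pd r (pd s (logDensity f x)) η ∂μ)) θ
      = -pd t (fun η => ∫ x, f η x * pd r (pd s (logDensity f x)) η ∂μ) θ := by
    simp only [pd, lineDeriv, Pi.neg_apply]
    exact deriv.fun_neg
  rw [h3, pd, h1]
  congr 1
  have h4 : ∀ x, pd t (fun η => f η x * pd r (pd s (logDensity f x)) η) θ
      = f θ x * pd t (pd r (pd s (logDensity f x))) θ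
        + f θ x * (pd r (pd s (logDensity f x)) θ * pd t (logDensity f x) θ) := by
    intro x
    rw [pd_mul (hm.diff_density x hθ) (hm.diff_two x r s hθ), hm.pd_density x t hθ]
    ring
  simp only [h4]
  rw [integral_add ((hm.integrable_law_iff hθ' _).1 (hm.integrable_third t r s hθ))
    ((hm.integrable_law_iff hθ' _).1 (hm.integrable_hess_mul_score r s t hθ)),
    ← hm.integral_law hθ', ← hm.integral_law hθ', K]

lemma RegularModel.K_comm_left (hm : RegularModel μ f Θ) (r s t : Fin p)
    {θ : Fin p → ℝ} (hθ : θ ∈ interior Θ) : K μ f θ r s t = K μ f θ s r t := by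
  unfold K
  congr 1
  ext x
  exact pd_comm isOpen_interior (hm.smooth_one x t) hθ

lemma RegularModel.hess_comm (hm : RegularModel μ f Θ) (r s : Fin p) (x : 𝒳)
    {θ : Fin p → ℝ} (hθ : θ ∈ interior Θ) :
    pd r (pd s (logDensity f x)) θ = pd s (pd r (logDensity f x)) θ :=
  pd_comm isOpen_interior ((hm.smooth x).of_le (by norm_num)) hθ

lemma RegularModel.K_comm_right (hm : RegularModel μ f Θ) (r s t : Fin p)
    {θ : Fin p → ℝ} (hθ : θ ∈ interior Θ) : K μ f θ r s t = K μ f θ r t s := by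
  unfold K
  congr 1
  ext x
  refine pd_congr ?_
  filter_upwards [isOpen_interior.mem_nhds hθ] with η hη
  exact hm.hess_comm s t x hη

lemma fisher_comm (r s : Fin p) (θ : Fin p → ℝ) : fisher μ f θ r s = fisher μ f θ s r := by
  simp only [fisher, Matrix.of_apply, mul_comm]

/-- A Gram matrix of scores is positive semidefinite, its quadratic form being the second moment of
a combination of scores; non-singularity makes it definite. -/
lemma RegularModel.fisher_posDef (hm : RegularModel μ f Θ) {θ : Fin p → ℝ}
    (hθ : θ ∈ interior Θ) : (fisher μ f θ).PosDef := by
  have hps : (fisher μ f θ).PosSemidef := by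
    refine Matrix.PosSemidef.of_dotProduct_mulVec_nonneg ?_ fun c => ?_
    · ext r s
      simpa using fisher_comm s r θ
    · have : star c ⬝ᵥ (fisher μ f θ).mulVec c
          = ∫ x, (∑ r, c r * pd r (logDensity f x) θ) ^ 2 ∂(law μ f θ) := by
        simp only [star_trivial, dotProduct, Matrix.mulVec, fisher, Matrix.of_apply, sq,
          Finset.sum_mul_sum]
        rw [integral_finsetSum _ fun r _ => integrable_finsetSum _ fun s _ =>
          ((hm.integrable_score_mul r s hθ).const_mul (c r * c s)).congr
            (Eventually.of_forall fun x => by ring)]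
        · refine Finset.sum_congr rfl fun r _ => ?_
          rw [integral_finsetSum _ fun s _ => ?_, Finset.mul_sum]
          · refine Finset.sum_congr rfl fun s _ => ?_
            rw [mul_comm _ (c s), ← mul_assoc, ← integral_const_mul]
            congr 1; ext x; ring
          · exact ((hm.integrable_score_mul r s hθ).const_mul (c r * c s)).congr
              (Eventually.of_forall fun x => by ring)
      rw [this]
      exact integral_nonneg fun x => sq_nonneg _
  exact (hps.posDef_iff_isUnit).2 ((Matrix.isUnit_iff_isUnit_det _).2 (hm.fisher_nonsing θ hθ))

end Law

/-! ### Independent and identically distributed observations -/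

section IID

variable {𝒳 : Type*} [MeasurableSpace 𝒳] {ν : Measure 𝒳} [IsProbabilityMeasure ν]

lemma integrable_eval {g : 𝒳 → ℝ} (hg : Integrable g ν) (i : ℕ) :
    Integrable (fun ω : ℕ → 𝒳 => g (ω i)) (Measure.infinitePi fun _ : ℕ => ν) :=
  (measurePreserving_eval_infinitePi (fun _ : ℕ => ν) i).integrable_comp_of_integrable hg

lemma integral_eval {g : 𝒳 → ℝ} (hg : AEStronglyMeasurable g ν) (i : ℕ) :
    ∫ ω, g (ω i) ∂(Measure.infinitePi fun _ : ℕ => ν) = ∫ x, g x ∂ν := by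
  have h := measurePreserving_eval_infinitePi (fun _ : ℕ => ν) i
  have h2 := integral_map h.aemeasurable (f := g) (by rwa [h.map_eq])
  rw [h.map_eq] at h2
  exact h2.symm

lemma ae_eval {q : 𝒳 → Prop} (hq : ∀ᵐ x ∂ν, q x) :
    ∀ᵐ ω ∂(Measure.infinitePi fun _ : ℕ => ν), ∀ i, q (ω i) :=
  ae_all_iff.2 fun i =>
    (measurePreserving_eval_infinitePi (fun _ : ℕ => ν) i).quasiMeasurePreserving.ae hq

lemma indepFun_eval {a b : 𝒳 → ℝ} (ha : Measurable a) (hb : Measurable b) {i j : ℕ}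
    (hij : i ≠ j) :
    ProbabilityTheory.IndepFun (fun ω : ℕ → 𝒳 => a (ω i)) (fun ω => b (ω j))
      (Measure.infinitePi fun _ : ℕ => ν) :=
  ((ProbabilityTheory.iIndepFun_infinitePi (P := fun _ : ℕ => ν) (X := fun _ x => x)
    (fun _ => measurable_id)).indepFun hij).comp ha hb

lemma integrable_eval_mul_eval {a b : 𝒳 → ℝ} (ha : Measurable a) (hb : Measurable b)
    (ha2 : MemLp a 2 ν) (hb2 : MemLp b 2 ν) (i j : ℕ) :
    Integrable (fun ω : ℕ → 𝒳 => a (ω i) * b (ω j)) (Measure.infinitePi fun _ : ℕ => ν) := by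
  by_cases hij : i = j
  · subst hij
    exact integrable_eval (g := fun x => a x * b x) (ha2.integrable_mul hb2) i
  · exact (indepFun_eval ha hb hij).integrable_mul
      (integrable_eval (ha2.integrable (by norm_num)) i)
      (integrable_eval (hb2.integrable (by norm_num)) j)

/-- Independence factors the off-diagonal terms, and one centred factor suffices to kill them. So
`a` may be a second derivative, whose mean is not zero, as long as `b` is a score. -/
lemma integral_eval_mul_eval {a b : 𝒳 → ℝ} (ha : Measurable a) (hb : Measurable b)
    (hb0 : ∫ x, b x ∂ν = 0) (i j : ℕ) :
    ∫ ω, a (ω i) * b (ω j) ∂(Measure.infinitePi fun _ : ℕ => ν)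
      = if i = j then ∫ x, a x * b x ∂ν else 0 := by
  split_ifs with hij
  · subst hij
    exact integral_eval (g := fun x => a x * b x) (ha.mul hb).aestronglyMeasurable i
  · have := (indepFun_eval (ν := ν) ha hb hij).integral_fun_mul_eq_mul_integral
      (ha.comp (measurable_pi_apply i)).aestronglyMeasurable
      (hb.comp (measurable_pi_apply j)).aestronglyMeasurable
    rw [this, integral_eval hb.aestronglyMeasurable, hb0, mul_zero]

lemma integrable_sum_mul_sum {a b : 𝒳 → ℝ} (ha : Measurable a) (hb : Measurable b)
    (ha2 : MemLp a 2 ν) (hb2 : MemLp b 2 ν) (n : ℕ) :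
    Integrable (fun ω : ℕ → 𝒳 => (n : ℝ)⁻¹ * ((∑ i ∈ Finset.range n, a (ω i))
      * ∑ j ∈ Finset.range n, b (ω j))) (Measure.infinitePi fun _ : ℕ => ν) := by
  simp only [Finset.sum_mul_sum]
  exact (integrable_finsetSum _ fun i _ => integrable_finsetSum _ fun j _ =>
    integrable_eval_mul_eval ha hb ha2 hb2 i j).const_mul _

/-- Of the `n²` products only the `n` diagonal ones have nonzero mean, and the factor `n⁻¹` makes
the result exact. This yields the expectations of `In` and `Jn` with no error term. -/
lemma integral_sum_mul_sum {a b : 𝒳 → ℝ} (ha : Measurable a) (hb : Measurable b)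
    (ha2 : MemLp a 2 ν) (hb2 : MemLp b 2 ν) (hb0 : ∫ x, b x ∂ν = 0) {n : ℕ} (hn : n ≠ 0) :
    ∫ ω : ℕ → 𝒳, (n : ℝ)⁻¹ * ((∑ i ∈ Finset.range n, a (ω i))
      * ∑ j ∈ Finset.range n, b (ω j)) ∂(Measure.infinitePi fun _ : ℕ => ν)
      = ∫ x, a x * b x ∂ν := by
  simp only [Finset.sum_mul_sum]
  rw [integral_const_mul, integral_finsetSum _ fun i _ => integrable_finsetSum _ fun j _ =>
    integrable_eval_mul_eval ha hb ha2 hb2 i j]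
  have : ∀ i ∈ Finset.range n, ∫ ω : ℕ → 𝒳, ∑ j ∈ Finset.range n, a (ω i) * b (ω j)
      ∂(Measure.infinitePi fun _ : ℕ => ν) = ∫ x, a x * b x ∂ν := by
    intro i hi
    rw [integral_finsetSum _ fun j _ => integrable_eval_mul_eval ha hb ha2 hb2 i j]
    simp only [integral_eval_mul_eval ha hb hb0]
    rw [Finset.sum_ite_eq, if_pos hi]
  rw [Finset.sum_congr rfl this, Finset.sum_const, Finset.card_range, nsmul_eq_mul, ← mul_assoc,
    inv_mul_cancel₀ (Nat.cast_ne_zero.2 hn), one_mul]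

/-- Normalized sums of centred square integrable variables are bounded in probability. -/
lemma tight_normalized_sum {a : 𝒳 → ℝ} (ha : Measurable a) (ha2 : MemLp a 2 ν)
    (ha0 : ∫ x, a x ∂ν = 0) {ε : ENNReal} (hε : 0 < ε) :
    ∃ M : ℝ, 0 < M ∧ ∀ n : ℕ, (Measure.infinitePi fun _ : ℕ => ν)
      {ω | M < |(Real.sqrt n)⁻¹ * ∑ i ∈ Finset.range n, a (ω i)|} ≤ ε := by
  set V : ℝ := ∫ x, a x * a x ∂ν with hV
  have hV0 : 0 ≤ V := integral_nonneg fun x => mul_self_nonneg _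
  obtain ⟨δ, hδ, hδε⟩ : ∃ δ : ℝ, 0 < δ ∧ ENNReal.ofReal δ ≤ ε := by
    by_cases h : ε = ⊤
    · exact ⟨1, one_pos, by simp [h]⟩
    · exact ⟨ε.toReal, ENNReal.toReal_pos hε.ne' h, by rw [ENNReal.ofReal_toReal h]⟩
  -- Markov's inequality bounds the probability by `V / M²`, and `M² δ = V + δ`. The summand `1`
  -- keeps `M` positive when `V = 0`.
  set M : ℝ := Real.sqrt (V / δ + 1) with hM
  have hM2 : M ^ 2 = V / δ + 1 := Real.sq_sqrt (by positivity)
  refine ⟨M, Real.sqrt_pos.2 (by positivity), fun n => ?_⟩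
  rcases eq_or_ne n 0 with rfl | hn
  · have : ¬ M < 0 := not_lt.2 (Real.sqrt_nonneg _)
    simp [this]
  have hI := integrable_sum_mul_sum ha ha ha2 ha2 n
  have hE := integral_sum_mul_sum ha ha ha2 ha2 ha0 hn
  have hmk := mul_meas_ge_le_integral_of_nonneg (Eventually.of_forall fun ω =>
    mul_nonneg (inv_nonneg.2 n.cast_nonneg) (mul_self_nonneg _)) hI (M ^ 2)
  rw [hE, ← hV] at hmk
  have hsub : {ω : ℕ → 𝒳 | M < |(Real.sqrt n)⁻¹ * ∑ i ∈ Finset.range n, a (ω i)|}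
      ⊆ {ω | M ^ 2 ≤ (n : ℝ)⁻¹ * ((∑ i ∈ Finset.range n, a (ω i))
      * ∑ j ∈ Finset.range n, a (ω j))} := by
    intro ω hω
    simp only [Set.mem_ofPred_eq] at hω ⊢
    have h1 : M ^ 2 ≤ |(Real.sqrt n)⁻¹ * ∑ i ∈ Finset.range n, a (ω i)| ^ 2 :=
      pow_le_pow_left₀ (Real.sqrt_nonneg _) hω.le 2
    rw [sq_abs, mul_pow, inv_pow, Real.sq_sqrt n.cast_nonneg, sq (∑ i ∈ _, _)] at h1
    exact h1
  refine (measure_mono hsub).trans (le_trans ?_ hδε)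
  rw [← ofReal_measureReal]
  refine ENNReal.ofReal_le_ofReal ?_
  have h3 : V ≤ M ^ 2 * δ := by
    rw [hM2, add_mul, div_mul_cancel₀ _ hδ.ne']; linarith
  have h4 : 0 < M ^ 2 := by rw [hM2]; positivity
  nlinarith

lemma strong_law_eval {g : 𝒳 → ℝ} (hg : Measurable g) (hi : Integrable g ν) :
    ∀ᵐ ω ∂(Measure.infinitePi fun _ : ℕ => ν),
      Tendsto (fun n : ℕ => (n : ℝ)⁻¹ * ∑ i ∈ Finset.range n, g (ω i)) atTop
        (𝓝 (∫ x, g x ∂ν)) := by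
  have h := ProbabilityTheory.strong_law_ae_real (μ := Measure.infinitePi fun _ : ℕ => ν)
    (fun i ω => g (ω i)) (integrable_eval hi 0)
    (fun i j hij => indepFun_eval hg hg hij)
    (fun i => by
      refine ⟨(hg.comp (measurable_pi_apply i)).aemeasurable,
        (hg.comp (measurable_pi_apply 0)).aemeasurable, ?_⟩
      have := fun i : ℕ => Measure.map_map (μ := Measure.infinitePi fun _ : ℕ => ν) hg
        (measurable_pi_apply i)
      simp only [Measure.infinitePi_map_eval] at this
      exact (this i).symm.trans (this 0))
  filter_upwards [h] with ω hω
  rw [integral_eval hi.aestronglyMeasurable] at hω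
  simpa only [div_eq_inv_mul] using hω

/-- This allows the first `m` observations to be reserved for making the posterior integrable while
the separation condition is applied to the later ones. -/
lemma measurePreserving_shift (m : ℕ) :
    MeasurePreserving (fun (ω : ℕ → 𝒳) i => ω (i + m)) (Measure.infinitePi fun _ : ℕ => ν)
      (Measure.infinitePi fun _ : ℕ => ν) :=
  ⟨by fun_prop, Measure.map_infinitePi_infinitePi_of_inj (P := fun _ : ℕ => ν)
    (add_left_injective m)⟩

/-- A uniform strong law of large numbers near a point, for averages of locally dominated
functions that depend continuously on a parameter. -/
lemma uniform_strong_law_near {p : ℕ} {U : Set (Fin p → ℝ)} (hU : IsOpen U)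
    {g : (Fin p → ℝ) → 𝒳 → ℝ} {θ : Fin p → ℝ} (hθ : θ ∈ U) (hm : ∀ η ∈ U, Measurable (g η))
    (hc : ∀ x, ContinuousOn (fun η => g η x) U) (hdom : LocallyDominated ν g θ)
    {κ : ℝ} (hκ : 0 < κ) :
    ∃ ρ > 0, ∀ᵐ ω ∂(Measure.infinitePi fun _ : ℕ => ν), ∀ᶠ n : ℕ in atTop,
      ∀ η ∈ Metric.ball θ ρ,
        |(n : ℝ)⁻¹ * ∑ i ∈ Finset.range n, g η (ω i) - ∫ x, g θ x ∂ν| ≤ κ := by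
  obtain ⟨V, hV, b, hb, hbound⟩ := hdom
  obtain ⟨ρ₀, hρ₀, hball⟩ := Metric.mem_nhds_iff.1 (inter_mem (hU.mem_nhds hθ) hV)
  have hgi : Integrable (g θ) ν := by
    refine hb.mono' (hm θ hθ).aestronglyMeasurable ?_
    filter_upwards [hbound] with x hx
    exact hx θ (mem_of_mem_nhds hV)
  set D : ℕ → Fin p → ℝ := TopologicalSpace.denseSeq (Fin p → ℝ)
  set r : ℕ → ℝ := fun j => ρ₀ / (j + 1) with hr
  have hr0 : ∀ j, 0 < r j := fun j => by positivity
  have hrle : ∀ j, r j ≤ ρ₀ := fun j => div_le_self hρ₀.le (by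
    have : (0 : ℝ) ≤ j := j.cast_nonneg
    linarith)
  -- The oscillation of `g` over shrinking balls. The supremum runs over a dense sequence to be
  -- measurable; by continuity in the parameter it still controls the whole ball (`hEub`). Its
  -- expectation tends to zero by dominated convergence.
  set E : ℕ → 𝒳 → ENNReal := fun j x =>
    ⨆ k, ⨆ _ : D k ∈ Metric.ball θ (r j), ‖g (D k) x - g θ x‖ₑ with hE
  have hEm : ∀ j, Measurable (E j) := by
    intro j
    refine Measurable.iSup fun k => Measurable.iSup fun hk => ?_
    exact ((hm _ (hball (Metric.ball_subset_ball (hrle j) hk)).1).sub (hm θ hθ)).enorm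
  have hEub : ∀ x j, ∀ η ∈ Metric.ball θ (r j), ‖g η x - g θ x‖ₑ ≤ E j x := by
    intro x j η hη
    have hopen : IsOpen (Metric.ball θ (r j)) := Metric.isOpen_ball
    have hcl : η ∈ closure (Metric.ball θ (r j) ∩ Set.range D) :=
      (TopologicalSpace.denseRange_denseSeq _).open_subset_closure_inter hopen hη
    obtain ⟨u, hu, hlim⟩ := mem_closure_iff_seq_limit.1 hcl
    have hcont : ContinuousAt (fun η => g η x) η :=
      (hc x).continuousAt (hU.mem_nhds (hball (Metric.ball_subset_ball (hrle j) hη)).1)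
    have ht : Tendsto (fun k => ‖g (u k) x - g θ x‖ₑ) atTop (𝓝 ‖g η x - g θ x‖ₑ) :=
      ((hcont.tendsto.comp hlim).sub_const _).enorm
    refine le_of_tendsto ht (Eventually.of_forall fun k => ?_)
    obtain ⟨hk1, l, hl⟩ := hu k
    rw [← hl] at hk1 ⊢
    exact le_iSup₂ (f := fun k (_ : D k ∈ Metric.ball θ (r j)) => ‖g (D k) x - g θ x‖ₑ) l hk1
  have hEb : ∀ᵐ x ∂ν, ∀ j, E j x ≤ ENNReal.ofReal (2 * b x) := by
    filter_upwards [hbound] with x hx j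
    refine iSup₂_le fun k hk => ?_
    rw [← ofReal_norm]
    refine ENNReal.ofReal_le_ofReal ?_
    have h1 := hx _ (hball (Metric.ball_subset_ball (hrle j) hk)).2
    have h2 := hx θ (mem_of_mem_nhds hV)
    have h3 := abs_sub (g (D k) x) (g θ x)
    rw [Real.norm_eq_abs]
    linarith
  have hElim : ∀ x, Tendsto (fun j => E j x) atTop (𝓝 0) := by
    intro x
    rw [ENNReal.tendsto_nhds_zero]
    intro ε hε
    have hcont : ContinuousAt (fun η => g η x) θ := (hc x).continuousAt (hU.mem_nhds hθ)
    have ht : Tendsto (fun η => ‖g η x - g θ x‖ₑ) (𝓝 θ) (𝓝 0) := by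
      simpa using (hcont.tendsto.sub_const (g θ x)).enorm
    obtain ⟨s, hs, hsub⟩ := Metric.mem_nhds_iff.1 ((ENNReal.tendsto_nhds_zero.1 ht) ε hε)
    have hrlim : Tendsto r atTop (𝓝 0) := by
      have := (tendsto_one_div_add_atTop_nhds_zero_nat (𝕜 := ℝ)).const_mul ρ₀
      simpa [hr, div_eq_mul_inv] using this
    filter_upwards [hrlim.eventually (gt_mem_nhds hs)] with j hj
    exact iSup₂_le fun k hk => hsub (Metric.ball_subset_ball hj.le hk)
  have hIlim : Tendsto (fun j => ∫ x, (E j x).toReal ∂ν) atTop (𝓝 0) := by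
    have := tendsto_integral_of_dominated_convergence (μ := ν) (F := fun j x => (E j x).toReal)
      (f := fun _ => 0) (fun x => 2 * b x) (fun j => (hEm j).ennreal_toReal.aestronglyMeasurable)
      (hb.const_mul 2) (fun j => by
        filter_upwards [hEb, hbound] with x hx hx2
        rw [Real.norm_of_nonneg ENNReal.toReal_nonneg]
        exact ENNReal.toReal_le_of_le_ofReal
          (by linarith [abs_nonneg (g θ x), hx2 θ (mem_of_mem_nhds hV)]) (hx j))
      (Eventually.of_forall fun x => by
        simpa [Function.comp_def] using (ENNReal.tendsto_toReal ENNReal.zero_ne_top).comp (hElim x))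
    simpa using this
  have hEint : ∀ j, Integrable (fun x => (E j x).toReal) ν := by
    intro j
    refine (hb.const_mul 2).mono' (hEm j).ennreal_toReal.aestronglyMeasurable ?_
    filter_upwards [hEb, hbound] with x hx hx2
    rw [Real.norm_of_nonneg ENNReal.toReal_nonneg]
    exact ENNReal.toReal_le_of_le_ofReal
      (by linarith [abs_nonneg (g θ x), hx2 θ (mem_of_mem_nhds hV)]) (hx j)
  -- An expected oscillation below `κ/4` makes its empirical average eventually smaller than `κ/2`.
  -- The other `κ/2` is spent on the strong law at `θ` itself.
  obtain ⟨j, hj⟩ := (hIlim.eventually (gt_mem_nhds (half_pos (half_pos hκ)))).exists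
  refine ⟨r j, hr0 j, ?_⟩
  have hfin : ∀ᵐ x ∂ν, E j x ≠ ⊤ := by
    filter_upwards [hEb] with x hx
    exact ((hx j).trans_lt ENNReal.ofReal_lt_top).ne
  filter_upwards [strong_law_eval (hm θ hθ) hgi,
    strong_law_eval (hEm j).ennreal_toReal (hEint j), ae_eval hfin] with ω h1 h2 h3
  filter_upwards [h1.eventually (Metric.ball_mem_nhds _ (half_pos hκ)),
    h2.eventually (gt_mem_nhds (hj.trans (half_lt_self (half_pos hκ))))] with n hn1 hn2 η hη
  rw [Real.dist_eq] at hn1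
  have h4 : |(n : ℝ)⁻¹ * ∑ i ∈ Finset.range n, g η (ω i)
      - (n : ℝ)⁻¹ * ∑ i ∈ Finset.range n, g θ (ω i)| ≤ κ / 2 := by
    rw [← mul_sub, ← Finset.sum_sub_distrib, abs_mul, abs_of_nonneg (by positivity)]
    refine le_trans ?_ hn2.le
    refine mul_le_mul_of_nonneg_left ?_ (by positivity)
    refine (Finset.abs_sum_le_sum_abs _ _).trans (Finset.sum_le_sum fun i _ => ?_)
    have h5 := ENNReal.toReal_mono (h3 i) (hEub (ω i) j η hη)
    rwa [toReal_enorm, Real.norm_eq_abs] at h5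
  have h6 := abs_add_le ((n : ℝ)⁻¹ * ∑ i ∈ Finset.range n, g η (ω i)
      - (n : ℝ)⁻¹ * ∑ i ∈ Finset.range n, g θ (ω i))
      ((n : ℝ)⁻¹ * ∑ i ∈ Finset.range n, g θ (ω i) - ∫ x, g θ x ∂ν)
  rw [sub_add_sub_cancel] at h6
  linarith

end IID

/-! ### Functions of at most exponential growth -/

/-- Continuous functions with `|q t| ≤ C exp(A ‖t‖)`. -/
def ExpGrowth {p : ℕ} (q : (Fin p → ℝ) → ℝ) : Prop :=
  Continuous q ∧ ∃ C A : ℝ, ∀ t, |q t| ≤ C * Real.exp (A * ‖t‖)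

lemma ExpGrowth.const {p : ℕ} (a : ℝ) : ExpGrowth fun _ : Fin p → ℝ => a :=
  ⟨continuous_const, |a|, 0, fun t => by simp⟩

lemma ExpGrowth.coord {p : ℕ} (i : Fin p) : ExpGrowth fun t : Fin p → ℝ => t i :=
  ⟨continuous_apply i, 1, 1, fun t => by
    have h1 : ‖t i‖ ≤ ‖t‖ := norm_le_pi_norm t i
    have h2 := Real.add_one_le_exp ‖t‖
    rw [Real.norm_eq_abs] at h1
    simp only [one_mul]
    linarith⟩

lemma ExpGrowth.add {p : ℕ} {q q' : (Fin p → ℝ) → ℝ} (h : ExpGrowth q) (h' : ExpGrowth q') :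
    ExpGrowth fun t => q t + q' t := by
  obtain ⟨hc, C, A, hb⟩ := h
  obtain ⟨hc', C', A', hb'⟩ := h'
  refine ⟨hc.add hc', |C| + |C'|, max A A', fun t => ?_⟩
  have e1 : Real.exp (A * ‖t‖) ≤ Real.exp (max A A' * ‖t‖) :=
    Real.exp_le_exp.2 (mul_le_mul_of_nonneg_right (le_max_left _ _) (norm_nonneg _))
  have e2 : Real.exp (A' * ‖t‖) ≤ Real.exp (max A A' * ‖t‖) :=
    Real.exp_le_exp.2 (mul_le_mul_of_nonneg_right (le_max_right _ _) (norm_nonneg _))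
  have b1 : C * Real.exp (A * ‖t‖) ≤ |C| * Real.exp (max A A' * ‖t‖) :=
    mul_le_mul (le_abs_self _) e1 (Real.exp_pos _).le (abs_nonneg _)
  have b2 : C' * Real.exp (A' * ‖t‖) ≤ |C'| * Real.exp (max A A' * ‖t‖) :=
    mul_le_mul (le_abs_self _) e2 (Real.exp_pos _).le (abs_nonneg _)
  rw [add_mul]
  linarith [abs_add_le (q t) (q' t), hb t, hb' t]

lemma ExpGrowth.mul {p : ℕ} {q q' : (Fin p → ℝ) → ℝ} (h : ExpGrowth q) (h' : ExpGrowth q') :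
    ExpGrowth fun t => q t * q' t := by
  obtain ⟨hc, C, A, hb⟩ := h
  obtain ⟨hc', C', A', hb'⟩ := h'
  refine ⟨hc.mul hc', C * C', A + A', fun t => ?_⟩
  rw [abs_mul, add_mul, Real.exp_add]
  calc |q t| * |q' t| ≤ (C * Real.exp (A * ‖t‖)) * (C' * Real.exp (A' * ‖t‖)) :=
        mul_le_mul (hb t) (hb' t) (abs_nonneg _) ((abs_nonneg _).trans (hb t))
    _ = _ := by ring

lemma ExpGrowth.sum {p : ℕ} {ι : Type*} {s : Finset ι} {q : ι → (Fin p → ℝ) → ℝ}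
    (h : ∀ i ∈ s, ExpGrowth (q i)) : ExpGrowth fun t => ∑ i ∈ s, q i t := by
  classical
  induction s using Finset.induction_on with
  | empty => simpa using ExpGrowth.const 0
  | insert a s ha ih =>
    simp only [Finset.sum_insert ha]
    exact (h a (Finset.mem_insert_self _ _)).add
      (ih fun i hi => h i (Finset.mem_insert_of_mem hi))

lemma ExpGrowth.const_mul {p : ℕ} {q : (Fin p → ℝ) → ℝ} (h : ExpGrowth q) (a : ℝ) :
    ExpGrowth fun t => a * q t :=
  (ExpGrowth.const a).mul h

/-! ### Gaussian weights -/

/-- Half of the quadratic term absorbs `A ‖t‖` by completing the square; the other half dominates a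
sum of squared coordinates, so a product of one-dimensional Gaussians is a majorant. The norm is the
supremum norm, whence the factor in `b`; `p + 1` replaces `p` to allow dimension zero. -/
lemma integrable_exp_norm_sub_norm_sq {p : ℕ} (A : ℝ) {c : ℝ} (hc : 0 < c) :
    Integrable fun t : Fin p → ℝ => Real.exp (A * ‖t‖ - c * ‖t‖ ^ 2) := by
  set b : ℝ := c / (2 * (p + 1)) with hb
  have hb0 : 0 < b := by positivity
  have h1 : Integrable fun t : Fin p → ℝ => ∏ i, Real.exp (-b * (t i) ^ 2) :=
    Integrable.fintype_prod fun _ => integrable_exp_neg_mul_sq hb0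
  refine (h1.const_mul (Real.exp (A ^ 2 / (2 * c)))).mono' (by fun_prop)
    (Eventually.of_forall fun t => ?_)
  rw [Real.norm_of_nonneg (Real.exp_pos _).le, ← Real.exp_sum, ← Real.exp_add, Real.exp_le_exp,
    ← Finset.mul_sum]
  have h2 : ∑ i, (t i) ^ 2 ≤ (p + 1) * ‖t‖ ^ 2 := by
    calc ∑ i, (t i) ^ 2 ≤ ∑ _i : Fin p, ‖t‖ ^ 2 := Finset.sum_le_sum fun i _ => by
          have := norm_le_pi_norm t i
          rw [Real.norm_eq_abs] at this
          rw [← sq_abs]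
          exact pow_le_pow_left₀ (abs_nonneg _) this 2
      _ = p * ‖t‖ ^ 2 := by simp
      _ ≤ _ := by nlinarith [sq_nonneg ‖t‖]
  have h3 : b * ∑ i, (t i) ^ 2 ≤ c / 2 * ‖t‖ ^ 2 := by
    calc b * ∑ i, (t i) ^ 2 ≤ b * ((p + 1) * ‖t‖ ^ 2) := mul_le_mul_of_nonneg_left h2 hb0.le
      _ = _ := by rw [hb]; field_simp
  have h4 : A * ‖t‖ ≤ A ^ 2 / (2 * c) + c / 2 * ‖t‖ ^ 2 := by
    have : A ^ 2 / (2 * c) + c / 2 * ‖t‖ ^ 2 - A * ‖t‖ = (A - c * ‖t‖) ^ 2 / (2 * c) := by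
      field_simp; ring
    have h5 : 0 ≤ (A - c * ‖t‖) ^ 2 / (2 * c) := by positivity
    linarith
  linarith

/-- The constant is the minimum of the form on the compact unit sphere, extended by homogeneity. In
dimension zero the sphere is empty. -/
lemma exists_pos_mul_norm_sq_le {p : ℕ} {J : Matrix (Fin p) (Fin p) ℝ} (hJ : J.PosDef) :
    ∃ c > 0, ∀ t, c * ‖t‖ ^ 2 ≤ t ⬝ᵥ J.mulVec t := by
  have hpos : ∀ t : Fin p → ℝ, t ≠ 0 → 0 < t ⬝ᵥ J.mulVec t := fun t ht => by
    simpa using hJ.dotProduct_mulVec_pos ht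
  have hcont : Continuous fun t : Fin p → ℝ => t ⬝ᵥ J.mulVec t := by
    simp only [dotProduct, Matrix.mulVec]; fun_prop
  rcases (Metric.sphere (0 : Fin p → ℝ) 1).eq_empty_or_nonempty with he | hne
  · refine ⟨1, one_pos, fun t => ?_⟩
    by_cases ht : t = 0
    · simp [ht]
    · exfalso
      have : ‖t‖⁻¹ • t ∈ Metric.sphere (0 : Fin p → ℝ) 1 := by
        simp [norm_smul, inv_mul_cancel₀ (norm_ne_zero_iff.2 ht)]
      rw [he] at this
      exact this
  · obtain ⟨t₀, ht₀, hmin⟩ := (isCompact_sphere (0 : Fin p → ℝ) 1).exists_isMinOn hne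
      hcont.continuousOn
    have ht₀' : t₀ ≠ 0 := by
      rintro rfl
      simp at ht₀
    refine ⟨t₀ ⬝ᵥ J.mulVec t₀, hpos _ ht₀', fun t => ?_⟩
    by_cases ht : t = 0
    · simp [ht]
    · have hm : ‖t‖⁻¹ • t ∈ Metric.sphere (0 : Fin p → ℝ) 1 := by
        simp [norm_smul, inv_mul_cancel₀ (norm_ne_zero_iff.2 ht)]
      have h1 : t₀ ⬝ᵥ J.mulVec t₀ ≤ (‖t‖⁻¹ • t) ⬝ᵥ J.mulVec (‖t‖⁻¹ • t) := hmin hm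
      rw [Matrix.mulVec_smul, dotProduct_smul, smul_dotProduct, smul_eq_mul, smul_eq_mul] at h1
      have h2 : 0 < ‖t‖ := norm_pos_iff.2 ht
      calc (t₀ ⬝ᵥ J.mulVec t₀) * ‖t‖ ^ 2
          ≤ (‖t‖⁻¹ * (‖t‖⁻¹ * (t ⬝ᵥ J.mulVec t))) * ‖t‖ ^ 2 :=
            mul_le_mul_of_nonneg_right h1 (by positivity)
        _ = _ := by field_simp

/-- The unnormalized Gaussian density `exp(z·t - ½ t·Jt)`. -/
noncomputable def gaussWeight {p : ℕ} (J : Matrix (Fin p) (Fin p) ℝ) (z t : Fin p → ℝ) : ℝ :=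
  Real.exp (z ⬝ᵥ t - (t ⬝ᵥ J.mulVec t) / 2)

lemma gaussWeight_pos {p : ℕ} (J : Matrix (Fin p) (Fin p) ℝ) (z t : Fin p → ℝ) :
    0 < gaussWeight J z t :=
  Real.exp_pos _

lemma continuous_gaussWeight {p : ℕ} (J : Matrix (Fin p) (Fin p) ℝ) (z : Fin p → ℝ) :
    Continuous (gaussWeight J z) := by
  unfold gaussWeight
  simp only [dotProduct, Matrix.mulVec]
  fun_prop

lemma abs_dotProduct_le {p : ℕ} (z t : Fin p → ℝ) : |z ⬝ᵥ t| ≤ p * ‖z‖ * ‖t‖ := by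
  calc |z ⬝ᵥ t| ≤ ∑ i, |z i * t i| := Finset.abs_sum_le_sum_abs _ _
    _ ≤ ∑ _i : Fin p, ‖z‖ * ‖t‖ := Finset.sum_le_sum fun i _ => by
        rw [abs_mul]
        exact mul_le_mul (norm_le_pi_norm z i) (norm_le_pi_norm t i) (abs_nonneg _)
          (norm_nonneg _)
    _ = _ := by simp [mul_assoc]

lemma gaussWeight_le {p : ℕ} {J : Matrix (Fin p) (Fin p) ℝ} {c : ℝ}
    (hc : ∀ t, c * ‖t‖ ^ 2 ≤ t ⬝ᵥ J.mulVec t) {z : Fin p → ℝ} {M : ℝ} (hz : ‖z‖ ≤ M)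
    (t : Fin p → ℝ) : gaussWeight J z t ≤ Real.exp (p * M * ‖t‖ - c / 2 * ‖t‖ ^ 2) := by
  refine Real.exp_le_exp.2 ?_
  have h1 := (le_abs_self _).trans (abs_dotProduct_le z t)
  have h2 : (p : ℝ) * ‖z‖ * ‖t‖ ≤ p * M * ‖t‖ := by gcongr
  linarith [hc t]

/-- Gaussian decay beats any exponential. The class `ExpGrowth` contains polynomials and is closed
under sums and products, so all integrability questions about moments reduce to this. -/
lemma ExpGrowth.integrable_mul_gaussWeight {p : ℕ} {J : Matrix (Fin p) (Fin p) ℝ}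
    (hJ : J.PosDef) (z : Fin p → ℝ) {q : (Fin p → ℝ) → ℝ} (hq : ExpGrowth q) :
    Integrable fun t => q t * gaussWeight J z t := by
  obtain ⟨c, hc, hcJ⟩ := exists_pos_mul_norm_sq_le hJ
  obtain ⟨hcont, C, A, hb⟩ := hq
  refine ((integrable_exp_norm_sub_norm_sq (p := p) (A + p * ‖z‖) (half_pos hc)).const_mul
    C).mono' (hcont.mul (continuous_gaussWeight J z)).aestronglyMeasurable
    (Eventually.of_forall fun t => ?_)
  rw [norm_mul, Real.norm_eq_abs, Real.norm_of_nonneg (gaussWeight_pos J z t).le]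
  calc |q t| * gaussWeight J z t
      ≤ (C * Real.exp (A * ‖t‖)) * Real.exp (p * ‖z‖ * ‖t‖ - c / 2 * ‖t‖ ^ 2) :=
        mul_le_mul (hb t) (gaussWeight_le hcJ le_rfl t) (gaussWeight_pos J z t).le
          ((abs_nonneg _).trans (hb t))
    _ = _ := by rw [mul_assoc, ← Real.exp_add]; congr 2; ring

lemma integrable_gaussWeight {p : ℕ} {J : Matrix (Fin p) (Fin p) ℝ}
    (hJ : J.PosDef) (z : Fin p → ℝ) : Integrable (gaussWeight J z) := by
  simpa using (ExpGrowth.const (p := p) 1).integrable_mul_gaussWeight hJ z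

/-! ### Directional derivatives of polynomials and Gaussian weights, Stein's identity and moments -/

lemma hasLineDerivAt_coord {p : ℕ} (u r : Fin p) (t : Fin p → ℝ) :
    HasLineDerivAt ℝ (fun t : Fin p → ℝ => t r) (if u = r then 1 else 0) t (Pi.single u 1) := by
  have h : HasDerivAt (fun s : ℝ => t r + s * (if u = r then 1 else 0))
      (1 * (if u = r then 1 else 0)) 0 := ((hasDerivAt_id (0 : ℝ)).mul_const _).const_add _
  rw [one_mul] at h
  refine h.congr_of_eventuallyEq (Eventually.of_forall fun s => ?_)
  simp [Pi.single_apply, eq_comm]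

lemma HasLineDerivAt.fun_mul {p : ℕ} {q q' : (Fin p → ℝ) → ℝ} {d d' : ℝ} {t v : Fin p → ℝ}
    (h : HasLineDerivAt ℝ q d t v) (h' : HasLineDerivAt ℝ q' d' t v) :
    HasLineDerivAt ℝ (fun t => q t * q' t) (d * q' t + q t * d') t v := by
  have := HasDerivAt.fun_mul h h'
  simpa [HasLineDerivAt] using this

lemma HasLineDerivAt.fun_sum {p : ℕ} {ι : Type*} {s : Finset ι} {q : ι → (Fin p → ℝ) → ℝ}
    {d : ι → ℝ} {t v : Fin p → ℝ} (h : ∀ i ∈ s, HasLineDerivAt ℝ (q i) (d i) t v) :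
    HasLineDerivAt ℝ (fun t => ∑ i ∈ s, q i t) (∑ i ∈ s, d i) t v :=
  HasDerivAt.fun_sum h

lemma HasLineDerivAt.const_mul {p : ℕ} {q : (Fin p → ℝ) → ℝ} {d : ℝ} {t v : Fin p → ℝ}
    (h : HasLineDerivAt ℝ q d t v) (a : ℝ) : HasLineDerivAt ℝ (fun t => a * q t) (a * d) t v :=
  HasDerivAt.const_mul a h

lemma hasLineDerivAt_linear {p : ℕ} (a : Fin p → ℝ) (u : Fin p) (t : Fin p → ℝ) :
    HasLineDerivAt ℝ (fun t : Fin p → ℝ => ∑ r, a r * t r) (a u) t (Pi.single u 1) := by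
  have := HasLineDerivAt.fun_sum (s := Finset.univ)
    fun r _ => HasLineDerivAt.const_mul (hasLineDerivAt_coord u r t) (a r)
  simpa using this

lemma hasLineDerivAt_quadratic {p : ℕ} {D : Fin p → Fin p → ℝ} (hD : ∀ r s, D r s = D s r)
    (u : Fin p) (t : Fin p → ℝ) :
    HasLineDerivAt ℝ (fun t : Fin p → ℝ => ∑ r, ∑ s, D r s * (t r * t s))
      (2 * ∑ s, D u s * t s) t (Pi.single u 1) := by
  have := HasLineDerivAt.fun_sum (s := Finset.univ) fun r _ =>
    HasLineDerivAt.fun_sum (s := Finset.univ) fun s _ =>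
    HasLineDerivAt.const_mul (HasLineDerivAt.fun_mul (hasLineDerivAt_coord u r t)
      (hasLineDerivAt_coord u s t)) (D r s)
  convert! this using 1
  simp only [mul_add, Finset.sum_add_distrib, ite_mul, mul_ite, one_mul, zero_mul, mul_one,
    mul_zero, Finset.sum_ite_eq, Finset.mem_univ, if_true]
  rw [Finset.sum_comm]
  simp only [Finset.sum_ite_eq, Finset.mem_univ, if_true]
  rw [two_mul]
  congr 1
  exact Finset.sum_congr rfl fun r _ => by rw [hD]

lemma hasLineDerivAt_cubic {p : ℕ} {T : Fin p → Fin p → Fin p → ℝ}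
    (h12 : ∀ r s t, T r s t = T s r t) (h23 : ∀ r s t, T r s t = T r t s)
    (u : Fin p) (t : Fin p → ℝ) :
    HasLineDerivAt ℝ (fun t : Fin p → ℝ => ∑ a, ∑ b, ∑ c, T a b c * (t a * t b * t c))
      (3 * ∑ b, ∑ c, T u b c * (t b * t c)) t (Pi.single u 1) := by
  have := HasLineDerivAt.fun_sum (s := Finset.univ) fun a _ =>
    HasLineDerivAt.fun_sum (s := Finset.univ) fun b _ =>
    HasLineDerivAt.fun_sum (s := Finset.univ) fun c _ =>
    HasLineDerivAt.const_mul (HasLineDerivAt.fun_mul (HasLineDerivAt.fun_mul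
      (hasLineDerivAt_coord u a t) (hasLineDerivAt_coord u b t))
      (hasLineDerivAt_coord u c t)) (T a b c)
  convert! this using 1
  have e1 : ∑ a, ∑ b, ∑ c, T a b c * ((if u = a then 1 else 0) * t b * t c)
      = ∑ b, ∑ c, T u b c * (t b * t c) := by
    rw [Finset.sum_comm]
    refine Finset.sum_congr rfl fun b _ => ?_
    rw [Finset.sum_comm]
    refine Finset.sum_congr rfl fun c _ => ?_
    simp
  have e2 : ∑ a, ∑ b, ∑ c, T a b c * (t a * (if u = b then 1 else 0) * t c)
      = ∑ b, ∑ c, T u b c * (t b * t c) := by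
    refine Finset.sum_congr rfl fun a _ => ?_
    rw [Finset.sum_comm]
    refine Finset.sum_congr rfl fun c _ => ?_
    simp [h12 a u c]
  have e3 : ∑ a, ∑ b, ∑ c, T a b c * (t a * t b * (if u = c then 1 else 0))
      = ∑ b, ∑ c, T u b c * (t b * t c) := by
    refine Finset.sum_congr rfl fun a _ => Finset.sum_congr rfl fun b _ => ?_
    simp [h23 a b u, h12 a u b]
  trans (∑ a, ∑ b, ∑ c, T a b c * ((if u = a then 1 else 0) * t b * t c))
    + (∑ a, ∑ b, ∑ c, T a b c * (t a * (if u = b then 1 else 0) * t c))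
    + ∑ a, ∑ b, ∑ c, T a b c * (t a * t b * (if u = c then 1 else 0))
  · rw [e1, e2, e3]; ring
  simp only [← Finset.sum_add_distrib]
  exact Finset.sum_congr rfl fun a _ => Finset.sum_congr rfl fun b _ =>
    Finset.sum_congr rfl fun c _ => by ring

lemma hasLineDerivAt_gaussWeight {p : ℕ} {J : Matrix (Fin p) (Fin p) ℝ}
    (hJ : ∀ r s, J r s = J s r) (z : Fin p → ℝ) (u : Fin p) (t : Fin p → ℝ) :
    HasLineDerivAt ℝ (gaussWeight J z) (-((J.mulVec t u - z u) * gaussWeight J z t)) t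
      (Pi.single u 1) := by
  have h1 := hasLineDerivAt_linear z u t
  have h2 := (hasLineDerivAt_quadratic (D := J) hJ u t).const_mul (1 / 2)
  have h3 := HasDerivAt.exp (HasDerivAt.fun_sub h1 h2)
  have e : ∀ t : Fin p → ℝ, (∑ r, z r * t r) - 1 / 2 * ∑ r, ∑ s, J r s * (t r * t s)
      = z ⬝ᵥ t - (t ⬝ᵥ J.mulVec t) / 2 := by
    intro t
    simp only [dotProduct, Matrix.mulVec, Finset.mul_sum]
    congr 1
    rw [Finset.sum_div]
    refine Finset.sum_congr rfl fun r _ => ?_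
    rw [Finset.sum_div]
    exact Finset.sum_congr rfl fun s _ => by ring
  simp only [e, zero_smul, add_zero] at h3
  refine HasDerivAt.congr_deriv h3 ?_
  simp only [gaussWeight, Matrix.mulVec, dotProduct]
  ring

/-- Stein's identity: integration by parts against a Gaussian weight. -/
lemma stein_gaussWeight {p : ℕ} {J : Matrix (Fin p) (Fin p) ℝ} (hJ : J.PosDef) (z : Fin p → ℝ)
    {q q' : (Fin p → ℝ) → ℝ} (u : Fin p) (hq : ExpGrowth q) (hq' : ExpGrowth q')
    (hd : ∀ t, HasLineDerivAt ℝ q (q' t) t (Pi.single u 1)) :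
    ∫ t, q t * ((J.mulVec t u - z u) * gaussWeight J z t) = ∫ t, q' t * gaussWeight J z t := by
  have hs : ∀ r s, J r s = J s r := fun r s => by
    have := congrFun (congrFun hJ.isHermitian r) s
    simpa [Matrix.conjTranspose_apply] using this.symm
  have hlin : ExpGrowth fun t => J.mulVec t u - z u := by
    have : ExpGrowth fun t : Fin p → ℝ => (∑ s, J u s * t s) + (-z u) :=
      (ExpGrowth.sum fun s _ => (ExpGrowth.coord s).const_mul _).add (ExpGrowth.const _)
    simpa [Matrix.mulVec, dotProduct, sub_eq_add_neg] using this
  have key := integral_bilinear_hasLineDerivAt_right_eq_neg_left_of_integrable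
    (μ := (volume : Measure (Fin p → ℝ))) (B := ContinuousLinearMap.mul ℝ ℝ) (f := q) (f' := q')
    (g := gaussWeight J z) (g' := fun t => -((J.mulVec t u - z u) * gaussWeight J z t))
    (v := Pi.single u 1)
    (by simpa using hq'.integrable_mul_gaussWeight hJ z)
    (by
      have := ((hq.mul hlin).integrable_mul_gaussWeight hJ z).neg
      refine this.congr (Eventually.of_forall fun t => ?_)
      simp; ring)
    (by simpa using hq.integrable_mul_gaussWeight hJ z)
    (fun t _ => hd t) (fun t _ => hasLineDerivAt_gaussWeight hs z u t)
  simp only [ContinuousLinearMap.mul_apply', mul_neg, integral_neg, neg_inj] at key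
  exact key

/-- Stein's identity solved for the centred coordinate, using `t - J⁻¹z = J⁻¹(Jt - z)`: the
unnormalized form of `cov(t, q) = J⁻¹ E∇q`. Taking `q = 1` and `q = t_s` gives the first and second
moments. -/
lemma integral_sub_mul_gaussWeight {p : ℕ} {J : Matrix (Fin p) (Fin p) ℝ} (hJ : J.PosDef)
    (z : Fin p → ℝ) {q : (Fin p → ℝ) → ℝ} {q' : Fin p → (Fin p → ℝ) → ℝ} (hq : ExpGrowth q)
    (hq' : ∀ u, ExpGrowth (q' u)) (hd : ∀ u t, HasLineDerivAt ℝ q (q' u t) t (Pi.single u 1))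
    (v : Fin p) :
    ∫ t, (t v - J⁻¹.mulVec z v) * (q t * gaussWeight J z t)
      = ∑ u, J⁻¹ v u * ∫ t, q' u t * gaussWeight J z t := by
  have hlin : ∀ u, ExpGrowth fun t => J.mulVec t u - z u := fun u => by
    have : ExpGrowth fun t : Fin p → ℝ => (∑ s, J u s * t s) + (-z u) :=
      (ExpGrowth.sum fun s _ => (ExpGrowth.coord s).const_mul _).add (ExpGrowth.const _)
    simpa [Matrix.mulVec, dotProduct, sub_eq_add_neg] using this
  have hdet : IsUnit J.det := (Matrix.isUnit_iff_isUnit_det _).1 hJ.isUnit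
  have e : ∀ t : Fin p → ℝ, t v - J⁻¹.mulVec z v = ∑ u, J⁻¹ v u * (J.mulVec t u - z u) := by
    intro t
    have h1 : J⁻¹.mulVec (J.mulVec t - z) v = t v - J⁻¹.mulVec z v := by
      rw [Matrix.mulVec_sub, Matrix.mulVec_mulVec, Matrix.nonsing_inv_mul _ hdet, Matrix.one_mulVec]
      rfl
    rw [← h1]
    rfl
  have hint : ∀ u, Integrable fun t => q t * ((J.mulVec t u - z u) * gaussWeight J z t) := by
    intro u
    simpa [mul_assoc] using (hq.mul (hlin u)).integrable_mul_gaussWeight hJ z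
  simp only [e, Finset.sum_mul]
  rw [integral_finsetSum]
  · refine Finset.sum_congr rfl fun u _ => ?_
    rw [← stein_gaussWeight hJ z u hq (hq' u) (hd u), ← integral_const_mul]
    congr 1; ext t; ring
  · intro u _
    refine ((hint u).const_mul (J⁻¹ v u)).congr (Eventually.of_forall fun t => ?_)
    simp only; ring

lemma integral_coord_gaussWeight {p : ℕ} {J : Matrix (Fin p) (Fin p) ℝ} (hJ : J.PosDef)
    (z : Fin p → ℝ) (v : Fin p) :
    ∫ t, t v * gaussWeight J z t = J⁻¹.mulVec z v * ∫ t, gaussWeight J z t := by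
  have h := integral_sub_mul_gaussWeight hJ z (q := fun _ => 1) (q' := fun _ _ => 0)
    (ExpGrowth.const 1) (fun _ => ExpGrowth.const 0)
    (fun u t => by simpa [HasLineDerivAt] using hasDerivAt_const (0 : ℝ) (1 : ℝ)) v
  simp only [sub_mul, one_mul, zero_mul, integral_zero, mul_zero, Finset.sum_const_zero] at h
  rw [integral_sub ((ExpGrowth.coord v).integrable_mul_gaussWeight hJ z)
    ((integrable_gaussWeight hJ z).const_mul _), integral_const_mul] at h
  linarith

lemma integral_coord_mul_coord_gaussWeight {p : ℕ} {J : Matrix (Fin p) (Fin p) ℝ} (hJ : J.PosDef)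
    (z : Fin p → ℝ) (v s : Fin p) :
    ∫ t, t v * t s * gaussWeight J z t
      = (J⁻¹.mulVec z v * J⁻¹.mulVec z s + J⁻¹ v s) * ∫ t, gaussWeight J z t := by
  have h := integral_sub_mul_gaussWeight hJ z (q := fun t => t s)
    (q' := fun u _ => if u = s then 1 else 0)
    (ExpGrowth.coord s) (fun _ => ExpGrowth.const _) (fun u t => hasLineDerivAt_coord u s t) v
  have e : ∀ t : Fin p → ℝ, (t v - J⁻¹.mulVec z v) * (t s * gaussWeight J z t)
      = t v * t s * gaussWeight J z t - J⁻¹.mulVec z v * (t s * gaussWeight J z t) := by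
    intro t; ring
  simp only [e] at h
  rw [integral_sub (((ExpGrowth.coord v).mul (ExpGrowth.coord s)).integrable_mul_gaussWeight hJ z)
    (((ExpGrowth.coord s).integrable_mul_gaussWeight hJ z).const_mul _), integral_const_mul,
    integral_coord_gaussWeight hJ] at h
  have e2 : ∑ u, J⁻¹ v u * ∫ t, (if u = s then (1 : ℝ) else 0) * gaussWeight J z t
      = J⁻¹ v s * ∫ t, gaussWeight J z t := by
    rw [Finset.sum_eq_single s]
    · simp
    · intro u _ hu; simp [hu]
    · simp
  rw [e2] at h
  linarith

/-- The polynomial `a·t + ½ ∑ D_{rs} t_r t_s + (1/6) ∑ T_{rst} t_r t_s t_t`. -/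
noncomputable def cubicPoly {p : ℕ} (a : Fin p → ℝ) (D : Fin p → Fin p → ℝ)
    (T : Fin p → Fin p → Fin p → ℝ) (t : Fin p → ℝ) : ℝ :=
  (∑ r, a r * t r) + 1 / 2 * (∑ r, ∑ s, D r s * (t r * t s))
    + 1 / 6 * ∑ b, ∑ c, ∑ d, T b c d * (t b * t c * t d)

lemma expGrowth_cubicPoly {p : ℕ} (a : Fin p → ℝ) (D : Fin p → Fin p → ℝ)
    (T : Fin p → Fin p → Fin p → ℝ) : ExpGrowth (cubicPoly a D T) := by
  have h1 : ExpGrowth fun t : Fin p → ℝ => ∑ r, a r * t r :=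
    ExpGrowth.sum fun r _ => (ExpGrowth.coord r).const_mul _
  have h2 : ExpGrowth fun t : Fin p → ℝ => ∑ r, ∑ s, D r s * (t r * t s) :=
    ExpGrowth.sum fun r _ => ExpGrowth.sum fun s _ =>
      ((ExpGrowth.coord r).mul (ExpGrowth.coord s)).const_mul _
  have h3 : ExpGrowth fun t : Fin p → ℝ => ∑ b, ∑ c, ∑ d, T b c d * (t b * t c * t d) :=
    ExpGrowth.sum fun r _ => ExpGrowth.sum fun s _ => ExpGrowth.sum fun d _ =>
      (((ExpGrowth.coord r).mul (ExpGrowth.coord s)).mul (ExpGrowth.coord d)).const_mul _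
  exact (h1.add (h2.const_mul _)).add (h3.const_mul _)

/-- The mean of the gradient of `cubicPoly` under the normal law with mean `y`, covariance `V`. -/
noncomputable def cubicMean {p : ℕ} (a : Fin p → ℝ) (D : Fin p → Fin p → ℝ)
    (T : Fin p → Fin p → Fin p → ℝ) (V : Matrix (Fin p) (Fin p) ℝ) (y : Fin p → ℝ) (u : Fin p) :
    ℝ :=
  a u + (∑ s, D u s * y s) + 1 / 2 * ∑ b, ∑ c, T u b c * (y b * y c + V b c)

/-- The gradient of a cubic is quadratic, so after Stein's identity only the first two Gaussian
moments enter, although the integrand on the left has degree four. -/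
lemma integral_sub_mul_cubicPoly {p : ℕ} {J : Matrix (Fin p) (Fin p) ℝ} (hJ : J.PosDef)
    (z : Fin p → ℝ) (a : Fin p → ℝ) {D : Fin p → Fin p → ℝ} {T : Fin p → Fin p → Fin p → ℝ}
    (hD : ∀ r s, D r s = D s r) (h12 : ∀ r s t, T r s t = T s r t)
    (h23 : ∀ r s t, T r s t = T r t s) (v : Fin p) :
    ∫ t, (t v - J⁻¹.mulVec z v) * (cubicPoly a D T t * gaussWeight J z t)
      = J⁻¹.mulVec (cubicMean a D T J⁻¹ (J⁻¹.mulVec z)) v * ∫ t, gaussWeight J z t := by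
  have g1 : ∀ u, ExpGrowth fun t : Fin p → ℝ => ∑ s, D u s * t s := fun u =>
    ExpGrowth.sum fun r _ => (ExpGrowth.coord r).const_mul _
  have g2 : ∀ u, ExpGrowth fun t : Fin p → ℝ => ∑ b, ∑ c, T u b c * (t b * t c) := fun u =>
    ExpGrowth.sum fun r _ => ExpGrowth.sum fun s _ =>
      ((ExpGrowth.coord r).mul (ExpGrowth.coord s)).const_mul _
  have h := integral_sub_mul_gaussWeight hJ z (q := cubicPoly a D T)
    (q' := fun u t => a u + (∑ s, D u s * t s) + 1 / 2 * ∑ b, ∑ c, T u b c * (t b * t c))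
    (expGrowth_cubicPoly a D T)
    (fun u => ((ExpGrowth.const (a u)).add (g1 u)).add ((g2 u).const_mul (1 / 2)))
    (fun u t => by
      have e := ((hasLineDerivAt_linear a u t).add
        ((hasLineDerivAt_quadratic hD u t).const_mul (1 / 2))).add
        ((hasLineDerivAt_cubic h12 h23 u t).const_mul (1 / 6))
      refine HasDerivAt.congr_deriv e ?_
      ring) v
  rw [h, Matrix.mulVec, dotProduct, Finset.sum_mul]
  refine Finset.sum_congr rfl fun u _ => ?_
  rw [mul_assoc]
  congr 1
  simp only [add_mul]
  have i1 := (g1 u).integrable_mul_gaussWeight hJ z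
  have i2 := ((g2 u).const_mul (1 / 2)).integrable_mul_gaussWeight hJ z
  have i0 := (integrable_gaussWeight hJ z).const_mul (a u)
  rw [integral_add (i0.fun_add i1) i2, integral_add i0 i1, integral_const_mul, cubicMean, add_mul,
    add_mul]
  congr 1
  · congr 1
    simp only [Finset.sum_mul]
    rw [integral_finsetSum _ fun s _ =>
      ((ExpGrowth.coord s).const_mul _).integrable_mul_gaussWeight hJ z]
    refine Finset.sum_congr rfl fun s _ => ?_
    simp only [mul_assoc]
    rw [integral_const_mul, integral_coord_gaussWeight hJ]
  · simp only [mul_assoc]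
    rw [integral_const_mul]
    congr 1
    simp only [Finset.sum_mul]
    rw [integral_finsetSum]
    · refine Finset.sum_congr rfl fun b _ => ?_
      rw [integral_finsetSum]
      · refine Finset.sum_congr rfl fun c _ => ?_
        simp only [mul_assoc]
        rw [integral_const_mul]
        congr 1
        simpa [mul_assoc] using integral_coord_mul_coord_gaussWeight hJ z b c
      · exact fun c _ => (((ExpGrowth.coord b).mul
          (ExpGrowth.coord c)).const_mul _).integrable_mul_gaussWeight hJ z
    · exact fun b _ => integrable_finsetSum _ fun c _ => (((ExpGrowth.coord b).mul
          (ExpGrowth.coord c)).const_mul _).integrable_mul_gaussWeight hJ z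

lemma integral_gaussWeight_zero_pos {p : ℕ} {J : Matrix (Fin p) (Fin p) ℝ} (hJ : J.PosDef) :
    0 < ∫ t, gaussWeight J 0 t :=
  integral_pos_of_integrable_nonneg_nonzero (x := 0) (continuous_gaussWeight J 0)
    (integrable_gaussWeight hJ 0) (fun t => (gaussWeight_pos J 0 t).le) (gaussWeight_pos J 0 0).ne'

/-- Since `exp(z·t) ≥ 1 + z·t` and the linear term integrates to zero against the centred weight,
the normalizing constant has a lower bound uniform in `z`. This permits division although `z` does
not converge. -/
lemma integral_gaussWeight_zero_le {p : ℕ} {J : Matrix (Fin p) (Fin p) ℝ} (hJ : J.PosDef)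
    (z : Fin p → ℝ) : ∫ t, gaussWeight J 0 t ≤ ∫ t, gaussWeight J z t := by
  have hg : ∀ v ∈ (Finset.univ : Finset (Fin p)),
      Integrable fun t : Fin p → ℝ => z v * (t v * gaussWeight J 0 t) := fun v _ =>
    ((ExpGrowth.coord v).integrable_mul_gaussWeight hJ 0).const_mul _
  have h0 : ∫ t, (z ⬝ᵥ t) * gaussWeight J 0 t = 0 := by
    simp only [dotProduct, Finset.sum_mul, mul_assoc]
    rw [integral_finsetSum _ hg]
    refine Finset.sum_eq_zero fun v _ => ?_
    rw [integral_const_mul, integral_coord_gaussWeight hJ, Matrix.mulVec_zero]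
    simp
  have hi : Integrable fun t : Fin p → ℝ => (z ⬝ᵥ t) * gaussWeight J 0 t := by
    simp only [dotProduct, Finset.sum_mul, mul_assoc]
    exact integrable_finsetSum _ hg
  calc ∫ t, gaussWeight J 0 t = ∫ t, (gaussWeight J 0 t + (z ⬝ᵥ t) * gaussWeight J 0 t) := by
        rw [integral_add (integrable_gaussWeight hJ 0) hi, h0, add_zero]
    _ ≤ _ := by
        refine integral_mono ((integrable_gaussWeight hJ 0).add hi) (integrable_gaussWeight hJ z)
          fun t => ?_
        have h1 : gaussWeight J z t = Real.exp (z ⬝ᵥ t) * gaussWeight J 0 t := by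
          rw [gaussWeight, gaussWeight, ← Real.exp_add]
          congr 1
          simp
          ring
        have h2 := Real.add_one_le_exp (z ⬝ᵥ t)
        have h3 := gaussWeight_pos J 0 t
        simp only [h1]
        nlinarith

/-! ### Laplace expansion of a ratio of integrals -/

lemma pow_le_six_mul_exp {x : ℝ} (hx : 0 ≤ x) {k : ℕ} (hk : k ≤ 3) : x ^ k ≤ 6 * Real.exp x := by
  have h := Real.pow_div_factorial_le_exp x hx k
  have h1 : (0 : ℝ) < k.factorial := by exact_mod_cast k.factorial_pos
  rw [div_le_iff₀ h1] at h
  have h2 : (k.factorial : ℝ) ≤ 6 := by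
    have : k.factorial ≤ Nat.factorial 3 := Nat.factorial_le hk
    exact_mod_cast this
  nlinarith [Real.exp_pos x]

lemma abs_sum_mul_coord_le {p : ℕ} {M : ℝ} {a : Fin p → ℝ} (ha : ∀ r, |a r| ≤ M)
    (t : Fin p → ℝ) : |∑ r, a r * t r| ≤ p * (M * ‖t‖) := by
  calc |∑ r, a r * t r| ≤ ∑ r, |a r * t r| := Finset.abs_sum_le_sum_abs _ _
    _ ≤ ∑ _r : Fin p, M * ‖t‖ := Finset.sum_le_sum fun r _ => by
        rw [abs_mul]
        exact mul_le_mul (ha r) (norm_le_pi_norm t r) (abs_nonneg _) ((abs_nonneg _).trans (ha r))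
    _ = _ := by simp

lemma abs_quadratic_le {p : ℕ} {M : ℝ} {D : Fin p → Fin p → ℝ} (hD : ∀ r s, |D r s| ≤ M)
    (t : Fin p → ℝ) : |∑ r, ∑ s, D r s * (t r * t s)| ≤ p ^ 2 * (M * ‖t‖ ^ 2) := by
  calc |∑ r, ∑ s, D r s * (t r * t s)| ≤ ∑ r, ∑ s, |D r s * (t r * t s)| :=
        (Finset.abs_sum_le_sum_abs _ _).trans
          (Finset.sum_le_sum fun _ _ => Finset.abs_sum_le_sum_abs _ _)
    _ ≤ ∑ _r : Fin p, ∑ _s : Fin p, M * ‖t‖ ^ 2 :=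
        Finset.sum_le_sum fun r _ => Finset.sum_le_sum fun s _ => by
        rw [abs_mul, abs_mul, sq]
        exact mul_le_mul (hD r s) (mul_le_mul (norm_le_pi_norm t r) (norm_le_pi_norm t s)
          (abs_nonneg _) (norm_nonneg _)) (by positivity) ((abs_nonneg _).trans (hD r s))
    _ = _ := by simp [sq]; ring

lemma abs_cubic_le {p : ℕ} {M : ℝ} {T : Fin p → Fin p → Fin p → ℝ}
    (hT : ∀ a b c, |T a b c| ≤ M) (t : Fin p → ℝ) :
    |∑ a, ∑ b, ∑ c, T a b c * (t a * t b * t c)| ≤ p ^ 3 * (M * ‖t‖ ^ 3) := by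
  calc |∑ a, ∑ b, ∑ c, T a b c * (t a * t b * t c)|
      ≤ ∑ a, ∑ b, ∑ c, |T a b c * (t a * t b * t c)| :=
        (Finset.abs_sum_le_sum_abs _ _).trans (Finset.sum_le_sum fun _ _ =>
          (Finset.abs_sum_le_sum_abs _ _).trans
            (Finset.sum_le_sum fun _ _ => Finset.abs_sum_le_sum_abs _ _))
    _ ≤ ∑ _a : Fin p, ∑ _b : Fin p, ∑ _c : Fin p, M * ‖t‖ ^ 3 :=
        Finset.sum_le_sum fun a _ => Finset.sum_le_sum fun b _ => Finset.sum_le_sum fun c _ => by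
        rw [abs_mul, abs_mul, abs_mul, pow_succ, sq]
        exact mul_le_mul (hT a b c) (mul_le_mul (mul_le_mul (norm_le_pi_norm t a)
          (norm_le_pi_norm t b) (abs_nonneg _) (norm_nonneg _)) (norm_le_pi_norm t c)
          (abs_nonneg _) (by positivity)) (by positivity) ((abs_nonneg _).trans (hT a b c))
    _ = _ := by simp; ring

/-- Weights `ρ(η) exp(L_i(η))` on `Θ` whose exponent is, on the scale `1/r_i` around `θ`, quadratic
up to corrections of relative order `1/r_i`, with negligible mass away from `θ`. -/
structure LaplaceSetting {p : ℕ} {ι : Type*} (l : Filter ι) (J : Matrix (Fin p) (Fin p) ℝ)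
    (T : Fin p → Fin p → Fin p → ℝ) (a : Fin p → ℝ) (Θ : Set (Fin p → ℝ)) (θ : Fin p → ℝ)
    (ρ : (Fin p → ℝ) → ℝ) (r : ι → ℝ) (L : ι → (Fin p → ℝ) → ℝ) (z : ι → Fin p → ℝ)
    (D : ι → Fin p → Fin p → ℝ) (c δ M₀ M₁ M₂ : ℝ) : Prop where
  posDef : J.PosDef
  c_pos : 0 < c
  coercive : ∀ t, c * ‖t‖ ^ 2 ≤ t ⬝ᵥ J.mulVec t
  δ_pos : 0 < δ
  M₁_nonneg : 0 ≤ M₁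
  M₂_nonneg : 0 ≤ M₂
  small : M₂ * δ ≤ c / 8
  measurableSet : MeasurableSet Θ
  ball_subset : Metric.closedBall θ δ ⊆ Θ
  measurable_ρ : Measurable ρ
  measurable_L : ∀ i, Measurable (L i)
  nonneg : ∀ η ∈ Θ, 0 ≤ ρ η
  lip : ∀ η ∈ Metric.closedBall θ δ, |ρ η - 1| ≤ M₀ * ‖η - θ‖
  r_top : Tendsto r l atTop
  slope : ∀ t, Tendsto (fun i => r i * (ρ (θ + (r i)⁻¹ • t) - 1)) l (𝓝 (∑ v, a v * t v))
  z_bdd : ∀ᶠ i in l, ‖z i‖ ≤ M₀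
  D_bdd : ∀ᶠ i in l, ∀ u v, |D i u v| ≤ M₀
  D_symm : ∀ i u v, D i u v = D i v u
  T_symm_left : ∀ u v w, T u v w = T v u w
  T_symm_right : ∀ u v w, T u v w = T u w v
  local_bound : ∀ᶠ i in l, ∀ t, ‖t‖ ≤ δ * r i →
    |r i * (L i (θ + (r i)⁻¹ • t) - (z i ⬝ᵥ t - (t ⬝ᵥ J.mulVec t) / 2))|
      ≤ M₁ * ‖t‖ ^ 2 + M₂ * ‖t‖ ^ 3
  local_lim : ∀ t, Tendsto (fun i =>
    r i * (L i (θ + (r i)⁻¹ • t) - (z i ⬝ᵥ t - (t ⬝ᵥ J.mulVec t) / 2))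
      - cubicPoly 0 (D i) T t) l (𝓝 0)
  tail_int : ∀ᶠ i in l, IntegrableOn (fun η => (1 + ‖η - θ‖) * (ρ η * Real.exp (L i η)))
    (Θ \ Metric.closedBall θ δ)
  tail_lim : Tendsto (fun i => r i ^ (p + 2) * ∫ η in Θ \ Metric.closedBall θ δ,
    (1 + ‖η - θ‖) * (ρ η * Real.exp (L i η))) l (𝓝 0)

section Laplace

variable {p : ℕ} {ι : Type*} {l : Filter ι} {J : Matrix (Fin p) (Fin p) ℝ}
  {T : Fin p → Fin p → Fin p → ℝ} {a : Fin p → ℝ} {Θ : Set (Fin p → ℝ)} {θ : Fin p → ℝ}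
  {ρ : (Fin p → ℝ) → ℝ} {r : ι → ℝ} {L : ι → (Fin p → ℝ) → ℝ} {z : ι → Fin p → ℝ}
  {D : ι → Fin p → Fin p → ℝ} {c δ M₀ M₁ M₂ : ℝ}

/-- The rescaled weight on the ball of radius `δ` around `θ`. -/
noncomputable def nearWeight (θ : Fin p → ℝ) (ρ : (Fin p → ℝ) → ℝ) (r : ι → ℝ)
    (L : ι → (Fin p → ℝ) → ℝ) (δ : ℝ) (i : ι) (t : Fin p → ℝ) : ℝ :=
  (Metric.closedBall 0 (δ * r i)).indicator
    (fun t => ρ (θ + (r i)⁻¹ • t) * Real.exp (L i (θ + (r i)⁻¹ • t))) t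

/-- The error, multiplied by `r`, of the first order approximation of the rescaled weight. -/
noncomputable def nearError (J : Matrix (Fin p) (Fin p) ℝ)
    (T : Fin p → Fin p → Fin p → ℝ) (a : Fin p → ℝ) (θ : Fin p → ℝ) (ρ : (Fin p → ℝ) → ℝ)
    (r : ι → ℝ) (L : ι → (Fin p → ℝ) → ℝ) (z : ι → Fin p → ℝ) (D : ι → Fin p → Fin p → ℝ) (δ : ℝ)
    (i : ι) (t : Fin p → ℝ) : ℝ :=
  r i * (nearWeight θ ρ r L δ i t - gaussWeight J (z i) t)
    - cubicPoly a (D i) T t * gaussWeight J (z i) t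

lemma cubicPoly_eq_add (a : Fin p → ℝ) (D : Fin p → Fin p → ℝ)
    (T : Fin p → Fin p → Fin p → ℝ) (t : Fin p → ℝ) :
    cubicPoly a D T t = (∑ v, a v * t v) + cubicPoly 0 D T t := by
  simp [cubicPoly]
  ring

/-- The exact form of the rescaled weight near the centre. -/
lemma nearWeight_eq {i : ι} (hri : 0 < r i) {t : Fin p → ℝ} (ht : ‖t‖ ≤ δ * r i) :
    nearWeight θ ρ r L δ i t = gaussWeight J (z i) t * (ρ (θ + (r i)⁻¹ • t) * Real.exp ((r i)⁻¹ *
      (r i * (L i (θ + (r i)⁻¹ • t) - (z i ⬝ᵥ t - (t ⬝ᵥ J.mulVec t) / 2))))) := by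
  rw [nearWeight, Set.indicator_of_mem (by simpa using ht), gaussWeight, mul_left_comm,
    ← Real.exp_add, inv_mul_cancel_left₀ hri.ne']
  congr 2
  ring

/-- The point is uniformity in `D`: the quadratic coefficients vary with the sample size and are
only bounded. -/
lemma cubicPoly_bound (a : Fin p → ℝ) (T : Fin p → Fin p → Fin p → ℝ) (M : ℝ) :
    ∃ C, 0 ≤ C ∧ ∀ D : Fin p → Fin p → ℝ, (∀ u v, |D u v| ≤ M) → ∀ t,
      |cubicPoly a D T t| ≤ C * Real.exp ‖t‖ := by
  obtain ⟨Ma, hMa⟩ : ∃ M, ∀ v, |a v| ≤ M := ⟨∑ v, |a v|, fun v =>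
    Finset.single_le_sum (f := fun v => |a v|) (fun _ _ => abs_nonneg _) (Finset.mem_univ v)⟩
  obtain ⟨MT, hMT⟩ : ∃ M, ∀ u v w, |T u v w| ≤ M := ⟨∑ u, ∑ v, ∑ w, |T u v w|, fun u v w =>
    (Finset.single_le_sum (f := fun w => |T u v w|) (fun _ _ => abs_nonneg _)
      (Finset.mem_univ w)).trans ((Finset.single_le_sum (f := fun v => ∑ w, |T u v w|)
      (fun _ _ => Finset.sum_nonneg fun _ _ => abs_nonneg _) (Finset.mem_univ v)).trans
      (Finset.single_le_sum (f := fun u => ∑ v, ∑ w, |T u v w|)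
      (fun _ _ => Finset.sum_nonneg fun _ _ => Finset.sum_nonneg fun _ _ => abs_nonneg _)
      (Finset.mem_univ u)))⟩
  refine ⟨6 * (p * |Ma| + p ^ 2 * |M| + p ^ 3 * |MT|), by positivity, fun D hD t => ?_⟩
  have h1 := abs_sum_mul_coord_le (fun v => (hMa v).trans (le_abs_self _)) t
  have h2 := abs_quadratic_le (fun u v => (hD u v).trans (le_abs_self _)) t
  have h3 := abs_cubic_le (fun u v w => (hMT u v w).trans (le_abs_self _)) t
  have e1 := pow_le_six_mul_exp (norm_nonneg t) (k := 1) (by norm_num)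
  have e2 := pow_le_six_mul_exp (norm_nonneg t) (k := 2) (by norm_num)
  have e3 := pow_le_six_mul_exp (norm_nonneg t) (k := 3) (by norm_num)
  rw [pow_one] at e1
  have f1 : p * (|Ma| * ‖t‖) ≤ p * |Ma| * (6 * Real.exp ‖t‖) := by
    rw [← mul_assoc]; exact mul_le_mul_of_nonneg_left e1 (by positivity)
  have f2 : p ^ 2 * (|M| * ‖t‖ ^ 2) ≤ p ^ 2 * |M| * (6 * Real.exp ‖t‖) := by
    rw [← mul_assoc]; exact mul_le_mul_of_nonneg_left e2 (by positivity)
  have f3 : p ^ 3 * (|MT| * ‖t‖ ^ 3) ≤ p ^ 3 * |MT| * (6 * Real.exp ‖t‖) := by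
    rw [← mul_assoc]; exact mul_le_mul_of_nonneg_left e3 (by positivity)
  have h4 : |cubicPoly a D T t| ≤ |∑ v, a v * t v| + |∑ u, ∑ v, D u v * (t u * t v)|
      + |∑ u, ∑ v, ∑ w, T u v w * (t u * t v * t w)| := by
    refine (abs_add_three _ _ _).trans ?_
    rw [abs_mul, abs_mul, abs_of_nonneg (by norm_num : (0 : ℝ) ≤ 1 / 2),
      abs_of_nonneg (by norm_num : (0 : ℝ) ≤ 1 / 6)]
    have := abs_nonneg (∑ u, ∑ v, D u v * (t u * t v))
    have := abs_nonneg (∑ u, ∑ v, ∑ w, T u v w * (t u * t v * t w))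
    linarith
  linarith

lemma LaplaceSetting.M₀_nonneg [l.NeBot] (h : LaplaceSetting l J T a Θ θ ρ r L z D c δ M₀ M₁ M₂) :
    0 ≤ M₀ := by
  obtain ⟨i, hi⟩ := h.z_bdd.exists
  exact (norm_nonneg _).trans hi

/-- The common bound for the rescaled weights. -/
lemma LaplaceSetting.exists_bound [l.NeBot]
    (h : LaplaceSetting l J T a Θ θ ρ r L z D c δ M₀ M₁ M₂) :
    ∃ C A, 0 ≤ C ∧ ∀ᶠ i in l, ∀ t,
      |cubicPoly a (D i) T t * gaussWeight J (z i) t| ≤ C * Real.exp (A * ‖t‖ - c / 4 * ‖t‖ ^ 2) ∧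
      |nearError J T a θ ρ r L z D δ i t| ≤ C * Real.exp (A * ‖t‖ - c / 4 * ‖t‖ ^ 2) := by
  obtain ⟨Cq, hCq0, hCq⟩ := cubicPoly_bound a T M₀
  have hM₀ := h.M₀_nonneg
  have hc := h.c_pos
  have hδ := h.δ_pos
  have hM₁ := h.M₁_nonneg
  have hM₂ := h.M₂_nonneg
  -- Each `6` comes from `x^k ≤ 6 exp x` for `k ≤ 3`. The terms `M₀`, `M₁`, `M₂` stem from the prior
  -- and from the quadratic and cubic errors inside the ball, `δ⁻¹` from its outside, `Cq` from the
  -- polynomial. The rate `p * M₀ + 1` collects `z·t` and the factor `exp ‖t‖`.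
  refine ⟨6 * M₀ + 6 * M₁ + 6 * M₂ + 6 * δ⁻¹ + Cq, p * M₀ + 1, by positivity, ?_⟩
  filter_upwards [h.z_bdd, h.D_bdd, h.local_bound, h.r_top.eventually_gt_atTop 0,
    h.r_top.eventually_ge_atTop (8 * M₁ / c)] with i hz hD hloc hr hr2 t
  have hw := gaussWeight_le h.coercive hz t
  have hw0 := gaussWeight_pos J (z i) t
  have hq := hCq (D i) hD t
  have e1 := pow_le_six_mul_exp (norm_nonneg t) (k := 1) (by norm_num)
  have e2 := pow_le_six_mul_exp (norm_nonneg t) (k := 2) (by norm_num)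
  have e3 := pow_le_six_mul_exp (norm_nonneg t) (k := 3) (by norm_num)
  rw [pow_one] at e1
  set Bd : ℝ := Real.exp ((p * M₀ + 1) * ‖t‖ - c / 4 * ‖t‖ ^ 2) with hBd
  have hBd0 : 0 < Bd := Real.exp_pos _
  have hwB : Real.exp ‖t‖ * gaussWeight J (z i) t ≤ Bd := by
    calc Real.exp ‖t‖ * gaussWeight J (z i) t
        ≤ Real.exp ‖t‖ * Real.exp (p * M₀ * ‖t‖ - c / 2 * ‖t‖ ^ 2) :=
          mul_le_mul_of_nonneg_left hw (Real.exp_pos _).le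
      _ ≤ Bd := by
        rw [← Real.exp_add]
        refine Real.exp_le_exp.2 ?_
        nlinarith [sq_nonneg ‖t‖]
  have hqw : |cubicPoly a (D i) T t * gaussWeight J (z i) t| ≤ Cq * Bd := by
    rw [abs_mul, abs_of_pos hw0]
    calc |cubicPoly a (D i) T t| * gaussWeight J (z i) t
        ≤ (Cq * Real.exp ‖t‖) * gaussWeight J (z i) t := mul_le_mul_of_nonneg_right hq hw0.le
      _ ≤ Cq * Bd := by rw [mul_assoc]; exact mul_le_mul_of_nonneg_left hwB hCq0
  have hδi : 0 < δ⁻¹ := inv_pos.2 hδ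
  have key : |r i * (nearWeight θ ρ r L δ i t - gaussWeight J (z i) t)|
      ≤ (6 * M₀ + 6 * M₁ + 6 * M₂ + 6 * δ⁻¹) * Bd := by
    by_cases ht : ‖t‖ ≤ δ * r i
    · rw [nearWeight_eq (J := J) (z := z) hr ht]
      have hb := hloc t ht
      set b : ℝ := r i * (L i (θ + (r i)⁻¹ • t) - (z i ⬝ᵥ t - (t ⬝ᵥ J.mulVec t) / 2))
      have hri : 0 < (r i)⁻¹ := inv_pos.2 hr
      have hη : ‖(θ + (r i)⁻¹ • t) - θ‖ = (r i)⁻¹ * ‖t‖ := by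
        rw [add_sub_cancel_left, norm_smul, Real.norm_of_nonneg hri.le]
      have hρ := h.lip (θ + (r i)⁻¹ • t) (by
        rw [Metric.mem_closedBall, dist_eq_norm, hη, inv_mul_le_iff₀ hr, mul_comm]
        exact ht)
      rw [hη] at hρ
      set ρt : ℝ := ρ (θ + (r i)⁻¹ • t)
      -- Inside the ball both errors cost at most `c/8` each: the quadratic one because `r` is
      -- large, the cubic one because `‖t‖ / r ≤ δ` and `M₂ * δ ≤ c/8`. Of the Gaussian decay `c/2`,
      -- the amount `c/4` is left.
      have hb2 : |(r i)⁻¹ * b| ≤ c / 4 * ‖t‖ ^ 2 := by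
        rw [abs_mul, abs_of_pos hri]
        have h1 : (r i)⁻¹ * |b| ≤ (r i)⁻¹ * (M₁ * ‖t‖ ^ 2 + M₂ * ‖t‖ ^ 3) :=
          mul_le_mul_of_nonneg_left hb hri.le
        have h2 : (r i)⁻¹ * M₁ ≤ c / 8 := by
          rw [inv_mul_le_iff₀ hr]
          rw [div_le_iff₀ hc] at hr2
          linarith
        have h3 : (r i)⁻¹ * ‖t‖ ≤ δ := by rw [inv_mul_le_iff₀ hr, mul_comm]; exact ht
        have h4 : M₂ * ((r i)⁻¹ * ‖t‖) ≤ c / 8 :=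
          (mul_le_mul_of_nonneg_left h3 hM₂).trans h.small
        have h5 : (r i)⁻¹ * (M₁ * ‖t‖ ^ 2 + M₂ * ‖t‖ ^ 3)
            = ((r i)⁻¹ * M₁ + M₂ * ((r i)⁻¹ * ‖t‖)) * ‖t‖ ^ 2 := by ring
        have h6 : ((r i)⁻¹ * M₁ + M₂ * ((r i)⁻¹ * ‖t‖)) * ‖t‖ ^ 2 ≤ (c / 8 + c / 8) * ‖t‖ ^ 2 :=
          mul_le_mul_of_nonneg_right (add_le_add h2 h4) (sq_nonneg _)
        linarith
      set Q : ℝ := Real.exp (c / 4 * ‖t‖ ^ 2) with hQ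
      have hexp : Real.exp ((r i)⁻¹ * b) ≤ Q := Real.exp_le_exp.2 ((le_abs_self _).trans hb2)
      have hQ1 : 1 ≤ Q := Real.one_le_exp (by positivity)
      have hexp1 : |Real.exp ((r i)⁻¹ * b) - 1| ≤ |(r i)⁻¹ * b| * Q := by
        set x := (r i)⁻¹ * b
        rw [abs_le]
        have hx1 := Real.add_one_le_exp x
        have hx2 := Real.add_one_le_exp (-x)
        have hp := Real.exp_pos x
        have h7 : Real.exp x - 1 ≤ x * Real.exp x := by
          have : Real.exp x * (-x + 1) ≤ Real.exp x * Real.exp (-x) :=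
            mul_le_mul_of_nonneg_left hx2 hp.le
          rw [← Real.exp_add, add_neg_cancel, Real.exp_zero] at this
          linarith
        constructor
        · have : |x| ≤ |x| * Q := le_mul_of_one_le_right (abs_nonneg _) hQ1
          linarith [neg_abs_le x]
        · calc Real.exp x - 1 ≤ x * Real.exp x := h7
            _ ≤ |x| * Real.exp x := mul_le_mul_of_nonneg_right (le_abs_self _) hp.le
            _ ≤ |x| * Q := mul_le_mul_of_nonneg_left hexp (abs_nonneg _)
      have hmain : |r i * (ρt * Real.exp ((r i)⁻¹ * b) - 1)|
          ≤ (M₀ * ‖t‖ + (M₁ * ‖t‖ ^ 2 + M₂ * ‖t‖ ^ 3)) * Q := by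
        have : r i * (ρt * Real.exp ((r i)⁻¹ * b) - 1)
            = r i * (ρt - 1) * Real.exp ((r i)⁻¹ * b) + r i * (Real.exp ((r i)⁻¹ * b) - 1) := by
          ring
        rw [this]
        refine (abs_add_le _ _).trans ?_
        rw [add_mul]
        refine add_le_add ?_ ?_
        · rw [abs_mul, abs_mul, abs_of_pos hr, abs_of_pos (Real.exp_pos _)]
          refine mul_le_mul ?_ hexp (Real.exp_pos _).le (by positivity)
          calc r i * |ρt - 1| ≤ r i * (M₀ * ((r i)⁻¹ * ‖t‖)) :=
                mul_le_mul_of_nonneg_left hρ hr.le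
            _ = M₀ * ‖t‖ := by field_simp
        · rw [abs_mul, abs_of_pos hr]
          calc r i * |Real.exp ((r i)⁻¹ * b) - 1| ≤ r i * (|(r i)⁻¹ * b| * Q) :=
                mul_le_mul_of_nonneg_left hexp1 hr.le
            _ = |b| * Q := by rw [abs_mul, abs_of_pos hri]; field_simp
            _ ≤ _ := mul_le_mul_of_nonneg_right hb (by linarith)
      have hfac : r i * (gaussWeight J (z i) t * (ρt * Real.exp ((r i)⁻¹ * b))
          - gaussWeight J (z i) t)
          = r i * (ρt * Real.exp ((r i)⁻¹ * b) - 1) * gaussWeight J (z i) t := by ring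
      rw [hfac, abs_mul, abs_of_pos hw0]
      have hpoly : M₀ * ‖t‖ + (M₁ * ‖t‖ ^ 2 + M₂ * ‖t‖ ^ 3)
          ≤ (6 * M₀ + 6 * M₁ + 6 * M₂) * Real.exp ‖t‖ := by
        have := mul_le_mul_of_nonneg_left e1 hM₀
        have := mul_le_mul_of_nonneg_left e2 hM₁
        have := mul_le_mul_of_nonneg_left e3 hM₂
        linarith
      have hQw : Real.exp ‖t‖ * Q * gaussWeight J (z i) t ≤ Bd := by
        calc Real.exp ‖t‖ * Q * gaussWeight J (z i) t
            ≤ Real.exp ‖t‖ * Q * Real.exp (p * M₀ * ‖t‖ - c / 2 * ‖t‖ ^ 2) :=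
              mul_le_mul_of_nonneg_left hw (by positivity)
          _ = Bd := by rw [hQ, ← Real.exp_add, ← Real.exp_add, hBd]; congr 1; ring
      calc |r i * (ρt * Real.exp ((r i)⁻¹ * b) - 1)| * gaussWeight J (z i) t
          ≤ ((M₀ * ‖t‖ + (M₁ * ‖t‖ ^ 2 + M₂ * ‖t‖ ^ 3)) * Q) * gaussWeight J (z i) t :=
            mul_le_mul_of_nonneg_right hmain hw0.le
        _ ≤ (((6 * M₀ + 6 * M₁ + 6 * M₂) * Real.exp ‖t‖) * Q) * gaussWeight J (z i) t := by
            gcongr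
        _ = (6 * M₀ + 6 * M₁ + 6 * M₂) * (Real.exp ‖t‖ * Q * gaussWeight J (z i) t) := by ring
        _ ≤ (6 * M₀ + 6 * M₁ + 6 * M₂) * Bd := mul_le_mul_of_nonneg_left hQw (by positivity)
        _ ≤ _ := by nlinarith
    · rw [nearWeight, Set.indicator_of_notMem (by simpa using ht), zero_sub, mul_neg, abs_neg,
        abs_mul, abs_of_pos hr, abs_of_pos hw0]
      push Not at ht
      -- Outside the ball the weight vanishes and what remains is `r` times the Gaussian; there `r`
      -- is smaller than `δ⁻¹ * ‖t‖`, which the Gaussian absorbs.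
      have h1 : r i ≤ δ⁻¹ * ‖t‖ := by
        rw [inv_mul_eq_div, le_div_iff₀ hδ, mul_comm]; exact ht.le
      calc r i * gaussWeight J (z i) t ≤ (δ⁻¹ * (6 * Real.exp ‖t‖)) * gaussWeight J (z i) t :=
            mul_le_mul_of_nonneg_right (h1.trans (mul_le_mul_of_nonneg_left e1 hδi.le)) hw0.le
        _ = 6 * δ⁻¹ * (Real.exp ‖t‖ * gaussWeight J (z i) t) := by ring
        _ ≤ 6 * δ⁻¹ * Bd := mul_le_mul_of_nonneg_left hwB (by positivity)
        _ ≤ _ := by nlinarith [mul_nonneg hM₀ hBd0.le, mul_nonneg hM₁ hBd0.le,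
            mul_nonneg hM₂ hBd0.le]
  have hpos : 0 ≤ (6 * M₀ + 6 * M₁ + 6 * M₂ + 6 * δ⁻¹) * Bd := by positivity
  refine ⟨?_, ?_⟩
  · rw [add_mul]; linarith
  · rw [add_mul]
    exact (abs_sub _ _).trans (add_le_add key hqw)

/-- Let `b` be `r` times the deviation of `L` from its quadratic part. Then `r(ρ e^{b/r} - 1)`
splits as `r(ρ - 1) e^{b/r} + r(e^{b/r} - 1 - b/r) + b`. At fixed `t`, `b` stays bounded, so the
first term tends to `a·t`, the second to zero, and `b` approaches the quadratic and cubic part of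
the polynomial. -/
lemma LaplaceSetting.tendsto_nearError (h : LaplaceSetting l J T a Θ θ ρ r L z D c δ M₀ M₁ M₂)
    (t : Fin p → ℝ) : Tendsto (fun i => nearError J T a θ ρ r L z D δ i t) l (𝓝 0) := by
  set b : ι → ℝ := fun i =>
    r i * (L i (θ + (r i)⁻¹ • t) - (z i ⬝ᵥ t - (t ⬝ᵥ J.mulVec t) / 2)) with hb
  have hrinv : Tendsto (fun i => (r i)⁻¹) l (𝓝 0) := h.r_top.inv_tendsto_atTop
  have hnear : ∀ᶠ i in l, ‖t‖ ≤ δ * r i := by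
    filter_upwards [h.r_top.eventually_ge_atTop (‖t‖ / δ)] with i hi
    rw [div_le_iff₀ h.δ_pos] at hi
    linarith
  have hbb : ∀ᶠ i in l, |b i| ≤ M₁ * ‖t‖ ^ 2 + M₂ * ‖t‖ ^ 3 := by
    filter_upwards [hnear, h.local_bound] with i h1 h2 using h2 t h1
  set B : ℝ := M₁ * ‖t‖ ^ 2 + M₂ * ‖t‖ ^ 3
  have hx : Tendsto (fun i => (r i)⁻¹ * b i) l (𝓝 0) := by
    refine squeeze_zero_norm' (a := fun i => |(r i)⁻¹| * B) ?_ ?_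
    · filter_upwards [hbb] with i hi
      rw [norm_mul, Real.norm_eq_abs, Real.norm_eq_abs]
      exact mul_le_mul_of_nonneg_left hi (abs_nonneg _)
    · simpa using hrinv.abs.mul_const B
  have hexp : Tendsto (fun i => Real.exp ((r i)⁻¹ * b i)) l (𝓝 1) := by
    simpa using hx.rexp
  have h2nd : Tendsto (fun i => r i * (Real.exp ((r i)⁻¹ * b i) - 1 - (r i)⁻¹ * b i)) l (𝓝 0) := by
    refine squeeze_zero_norm' (a := fun i => B * |(r i)⁻¹ * b i|) ?_ ?_
    · have hx1 : ∀ᶠ i in l, |(r i)⁻¹ * b i| ≤ 1 := by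
        have := hx.abs.eventually (gt_mem_nhds (show |(0 : ℝ)| < 1 by simp))
        filter_upwards [this] with i hi using hi.le
      filter_upwards [hbb, hx1, h.r_top.eventually_gt_atTop 0] with i hi hi1 hr
      rw [norm_mul, Real.norm_eq_abs, Real.norm_eq_abs, abs_of_pos hr]
      calc r i * |Real.exp ((r i)⁻¹ * b i) - 1 - (r i)⁻¹ * b i|
          ≤ r i * ((r i)⁻¹ * b i) ^ 2 :=
            mul_le_mul_of_nonneg_left (Real.abs_exp_sub_one_sub_id_le hi1) hr.le
        _ = |b i| * |(r i)⁻¹ * b i| := by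
            rw [← sq_abs, abs_mul, abs_of_pos (inv_pos.2 hr)]
            field_simp
        _ ≤ B * |(r i)⁻¹ * b i| := mul_le_mul_of_nonneg_right hi (abs_nonneg _)
    · simpa using hx.abs.const_mul B
  have hsum : Tendsto (fun i =>
      (r i * (ρ (θ + (r i)⁻¹ • t) - 1) * Real.exp ((r i)⁻¹ * b i) - ∑ v, a v * t v)
      + r i * (Real.exp ((r i)⁻¹ * b i) - 1 - (r i)⁻¹ * b i)
      + (b i - cubicPoly 0 (D i) T t)) l (𝓝 0) := by
    have h1 := ((h.slope t).mul hexp).sub_const (∑ v, a v * t v)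
    simpa using (h1.add h2nd).add (h.local_lim t)
  refine squeeze_zero_norm' (a := fun i => Real.exp (p * M₀ * ‖t‖) * |(r i *
      (ρ (θ + (r i)⁻¹ • t) - 1) * Real.exp ((r i)⁻¹ * b i) - ∑ v, a v * t v)
      + r i * (Real.exp ((r i)⁻¹ * b i) - 1 - (r i)⁻¹ * b i)
      + (b i - cubicPoly 0 (D i) T t)|) ?_ (by simpa using hsum.abs.const_mul _)
  filter_upwards [hnear, h.z_bdd, h.r_top.eventually_gt_atTop 0] with i ht hz hr
  rw [nearError, nearWeight_eq (J := J) (z := z) hr ht, cubicPoly_eq_add]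
  have e : r i * (gaussWeight J (z i) t * (ρ (θ + (r i)⁻¹ • t) * Real.exp ((r i)⁻¹ * b i))
      - gaussWeight J (z i) t) - ((∑ v, a v * t v) + cubicPoly 0 (D i) T t) * gaussWeight J (z i) t
      = gaussWeight J (z i) t * ((r i *
      (ρ (θ + (r i)⁻¹ • t) - 1) * Real.exp ((r i)⁻¹ * b i) - ∑ v, a v * t v)
      + r i * (Real.exp ((r i)⁻¹ * b i) - 1 - (r i)⁻¹ * b i)
      + (b i - cubicPoly 0 (D i) T t)) := by
    field_simp
    ring
  rw [e, norm_mul, Real.norm_eq_abs, Real.norm_eq_abs, abs_of_pos (gaussWeight_pos _ _ _)]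
  refine mul_le_mul_of_nonneg_right ?_ (abs_nonneg _)
  refine (gaussWeight_le h.coercive hz t).trans (Real.exp_le_exp.2 ?_)
  have := h.c_pos
  have : 0 ≤ c / 2 * ‖t‖ ^ 2 := by positivity
  linarith

end Laplace

/-! ### Integration of the pointwise expansion, and the posterior mean -/

section Laplace

variable {p : ℕ} {ι : Type*} {l : Filter ι} {J : Matrix (Fin p) (Fin p) ℝ}
  {T : Fin p → Fin p → Fin p → ℝ} {a : Fin p → ℝ} {Θ : Set (Fin p → ℝ)} {θ : Fin p → ℝ}
  {ρ : (Fin p → ℝ) → ℝ} {r : ι → ℝ} {L : ι → (Fin p → ℝ) → ℝ} {z : ι → Fin p → ℝ}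
  {D : ι → Fin p → Fin p → ℝ} {c δ M₀ M₁ M₂ : ℝ}

lemma indicator_closedBall_rescale (θ : Fin p → ℝ) {δ R : ℝ} (hR : 0 < R)
    (Φ : (Fin p → ℝ) → ℝ) (t : Fin p → ℝ) :
    (Metric.closedBall 0 (δ * R)).indicator (fun t => Φ (θ + R⁻¹ • t)) t
      = (Metric.closedBall θ δ).indicator Φ (θ + R⁻¹ • t) := by
  have hiff : t ∈ Metric.closedBall (0 : Fin p → ℝ) (δ * R)
      ↔ θ + R⁻¹ • t ∈ Metric.closedBall θ δ := by
    rw [mem_closedBall_zero_iff, Metric.mem_closedBall, dist_eq_norm, add_sub_cancel_left,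
      norm_smul, Real.norm_of_nonneg (inv_pos.2 hR).le, inv_mul_le_iff₀ hR, mul_comm]
  by_cases ht : t ∈ Metric.closedBall (0 : Fin p → ℝ) (δ * R)
  · rw [Set.indicator_of_mem ht, Set.indicator_of_mem (hiff.1 ht)]
  · rw [Set.indicator_of_notMem ht, Set.indicator_of_notMem (fun h => ht (hiff.2 h))]

lemma integral_closedBall_rescale (θ : Fin p → ℝ) {δ R : ℝ} (hR : 0 < R)
    (Φ : (Fin p → ℝ) → ℝ) :
    ∫ t, (Metric.closedBall 0 (δ * R)).indicator (fun t => Φ (θ + R⁻¹ • t)) t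
      = R ^ p * ∫ η in Metric.closedBall θ δ, Φ η := by
  simp only [indicator_closedBall_rescale θ hR]
  rw [Measure.integral_comp_inv_smul volume
    (fun t => (Metric.closedBall θ δ).indicator Φ (θ + t)) R,
    integral_add_left_eq_self (fun t => (Metric.closedBall θ δ).indicator Φ t) θ,
    integral_indicator Metric.isClosed_closedBall.measurableSet]
  simp [abs_of_pos hR]

lemma integrableOn_closedBall_rescale (θ : Fin p → ℝ) {δ R : ℝ} (hR : 0 < R)
    {Φ : (Fin p → ℝ) → ℝ}
    (h : Integrable ((Metric.closedBall 0 (δ * R)).indicator fun t => Φ (θ + R⁻¹ • t))) :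
    IntegrableOn Φ (Metric.closedBall θ δ) := by
  have h1 : Integrable fun t => (Metric.closedBall θ δ).indicator Φ (θ + R⁻¹ • t) :=
    h.congr (Eventually.of_forall fun t => indicator_closedBall_rescale θ hR Φ t)
  have h2 : Integrable fun t => (Metric.closedBall θ δ).indicator Φ (θ + t) :=
    (integrable_comp_smul_iff volume (fun t => (Metric.closedBall θ δ).indicator Φ (θ + t))
      (inv_pos.2 hR).ne').1 h1
  have h3 := h2.comp_add_left (-θ)
  simp only [add_neg_cancel_left] at h3
  exact (integrable_indicator_iff Metric.isClosed_closedBall.measurableSet).1 h3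

lemma LaplaceSetting.measurable_nearWeight
    (h : LaplaceSetting l J T a Θ θ ρ r L z D c δ M₀ M₁ M₂) (i : ι) :
    Measurable (nearWeight θ ρ r L δ i) := by
  have hm : Measurable fun t : Fin p → ℝ => θ + (r i)⁻¹ • t := by fun_prop
  exact ((h.measurable_ρ.comp hm).mul ((h.measurable_L i).comp hm).exp).indicator
    Metric.isClosed_closedBall.measurableSet

lemma LaplaceSetting.measurable_nearError
    (h : LaplaceSetting l J T a Θ θ ρ r L z D c δ M₀ M₁ M₂) (i : ι) :
    Measurable (nearError J T a θ ρ r L z D δ i) :=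
  (((h.measurable_nearWeight i).sub (continuous_gaussWeight J (z i)).measurable).const_mul _).sub
    ((expGrowth_cubicPoly a (D i) T).1.measurable.mul (continuous_gaussWeight J (z i)).measurable)

/-- Dominated convergence with the common majorant of `exists_bound`. The test function `H` may
depend on `i` because the numerator is centred at the moving point `J⁻¹ z_i`. -/
lemma LaplaceSetting.tendsto_integral_nearError [l.NeBot] [l.IsCountablyGenerated]
    (h : LaplaceSetting l J T a Θ θ ρ r L z D c δ M₀ M₁ M₂) {H : ι → (Fin p → ℝ) → ℝ}
    (hH : ∀ i, Measurable (H i)) {B : ℝ} (hB : ∀ᶠ i in l, ∀ t, |H i t| ≤ B * Real.exp ‖t‖) :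
    (∀ᶠ i in l, Integrable fun t => H i t * nearError J T a θ ρ r L z D δ i t) ∧
    Tendsto (fun i => ∫ t, H i t * nearError J T a θ ρ r L z D δ i t) l (𝓝 0) := by
  obtain ⟨C, A, hC, hbound⟩ := h.exists_bound
  have hint : Integrable fun t : Fin p → ℝ =>
      B * C * Real.exp ((A + 1) * ‖t‖ - c / 4 * ‖t‖ ^ 2) :=
    (integrable_exp_norm_sub_norm_sq (A + 1) (by linarith [h.c_pos])).const_mul _
  have hdom : ∀ᶠ i in l, ∀ᵐ t : Fin p → ℝ, ‖H i t * nearError J T a θ ρ r L z D δ i t‖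
      ≤ B * C * Real.exp ((A + 1) * ‖t‖ - c / 4 * ‖t‖ ^ 2) := by
    filter_upwards [hB, hbound] with i h1 h2
    refine Eventually.of_forall fun t => ?_
    rw [norm_mul, Real.norm_eq_abs, Real.norm_eq_abs]
    calc |H i t| * |nearError J T a θ ρ r L z D δ i t|
        ≤ (B * Real.exp ‖t‖) * (C * Real.exp (A * ‖t‖ - c / 4 * ‖t‖ ^ 2)) :=
          mul_le_mul (h1 t) (h2 t).2 (abs_nonneg _) ((abs_nonneg _).trans (h1 t))
      _ = B * C * (Real.exp ‖t‖ * Real.exp (A * ‖t‖ - c / 4 * ‖t‖ ^ 2)) := by ring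
      _ = _ := by rw [← Real.exp_add]; congr 2; ring
  have hmeas : ∀ i, Measurable fun t => H i t * nearError J T a θ ρ r L z D δ i t :=
    fun i => (hH i).mul (h.measurable_nearError i)
  refine ⟨?_, ?_⟩
  · filter_upwards [hdom] with i hi
    exact hint.mono' (hmeas i).aestronglyMeasurable hi
  · have := tendsto_integral_filter_of_dominated_convergence
      (F := fun i t => H i t * nearError J T a θ ρ r L z D δ i t) (f := fun _ => (0 : ℝ))
      (μ := (volume : Measure (Fin p → ℝ))) (l := l) _
      (Eventually.of_forall fun i => (hmeas i).aestronglyMeasurable) hdom hint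
      (Eventually.of_forall fun t => by
        refine squeeze_zero_norm' (a := fun i => B * Real.exp ‖t‖ *
          |nearError J T a θ ρ r L z D δ i t|) ?_ (by
            simpa using (h.tendsto_nearError t).abs.const_mul (B * Real.exp ‖t‖))
        filter_upwards [hB] with i hi
        rw [norm_mul, Real.norm_eq_abs, Real.norm_eq_abs]
        exact mul_le_mul_of_nonneg_right (hi t) (abs_nonneg _))
    simpa using this

lemma nearWeight_mul_eq {i : ι} (hr : r i ≠ 0) (s : ℝ) (t : Fin p → ℝ) :
    s * nearWeight θ ρ r L δ i t
      = (r i)⁻¹ * (s * nearError J T a θ ρ r L z D δ i t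
        + s * (cubicPoly a (D i) T t * gaussWeight J (z i) t)) + s * gaussWeight J (z i) t := by
  rw [nearError]
  field_simp
  ring

lemma abs_mulVec_le (V : Matrix (Fin p) (Fin p) ℝ) {x : Fin p → ℝ} {M : ℝ} (hx : ‖x‖ ≤ M)
    (v : Fin p) : |V.mulVec x v| ≤ (∑ u, |V v u|) * M := by
  rw [Matrix.mulVec, dotProduct, Finset.sum_mul]
  refine (Finset.abs_sum_le_sum_abs _ _).trans (Finset.sum_le_sum fun u _ => ?_)
  rw [abs_mul]
  exact mul_le_mul_of_nonneg_left ((norm_le_pi_norm x u).trans hx) (abs_nonneg _)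

/-- Laplace expansion of the denominator. -/
lemma LaplaceSetting.tendsto_integral_near [l.NeBot] [l.IsCountablyGenerated]
    (h : LaplaceSetting l J T a Θ θ ρ r L z D c δ M₀ M₁ M₂) :
    (∀ᶠ i in l, Integrable (nearWeight θ ρ r L δ i)) ∧
    Tendsto (fun i => (∫ t, nearWeight θ ρ r L δ i t) - ∫ t, gaussWeight J (z i) t) l (𝓝 0) := by
  obtain ⟨hi1, hl1⟩ := h.tendsto_integral_nearError (H := fun _ _ => 1) (B := 1)
    (fun _ => measurable_const)
    (Eventually.of_forall fun i t => by simp [Real.one_le_exp (norm_nonneg t)])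
  obtain ⟨C, A, hC, hbound⟩ := h.exists_bound
  have hint : Integrable fun t : Fin p → ℝ => C * Real.exp (A * ‖t‖ - c / 4 * ‖t‖ ^ 2) :=
    (integrable_exp_norm_sub_norm_sq A (by linarith [h.c_pos])).const_mul _
  have hcg : ∀ i, Integrable fun t => cubicPoly a (D i) T t * gaussWeight J (z i) t :=
    fun i => (expGrowth_cubicPoly a (D i) T).integrable_mul_gaussWeight h.posDef (z i)
  have hgi : ∀ i, Integrable (gaussWeight J (z i)) := fun i => integrable_gaussWeight h.posDef _
  have hrep : ∀ i, r i ≠ 0 → nearWeight θ ρ r L δ i = fun t => (r i)⁻¹ *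
      (1 * nearError J T a θ ρ r L z D δ i t + cubicPoly a (D i) T t * gaussWeight J (z i) t)
      + gaussWeight J (z i) t := fun i hi => by
    ext t
    have := nearWeight_mul_eq (θ := θ) (ρ := ρ) (L := L) (J := J) (T := T) (a := a) (z := z)
      (D := D) (δ := δ) hi 1 t
    simpa using this
  refine ⟨?_, ?_⟩
  · filter_upwards [hi1, h.r_top.eventually_gt_atTop 0] with i h1 hr
    rw [hrep i hr.ne']
    exact ((h1.add (hcg i)).const_mul _).add (hgi i)
  · have hlim : Tendsto (fun i => (r i)⁻¹ * ((∫ t, 1 * nearError J T a θ ρ r L z D δ i t)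
        + ∫ t, cubicPoly a (D i) T t * gaussWeight J (z i) t)) l (𝓝 0) := by
      have hrinv : Tendsto (fun i => (r i)⁻¹) l (𝓝 0) := h.r_top.inv_tendsto_atTop
      have h2 : Tendsto (fun i => (r i)⁻¹ * ∫ t, cubicPoly a (D i) T t * gaussWeight J (z i) t)
          l (𝓝 0) := by
        refine squeeze_zero_norm' (a := fun i => |(r i)⁻¹| *
          ∫ t : Fin p → ℝ, C * Real.exp (A * ‖t‖ - c / 4 * ‖t‖ ^ 2)) ?_
          (by simpa using hrinv.abs.mul_const _)
        filter_upwards [hbound] with i hi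
        rw [norm_mul, Real.norm_eq_abs]
        refine mul_le_mul_of_nonneg_left ?_ (abs_nonneg _)
        exact norm_integral_le_of_norm_le hint (Eventually.of_forall fun t => (hi t).1)
      simpa [mul_add] using (hrinv.mul hl1).add h2
    refine hlim.congr' ?_
    filter_upwards [hi1, h.r_top.eventually_gt_atTop 0] with i h1 hr
    rw [hrep i hr.ne', integral_add ((h1.fun_add (hcg i)).const_mul _) (hgi i),
      integral_const_mul (r i)⁻¹, integral_add h1 (hcg i)]
    ring

/-- Laplace expansion of the centred numerator. -/
lemma LaplaceSetting.tendsto_integral_near_coord [l.NeBot] [l.IsCountablyGenerated]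
    (h : LaplaceSetting l J T a Θ θ ρ r L z D c δ M₀ M₁ M₂) (v : Fin p) :
    (∀ᶠ i in l, Integrable fun t =>
      (t v - J⁻¹.mulVec (z i) v) * nearWeight θ ρ r L δ i t) ∧
    Tendsto (fun i => r i * (∫ t, (t v - J⁻¹.mulVec (z i) v) * nearWeight θ ρ r L δ i t)
      - J⁻¹.mulVec (cubicMean a (D i) T J⁻¹ (J⁻¹.mulVec (z i))) v * ∫ t, gaussWeight J (z i) t)
      l (𝓝 0) := by
  set S : ℝ := (∑ u, |J⁻¹ v u|) * M₀
  have hyb : ∀ᶠ i in l, |J⁻¹.mulVec (z i) v| ≤ S := by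
    filter_upwards [h.z_bdd] with i hi using abs_mulVec_le _ hi v
  obtain ⟨hi1, hl1⟩ := h.tendsto_integral_nearError
    (H := fun i t => t v - J⁻¹.mulVec (z i) v) (B := 1 + S)
    (fun i => (measurable_pi_apply v).sub_const _) (by
      filter_upwards [hyb] with i hi t
      have h1 := (Real.norm_eq_abs (t v)) ▸ norm_le_pi_norm t v
      have h2 := Real.add_one_le_exp ‖t‖
      have h3 := Real.one_le_exp (norm_nonneg t)
      have h4 : S ≤ S * Real.exp ‖t‖ :=
        le_mul_of_one_le_right ((abs_nonneg _).trans hi) h3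
      rw [add_mul, one_mul]
      linarith [abs_sub (t v) (J⁻¹.mulVec (z i) v)])
  have hlin : ∀ i, ExpGrowth fun t : Fin p → ℝ => t v - J⁻¹.mulVec (z i) v := fun i => by
    simpa [sub_eq_add_neg] using (ExpGrowth.coord v).add (ExpGrowth.const (-J⁻¹.mulVec (z i) v))
  have hcg : ∀ i, Integrable fun t => (t v - J⁻¹.mulVec (z i) v) *
      (cubicPoly a (D i) T t * gaussWeight J (z i) t) := fun i => by
    simpa [mul_assoc] using
      ((hlin i).mul (expGrowth_cubicPoly a (D i) T)).integrable_mul_gaussWeight h.posDef (z i)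
  have hgi : ∀ i, Integrable fun t => (t v - J⁻¹.mulVec (z i) v) * gaussWeight J (z i) t :=
    fun i => (hlin i).integrable_mul_gaussWeight h.posDef (z i)
  -- Centring at the Gaussian mean removes the leading term, so the integral may be multiplied by
  -- `r` and still be compared with a bounded quantity.
  have hg0 : ∀ i, ∫ t, (t v - J⁻¹.mulVec (z i) v) * gaussWeight J (z i) t = 0 := by
    intro i
    simp only [sub_mul]
    rw [integral_sub ((ExpGrowth.coord v).integrable_mul_gaussWeight h.posDef (z i))
      ((integrable_gaussWeight h.posDef (z i)).const_mul _), integral_const_mul,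
      integral_coord_gaussWeight h.posDef, sub_self]
  have hrep : ∀ i, r i ≠ 0 → (fun t => (t v - J⁻¹.mulVec (z i) v) * nearWeight θ ρ r L δ i t)
      = fun t => (r i)⁻¹ *
      ((t v - J⁻¹.mulVec (z i) v) * nearError J T a θ ρ r L z D δ i t
        + (t v - J⁻¹.mulVec (z i) v) * (cubicPoly a (D i) T t * gaussWeight J (z i) t))
      + (t v - J⁻¹.mulVec (z i) v) * gaussWeight J (z i) t := fun i hi => by
    ext t
    exact nearWeight_mul_eq hi _ t
  refine ⟨?_, ?_⟩
  · filter_upwards [hi1, h.r_top.eventually_gt_atTop 0] with i h1 hr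
    rw [hrep i hr.ne']
    exact ((h1.add (hcg i)).const_mul _).add (hgi i)
  · refine hl1.congr' ?_
    filter_upwards [hi1, h.r_top.eventually_gt_atTop 0] with i h1 hr
    rw [hrep i hr.ne', integral_add ((h1.fun_add (hcg i)).const_mul _) (hgi i), integral_const_mul,
      integral_add h1 (hcg i), hg0, add_zero, mul_inv_cancel_left₀ hr.ne',
      integral_sub_mul_cubicPoly h.posDef (z i) a (h.D_symm i) h.T_symm_left h.T_symm_right v]
    ring

/-- Laplace expansion of the mean of a probability density proportional to `ρ exp(L_i)` on `Θ`. -/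
theorem LaplaceSetting.tendsto_mean [l.IsCountablyGenerated]
    (h : LaplaceSetting l J T a Θ θ ρ r L z D c δ M₀ M₁ M₂) (v : Fin p) :
    (∀ᶠ i in l, IntegrableOn (fun η => ρ η * Real.exp (L i η) * η v) Θ) ∧
    Tendsto (fun i => r i ^ 2 * ((∫ η in Θ, ρ η * Real.exp (L i η))⁻¹ *
        (∫ η in Θ, ρ η * Real.exp (L i η) * η v) - θ v)
      - r i * J⁻¹.mulVec (z i) v
      - J⁻¹.mulVec (cubicMean a (D i) T J⁻¹ (J⁻¹.mulVec (z i))) v) l (𝓝 0) := by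
  -- The filter is trivial if, on a given sample path, only finitely many sample sizes are good.
  rcases l.eq_or_neBot with rfl | hne
  · exact ⟨eventually_bot, tendsto_bot⟩
  set W : ι → ℝ := fun i => ∫ t, gaussWeight J (z i) t
  set W₀ : ℝ := ∫ t, gaussWeight J 0 t
  have hW₀ : 0 < W₀ := integral_gaussWeight_zero_pos h.posDef
  have hW : ∀ i, W₀ ≤ W i := fun i => integral_gaussWeight_zero_le h.posDef (z i)
  set y : ι → ℝ := fun i => J⁻¹.mulVec (z i) v
  set β : ι → ℝ := fun i => J⁻¹.mulVec (cubicMean a (D i) T J⁻¹ (J⁻¹.mulVec (z i))) v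
  set F : ι → (Fin p → ℝ) → ℝ := fun i η => ρ η * Real.exp (L i η)
  set tail : ι → ℝ := fun i => ∫ η in Θ \ Metric.closedBall θ δ, (1 + ‖η - θ‖) * F i η
  obtain ⟨hi0, hl0⟩ := h.tendsto_integral_near
  obtain ⟨hi1, hl1⟩ := h.tendsto_integral_near_coord v
  set S : ℝ := (∑ u, |J⁻¹ v u|) * M₀
  have hyb : ∀ᶠ i in l, |y i| ≤ S := by
    filter_upwards [h.z_bdd] with i hi using abs_mulVec_le _ hi v
  have hrinv : Tendsto (fun i => (r i)⁻¹) l (𝓝 0) := h.r_top.inv_tendsto_atTop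
  have hdm : MeasurableSet (Θ \ Metric.closedBall θ δ) :=
    h.measurableSet.diff Metric.isClosed_closedBall.measurableSet
  have hFm : ∀ i, Measurable (F i) := fun i => h.measurable_ρ.mul (h.measurable_L i).exp
  have hF0 : ∀ i, ∀ η ∈ Θ, 0 ≤ F i η := fun i η hη =>
    mul_nonneg (h.nonneg η hη) (Real.exp_pos _).le
  have hsplit : ∀ {Φ : (Fin p → ℝ) → ℝ}, IntegrableOn Φ (Metric.closedBall θ δ) →
      IntegrableOn Φ (Θ \ Metric.closedBall θ δ) → IntegrableOn Φ Θ ∧ ∫ η in Θ, Φ η =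
        (∫ η in Metric.closedBall θ δ, Φ η) + ∫ η in Θ \ Metric.closedBall θ δ, Φ η := by
    intro Φ h1 h2
    have hu : Metric.closedBall θ δ ∪ Θ \ Metric.closedBall θ δ = Θ :=
      Set.union_sdiff_cancel h.ball_subset
    have h3 := setIntegral_union Set.disjoint_sdiff_right hdm h1 h2
    rw [hu] at h3
    exact ⟨hu ▸ h1.union h2, h3⟩
  -- the part of the integrals far from `θ`
  have hfar0 : ∀ᶠ i in l, IntegrableOn (F i) (Θ \ Metric.closedBall θ δ) ∧
      |∫ η in Θ \ Metric.closedBall θ δ, F i η| ≤ tail i := by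
    filter_upwards [h.tail_int] with i hi
    have hle : ∀ᵐ η ∂(volume.restrict (Θ \ Metric.closedBall θ δ)),
        ‖F i η‖ ≤ (1 + ‖η - θ‖) * F i η := by
      filter_upwards [ae_restrict_mem hdm] with η hη
      rw [Real.norm_of_nonneg (hF0 i η hη.1)]
      exact le_mul_of_one_le_left (hF0 i η hη.1) (by linarith [norm_nonneg (η - θ)])
    exact ⟨hi.mono' (hFm i).aestronglyMeasurable hle, norm_integral_le_of_norm_le hi hle⟩
  have hfar1 : ∀ᶠ i in l, IntegrableOn (fun η => (r i * (η v - θ v) - y i) * F i η)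
      (Θ \ Metric.closedBall θ δ) ∧
      |∫ η in Θ \ Metric.closedBall θ δ, (r i * (η v - θ v) - y i) * F i η|
        ≤ (r i + S) * tail i := by
    filter_upwards [h.tail_int, hyb, h.r_top.eventually_gt_atTop 0] with i hi hy hr
    have hle : ∀ᵐ η ∂(volume.restrict (Θ \ Metric.closedBall θ δ)),
        ‖(r i * (η v - θ v) - y i) * F i η‖ ≤ (r i + S) * ((1 + ‖η - θ‖) * F i η) := by
      filter_upwards [ae_restrict_mem hdm] with η hη
      rw [norm_mul, Real.norm_of_nonneg (hF0 i η hη.1), ← mul_assoc (r i + S), Real.norm_eq_abs]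
      refine mul_le_mul_of_nonneg_right ?_ (hF0 i η hη.1)
      have h1 := abs_sub (r i * (η v - θ v)) (y i)
      rw [abs_mul, abs_of_pos hr] at h1
      have h2 : |η v - θ v| ≤ ‖η - θ‖ := norm_le_pi_norm (η - θ) v
      have h3 := mul_le_mul_of_nonneg_left h2 hr.le
      have h4 : 0 ≤ S * ‖η - θ‖ := mul_nonneg ((abs_nonneg _).trans hy) (norm_nonneg _)
      nlinarith
    refine ⟨(hi.const_mul _).mono' ?_ hle, ?_⟩
    · exact ((((measurable_pi_apply v).sub_const _).const_mul _).sub_const _).mul (hFm i)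
        |>.aestronglyMeasurable
    · rw [← integral_const_mul]
      exact norm_integral_le_of_norm_le (hi.const_mul _) hle
  -- denominator
  have hden : Tendsto (fun i => r i ^ p * (∫ η in Θ, F i η) - W i) l (𝓝 0) := by
    have ht : Tendsto (fun i => r i ^ p * ∫ η in Θ \ Metric.closedBall θ δ, F i η) l (𝓝 0) := by
      refine squeeze_zero_norm' (a := fun i => (r i)⁻¹ ^ 2 * (r i ^ (p + 2) * tail i)) ?_ (by
        simpa using (hrinv.pow 2).mul h.tail_lim)
      filter_upwards [hfar0, h.r_top.eventually_gt_atTop 0] with i hi hr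
      rw [norm_mul, Real.norm_of_nonneg (by positivity), Real.norm_eq_abs]
      calc _ ≤ r i ^ p * tail i := mul_le_mul_of_nonneg_left hi.2 (by positivity)
        _ = _ := by field_simp; ring
    have := hl0.add ht
    rw [add_zero] at this
    refine this.congr' ?_
    filter_upwards [hi0, hfar0, h.r_top.eventually_gt_atTop 0] with i h1 h2 hr
    have hb := integrableOn_closedBall_rescale (Φ := F i) θ hr h1
    rw [(hsplit hb h2.1).2, mul_add, ← integral_closedBall_rescale θ hr (F i)]
    simp only [nearWeight, F, W]
    ring
  have hcov : ∀ i, 0 < r i → ∀ t, (t v - y i) * nearWeight θ ρ r L δ i t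
      = (Metric.closedBall 0 (δ * r i)).indicator (fun t =>
        (fun η => (r i * (η v - θ v) - y i) * F i η) (θ + (r i)⁻¹ • t)) t := by
    intro i hr t
    simp only [nearWeight, Set.indicator]
    split_ifs
    · simp only [Pi.add_apply, Pi.smul_apply, smul_eq_mul, add_sub_cancel_left,
        mul_inv_cancel_left₀ hr.ne', F]
    · rw [mul_zero]
  -- The power `p + 1` is the Jacobian `r^p` times the factor `r` of the centred expansion. Since
  -- the far integrand contributes another factor of order `r`, the tail must be negligible at order
  -- `r^(p+2)`, the exponent in `tail_lim`.
  have hnum : Tendsto (fun i => r i ^ (p + 1) * (∫ η in Θ, (r i * (η v - θ v) - y i) * F i η)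
      - β i * W i) l (𝓝 0) := by
    have ht : Tendsto (fun i => r i ^ (p + 1) *
        ∫ η in Θ \ Metric.closedBall θ δ, (r i * (η v - θ v) - y i) * F i η) l (𝓝 0) := by
      refine squeeze_zero_norm' (a := fun i => (1 + S * (r i)⁻¹) * (r i ^ (p + 2) * tail i)) ?_ (by
        simpa using ((hrinv.const_mul S).const_add 1).mul h.tail_lim)
      filter_upwards [hfar1, h.r_top.eventually_gt_atTop 0] with i hi hr
      rw [norm_mul, Real.norm_of_nonneg (by positivity), Real.norm_eq_abs]
      calc _ ≤ r i ^ (p + 1) * ((r i + S) * tail i) :=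
            mul_le_mul_of_nonneg_left hi.2 (by positivity)
        _ = _ := by field_simp; ring
    have := hl1.add ht
    rw [add_zero] at this
    refine this.congr' ?_
    filter_upwards [hi1, hfar1, h.r_top.eventually_gt_atTop 0] with i h1 h2 hr
    rw [show (fun t => (t v - J⁻¹.mulVec (z i) v) * nearWeight θ ρ r L δ i t) = _ from
      funext (hcov i hr)] at h1 ⊢
    have hb := integrableOn_closedBall_rescale
      (Φ := fun η => (r i * (η v - θ v) - y i) * F i η) θ hr h1
    rw [(hsplit hb h2.1).2, mul_add, integral_closedBall_rescale θ hr
      (fun η => (r i * (η v - θ v) - y i) * F i η)]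
    ring
  -- `β * W` is itself an integral with a fixed integrable majorant, and `W ≥ W₀`; this bounds `β`
  -- without estimating its coefficients.
  have hβ : ∃ Bβ, ∀ᶠ i in l, |β i| ≤ Bβ := by
    obtain ⟨C, A, hC, hbound⟩ := h.exists_bound
    have hint : Integrable fun t : Fin p → ℝ =>
        (1 + S) * C * Real.exp ((A + 1) * ‖t‖ - c / 4 * ‖t‖ ^ 2) :=
      (integrable_exp_norm_sub_norm_sq (A + 1) (by linarith [h.c_pos])).const_mul _
    refine ⟨(∫ t : Fin p → ℝ, (1 + S) * C * Real.exp ((A + 1) * ‖t‖ - c / 4 * ‖t‖ ^ 2)) / W₀, ?_⟩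
    filter_upwards [hbound, hyb] with i hi hy
    have h1 := integral_sub_mul_cubicPoly h.posDef (z i) a (h.D_symm i) h.T_symm_left
      h.T_symm_right v
    rw [le_div_iff₀ hW₀]
    calc |β i| * W₀ ≤ |β i| * W i := mul_le_mul_of_nonneg_left (hW i) (abs_nonneg _)
      _ = |β i * W i| := by rw [abs_mul, abs_of_pos (hW₀.trans_le (hW i))]
      _ ≤ _ := by
        rw [← h1, ← Real.norm_eq_abs]
        refine norm_integral_le_of_norm_le hint (Eventually.of_forall fun t => ?_)
        rw [norm_mul, Real.norm_eq_abs, Real.norm_eq_abs]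
        have h2 : |t v - J⁻¹.mulVec (z i) v| ≤ (1 + S) * Real.exp ‖t‖ := by
          have h1 := (Real.norm_eq_abs (t v)) ▸ norm_le_pi_norm t v
          have h2 := Real.add_one_le_exp ‖t‖
          have h3 := Real.one_le_exp (norm_nonneg t)
          have h4 : S ≤ S * Real.exp ‖t‖ := le_mul_of_one_le_right ((abs_nonneg _).trans hy) h3
          rw [add_mul, one_mul]
          linarith [abs_sub (t v) (J⁻¹.mulVec (z i) v)]
        calc _ ≤ ((1 + S) * Real.exp ‖t‖) * (C * Real.exp (A * ‖t‖ - c / 4 * ‖t‖ ^ 2)) :=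
              mul_le_mul h2 (hi t).1 (abs_nonneg _) ((abs_nonneg _).trans h2)
          _ = (1 + S) * C * (Real.exp ‖t‖ * Real.exp (A * ‖t‖ - c / 4 * ‖t‖ ^ 2)) := by ring
          _ = _ := by rw [← Real.exp_add]; congr 2; ring
  obtain ⟨Bβ, hBβ⟩ := hβ
  set Nn : ι → ℝ := fun i => r i ^ (p + 1) * ∫ η in Θ, (r i * (η v - θ v) - y i) * F i η
  set Dn : ι → ℝ := fun i => r i ^ p * ∫ η in Θ, F i η
  have hDpos : ∀ᶠ i in l, W₀ / 2 < Dn i := by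
    have := hden.eventually (lt_mem_nhds (show -(W₀ / 2) < 0 by linarith))
    filter_upwards [this] with i hi
    linarith [hW i]
  -- Neither `W` nor `β` need converge. It is enough that the denominators stay above `W₀ / 2` and
  -- `β` stays bounded.
  have hquot : Tendsto (fun i => Nn i / Dn i - β i) l (𝓝 0) := by
    refine squeeze_zero_norm' (a := fun i => (2 / W₀) * (|Nn i - β i * W i|
      + Bβ * |Dn i - W i|)) ?_ (by
        simpa using (hnum.abs.add (hden.abs.const_mul Bβ)).const_mul (2 / W₀))
    filter_upwards [hDpos, hBβ] with i hD hβi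
    have hD0 : 0 < Dn i := by linarith
    have e : Nn i / Dn i - β i = (Dn i)⁻¹ * ((Nn i - β i * W i) - β i * (Dn i - W i)) := by
      field_simp; ring
    rw [e, norm_mul, Real.norm_eq_abs, Real.norm_eq_abs, abs_of_pos (inv_pos.2 hD0)]
    have h1 : (Dn i)⁻¹ ≤ 2 / W₀ := by
      rw [← inv_div]
      exact inv_anti₀ (by linarith) hD.le
    refine mul_le_mul h1 ((abs_sub _ _).trans ?_) (abs_nonneg _) (by positivity)
    rw [abs_mul]
    gcongr
  have hints : ∀ᶠ i in l, IntegrableOn (F i) Θ ∧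
      IntegrableOn (fun η => (r i * (η v - θ v) - y i) * F i η) Θ := by
    filter_upwards [hi0, hfar0, hi1, hfar1, h.r_top.eventually_gt_atTop 0] with i h0 hf0 h1 hf1 hr
    have hb0 := integrableOn_closedBall_rescale (Φ := F i) θ hr h0
    rw [show (fun t => (t v - J⁻¹.mulVec (z i) v) * nearWeight θ ρ r L δ i t) = _ from
        funext (hcov i hr)] at h1
    have hb1 := integrableOn_closedBall_rescale
        (Φ := fun η => (r i * (η v - θ v) - y i) * F i η) θ hr h1
    exact ⟨(hsplit hb0 hf0.1).1, (hsplit hb1 hf1.1).1⟩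
  have hcoord : ∀ i, 0 < r i → (fun η : Fin p → ℝ => F i η * η v) = fun η => (r i)⁻¹ *
      ((r i * (η v - θ v) - y i) * F i η + (y i + r i * θ v) * F i η) := by
    intro i hr
    ext η
    field_simp
    ring
  refine ⟨?_, hquot.congr' ?_⟩
  · filter_upwards [hints, h.r_top.eventually_gt_atTop 0] with i hi hr
    change IntegrableOn (fun η => F i η * η v) Θ
    rw [hcoord i hr]
    exact (hi.2.add (hi.1.const_mul _)).const_mul _
  filter_upwards [hDpos, hints, h.r_top.eventually_gt_atTop 0] with i hD hi hr
  have hne0 : (∫ η in Θ, F i η) ≠ 0 := by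
    intro h0
    simp only [Dn, h0, mul_zero] at hD
    linarith
  change Nn i / Dn i - β i = r i ^ 2 * ((∫ η in Θ, F i η)⁻¹ * (∫ η in Θ, F i η * η v) - θ v)
    - r i * y i - β i
  rw [hcoord i hr, integral_const_mul (r i)⁻¹, integral_add hi.2 (hi.1.const_mul _),
    integral_const_mul (y i + r i * θ v)]
  simp only [Nn, Dn]
  field_simp
  ring

end Laplace

section LogLik

variable {p : ℕ} {𝒳 : Type*} [MeasurableSpace 𝒳] {μ : Measure 𝒳}
  {f : (Fin p → ℝ) → 𝒳 → ℝ} {Θ : Set (Fin p → ℝ)}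

/-! ### The log-likelihood as a sum -/

lemma RegularModel.jointDensity_pos (hm : RegularModel μ f Θ) (n : ℕ) (ω : ℕ → 𝒳)
    {η : Fin p → ℝ} (hη : η ∈ Θ) : 0 < jointDensity f n ω η :=
  Finset.prod_pos fun i _ => hm.pos η hη (ω i)

lemma RegularModel.logLik_eq_sum (hm : RegularModel μ f Θ) (n : ℕ) (ω : ℕ → 𝒳)
    {η : Fin p → ℝ} (hη : η ∈ Θ) :
    logLik f n ω η = ∑ i ∈ Finset.range n, logDensity f (ω i) η :=
  Real.log_prod fun i _ => (hm.pos η hη (ω i)).ne'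

lemma RegularModel.exp_logLik_sub (hm : RegularModel μ f Θ) (n : ℕ) (ω : ℕ → 𝒳)
    {η θ : Fin p → ℝ} (hη : η ∈ Θ) (hθ : θ ∈ Θ) :
    Real.exp (logLik f n ω η - logLik f n ω θ) = jointDensity f n ω η / jointDensity f n ω θ := by
  rw [Real.exp_sub, logLik, logLik, Real.exp_log (hm.jointDensity_pos n ω hη),
    Real.exp_log (hm.jointDensity_pos n ω hθ)]

lemma RegularModel.logLik_add (hm : RegularModel μ f Θ) (m n : ℕ) (ω : ℕ → 𝒳)
    {η : Fin p → ℝ} (hη : η ∈ Θ) :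
    logLik f (m + n) ω η = logLik f m ω η + logLik f n (fun i => ω (i + m)) η := by
  rw [hm.logLik_eq_sum _ _ hη, hm.logLik_eq_sum _ _ hη, hm.logLik_eq_sum _ _ hη,
    Finset.sum_range_add]
  simp only [add_comm]

lemma RegularModel.logLik_eventuallyEq (hm : RegularModel μ f Θ) (n : ℕ) (ω : ℕ → 𝒳)
    {η : Fin p → ℝ} (hη : η ∈ interior Θ) :
    logLik f n ω =ᶠ[𝓝 η] fun η => ∑ i ∈ Finset.range n, logDensity f (ω i) η := by
  filter_upwards [isOpen_interior.mem_nhds hη] with ζ hζ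
  exact hm.logLik_eq_sum n ω (interior_subset hζ)

lemma RegularModel.pd_logLik (hm : RegularModel μ f Θ) (n : ℕ) (ω : ℕ → 𝒳) (v : Fin p)
    {η : Fin p → ℝ} (hη : η ∈ interior Θ) :
    pd v (logLik f n ω) η = ∑ i ∈ Finset.range n, pd v (logDensity f (ω i)) η := by
  rw [pd_congr (hm.logLik_eventuallyEq n ω hη), pd_sum fun i _ => hm.diff_zero (ω i) hη]

lemma RegularModel.pd_pd_logLik (hm : RegularModel μ f Θ) (n : ℕ) (ω : ℕ → 𝒳) (u v : Fin p)
    {η : Fin p → ℝ} (hη : η ∈ interior Θ) :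
    pd u (pd v (logLik f n ω)) η
      = ∑ i ∈ Finset.range n, pd u (pd v (logDensity f (ω i))) η := by
  have h : pd v (logLik f n ω)
      =ᶠ[𝓝 η] fun η => ∑ i ∈ Finset.range n, pd v (logDensity f (ω i)) η := by
    filter_upwards [isOpen_interior.mem_nhds hη] with ζ hζ using hm.pd_logLik n ω v hζ
  rw [pd_congr h, pd_sum fun i _ => hm.diff_one (ω i) v hη]

lemma RegularModel.pd_pd_pd_logLik (hm : RegularModel μ f Θ) (n : ℕ) (ω : ℕ → 𝒳)
    (t u v : Fin p) {η : Fin p → ℝ} (hη : η ∈ interior Θ) :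
    pd t (pd u (pd v (logLik f n ω))) η
      = ∑ i ∈ Finset.range n, pd t (pd u (pd v (logDensity f (ω i)))) η := by
  have h : pd u (pd v (logLik f n ω))
      =ᶠ[𝓝 η] fun η => ∑ i ∈ Finset.range n, pd u (pd v (logDensity f (ω i))) η := by
    filter_upwards [isOpen_interior.mem_nhds hη] with ζ hζ using hm.pd_pd_logLik n ω u v hζ
  rw [pd_congr h, pd_sum fun i _ => hm.diff_two (ω i) u v hη]

lemma RegularModel.contDiffOn_logLik (hm : RegularModel μ f Θ) (n : ℕ) (ω : ℕ → 𝒳) :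
    ContDiffOn ℝ 3 (logLik f n ω) (interior Θ) :=
  (ContDiffOn.sum fun i _ => hm.smooth (ω i)).congr fun η hη => by
    exact hm.logLik_eq_sum n ω (interior_subset hη)

lemma RegularModel.measurable_jointDensity_uncurry (hm : RegularModel μ f Θ) (n : ℕ) :
    Measurable fun q : (ℕ → 𝒳) × (Fin p → ℝ) => jointDensity f n q.1 q.2 := by
  refine Finset.measurable_fun_prod _ fun i _ => ?_
  exact hm.measurable.comp
    (measurable_snd.prodMk ((measurable_pi_apply i).comp measurable_fst))

lemma RegularModel.measurable_logLik (hm : RegularModel μ f Θ) (n : ℕ) (ω : ℕ → 𝒳) :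
    Measurable (logLik f n ω) :=
  ((hm.measurable_jointDensity_uncurry n).comp measurable_prodMk_left).log

lemma RegularModel.measurable_bayes (hm : RegularModel μ f Θ) {π : (Fin p → ℝ) → ℝ}
    (hπ : Measurable π) (n : ℕ) : Measurable (bayes f Θ π n) := by
  have hj := hm.measurable_jointDensity_uncurry n
  have h1 : Measurable fun q : (ℕ → 𝒳) × (Fin p → ℝ) => π q.2 * jointDensity f n q.1 q.2 :=
    (hπ.comp measurable_snd).mul hj
  have h2 : Measurable fun q : (ℕ → 𝒳) × (Fin p → ℝ) =>
      (π q.2 * jointDensity f n q.1 q.2) • q.2 := h1.smul measurable_snd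
  have i1 := h1.stronglyMeasurable.integral_prod_right' (ν := volume.restrict Θ)
  have i2 := h2.stronglyMeasurable.integral_prod_right' (ν := volume.restrict Θ)
  exact i1.measurable.inv.smul i2.measurable

lemma RegularModel.measurable_pd_logLik (hm : RegularModel μ f Θ) (n : ℕ) (v : Fin p)
    {θ : Fin p → ℝ} (hθ : θ ∈ interior Θ) :
    Measurable fun ω : ℕ → 𝒳 => pd v (logLik f n ω) θ := by
  simp only [hm.pd_logLik n _ v hθ]
  exact Finset.measurable_fun_sum _ fun i _ => (hm.measurable_score v hθ).comp
    (measurable_pi_apply i)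

lemma RegularModel.measurable_pd_pd_logLik (hm : RegularModel μ f Θ) (n : ℕ) (u v : Fin p)
    {θ : Fin p → ℝ} (hθ : θ ∈ interior Θ) :
    Measurable fun ω : ℕ → 𝒳 => pd u (pd v (logLik f n ω)) θ := by
  simp only [hm.pd_pd_logLik n _ u v hθ]
  exact Finset.measurable_fun_sum _ fun i _ => (hm.measurable_hess u v hθ).comp
    (measurable_pi_apply i)

lemma RegularModel.measurable_remainder (hm : RegularModel μ f Θ) {π : (Fin p → ℝ) → ℝ}
    (hπ : Measurable π) (n : ℕ) {θ : Fin p → ℝ} (hθ : θ ∈ interior Θ) :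
    Measurable (remainder μ f Θ π θ n) := by
  have h1 := fun v => hm.measurable_pd_logLik n v hθ
  have h2 := fun u v => hm.measurable_pd_pd_logLik n u v hθ
  refine ((hm.measurable_bayes hπ n).sub_const θ).sub (Measurable.fun_const_smul ?_ _)
  refine measurable_pi_lambda _ fun w => ?_
  simp only [Matrix.mulVec, dotProduct, An, In, Jn]
  fun_prop

/-! ### Taylor expansion of the log-likelihood -/

/-- The normalized score `n^{-1/2} ∂ℓ_n(θ)`. -/
noncomputable def normScore (f : (Fin p → ℝ) → 𝒳 → ℝ) (θ : Fin p → ℝ) (ω : ℕ → 𝒳) (n : ℕ) :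
    Fin p → ℝ :=
  fun v => (Real.sqrt n)⁻¹ * pd v (logLik f n ω) θ

/-- The normalized and centred Hessian `n^{1/2} (n⁻¹ ∂²ℓ_n(θ) + I(θ))`. -/
noncomputable def normHess (μ : Measure 𝒳) (f : (Fin p → ℝ) → 𝒳 → ℝ) (θ : Fin p → ℝ)
    (ω : ℕ → 𝒳) (n : ℕ) (u v : Fin p) : ℝ :=
  Real.sqrt n * ((n : ℝ)⁻¹ * pd u (pd v (logLik f n ω)) θ + fisher μ f θ u v)

/-- The expansion is about the true value and uses the information in place of the observed Hessian.
The discrepancy, of order `n^{-1/2}` after averaging, becomes the quadratic part of the error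
polynomial, alongside the averaged third derivatives at an intermediate point. -/
lemma RegularModel.logLik_taylor (hm : RegularModel μ f Θ) {θ : Fin p → ℝ} {δ : ℝ}
    (hball : Metric.closedBall θ δ ⊆ interior Θ) (ω : ℕ → 𝒳) {n : ℕ} (hn : n ≠ 0)
    {t : Fin p → ℝ} (ht : ‖t‖ ≤ δ * Real.sqrt n) :
    ∃ ξ ∈ Set.Ioo (0 : ℝ) 1,
      Real.sqrt n * (logLik f n ω (θ + (Real.sqrt n)⁻¹ • t) - logLik f n ω θ
        - (normScore f θ ω n ⬝ᵥ t - (t ⬝ᵥ (fisher μ f θ).mulVec t) / 2))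
      = cubicPoly 0 (normHess μ f θ ω n) (fun a b c => (n : ℝ)⁻¹ *
          pd a (pd b (pd c (logLik f n ω))) (θ + ξ • (Real.sqrt n)⁻¹ • t)) t := by
  have hs : 0 < Real.sqrt n := Real.sqrt_pos.2 (by exact_mod_cast Nat.pos_of_ne_zero hn)
  have hs2 : Real.sqrt n * Real.sqrt n = n := Real.mul_self_sqrt n.cast_nonneg
  have hnorm : ‖(Real.sqrt n)⁻¹ • t‖ ≤ δ := by
    rw [norm_smul, Real.norm_of_nonneg (inv_pos.2 hs).le, inv_mul_le_iff₀ hs, mul_comm]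
    exact ht
  obtain ⟨ξ, hξ, e⟩ := taylor_three isOpen_interior (hm.contDiffOn_logLik n ω)
    (θ := θ) (h := (Real.sqrt n)⁻¹ • t) (fun s hs => hball (by
      rw [Metric.mem_closedBall, dist_eq_norm, add_sub_cancel_left, norm_smul,
        Real.norm_of_nonneg hs.1]
      calc s * ‖(Real.sqrt n)⁻¹ • t‖ ≤ 1 * δ := mul_le_mul hs.2 hnorm (norm_nonneg _) zero_le_one
        _ = δ := one_mul δ))
  refine ⟨ξ, hξ, ?_⟩
  rw [e]
  set s := Real.sqrt n with hsdef
  have e1 : ∑ v, (s⁻¹ • t) v * pd v (logLik f n ω) θ = normScore f θ ω n ⬝ᵥ t := by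
    simp only [dotProduct, normScore, Pi.smul_apply, smul_eq_mul]
    exact Finset.sum_congr rfl fun v _ => by ring
  have e2 : s * ((∑ u, ∑ v, (s⁻¹ • t) u * (s⁻¹ • t) v * pd u (pd v (logLik f n ω)) θ) / 2
      + (t ⬝ᵥ (fisher μ f θ).mulVec t) / 2)
      = 1 / 2 * ∑ u, ∑ v, normHess μ f θ ω n u v * (t u * t v) := by
    simp only [dotProduct, Matrix.mulVec, normHess, Pi.smul_apply, smul_eq_mul, Finset.mul_sum,
      ← add_div, ← Finset.sum_add_distrib, Finset.sum_div, ← hsdef]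
    refine Finset.sum_congr rfl fun u _ => Finset.sum_congr rfl fun v _ => ?_
    rw [← hs2]
    field_simp
  have e3 : s * ((∑ a, ∑ b, ∑ c, (s⁻¹ • t) a * (s⁻¹ • t) b * (s⁻¹ • t) c *
      pd a (pd b (pd c (logLik f n ω))) (θ + ξ • s⁻¹ • t)) / 6)
      = 1 / 6 * ∑ a, ∑ b, ∑ c, ((n : ℝ)⁻¹ *
          pd a (pd b (pd c (logLik f n ω))) (θ + ξ • s⁻¹ • t)) * (t a * t b * t c) := by
    simp only [Pi.smul_apply, smul_eq_mul, Finset.mul_sum, Finset.sum_div]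
    refine Finset.sum_congr rfl fun a _ => Finset.sum_congr rfl fun b _ =>
      Finset.sum_congr rfl fun c _ => ?_
    rw [← hs2]
    field_simp
  rw [cubicPoly, ← e2, ← e3, e1]
  simp only [Pi.zero_apply, zero_mul, Finset.sum_const_zero]
  ring

end LogLik

section Path

variable {p : ℕ} {𝒳 : Type*} [MeasurableSpace 𝒳] {μ : Measure 𝒳}
  {f : (Fin p → ℝ) → 𝒳 → ℝ} {Θ : Set (Fin p → ℝ)} {π : (Fin p → ℝ) → ℝ}

/-! ### Local behaviour of the prior -/

/-- Differentiability at the single point `θ` suffices, since increments are compared with the value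
at `θ` only. -/
lemma RegularPrior.exists_lip (hp : RegularPrior μ f Θ π) {θ : Fin p → ℝ}
    (hθ : θ ∈ interior Θ) :
    ∃ C, 0 ≤ C ∧ ∃ δ > 0, ∀ η ∈ Metric.closedBall θ δ, |π η / π θ - 1| ≤ C * ‖η - θ‖ := by
  have hpos := hp.pos θ hθ
  obtain ⟨C, hC, hO⟩ := ((hp.diff θ hθ).isBigO_sub).exists_pos
  obtain ⟨δ, hδ, hsub⟩ := Metric.nhds_basis_closedBall.mem_iff.1 hO.bound
  refine ⟨C / π θ, by positivity, δ, hδ, fun η hη => ?_⟩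
  have h1 : ‖π η - π θ‖ ≤ C * ‖η - θ‖ := hsub hη
  rw [div_sub_one hpos.ne', abs_div, abs_of_pos hpos, div_mul_eq_mul_div]
  exact div_le_div_of_nonneg_right h1 hpos.le

/-- The normalized prior `π / π θ` has value one at `θ`, so its gradient there is that of `log π`.
-/
lemma RegularPrior.tendsto_slope (hp : RegularPrior μ f Θ π) {θ : Fin p → ℝ}
    (hθ : θ ∈ interior Θ) (t : Fin p → ℝ) :
    Tendsto (fun n : ℕ => Real.sqrt n * (π (θ + (Real.sqrt n)⁻¹ • t) / π θ - 1)) atTop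
      (𝓝 (∑ v, gradLogPrior π θ v * t v)) := by
  have hpos := hp.pos θ hθ
  have hd := hp.diff θ hθ
  have h1 : HasLineDerivAt ℝ (fun η => π η / π θ) (∑ v, gradLogPrior π θ v * t v) θ t := by
    have e : ∑ v, gradLogPrior π θ v * t v = fderiv ℝ (fun η => π η / π θ) θ t := by
      have h2 : ∑ v, gradLogPrior π θ v * t v = fderiv ℝ (fun η => Real.log (π η)) θ t := by
        rw [fderiv_eq_sum_pd (hd.log hpos.ne')]
        exact Finset.sum_congr rfl fun v _ => by rw [gradLogPrior, mul_comm]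
      rw [h2, fderiv.log hd hpos.ne']
      simp only [div_eq_inv_mul]
      rw [fderiv_const_mul hd]
    rw [e]
    have hd' : DifferentiableAt ℝ (fun η => π η / π θ) θ := by
      simp only [div_eq_mul_inv]
      exact hd.mul_const _
    exact hd'.hasFDerivAt.hasLineDerivAt t
  have h0 : Tendsto (fun n : ℕ => (Real.sqrt n)⁻¹) atTop (𝓝[>] 0) := by
    refine tendsto_nhdsWithin_iff.2 ⟨?_, ?_⟩
    · exact (Real.tendsto_sqrt_atTop.comp tendsto_natCast_atTop_atTop).inv_tendsto_atTop
    · filter_upwards [eventually_gt_atTop 0] with n hn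
      exact inv_pos.2 (Real.sqrt_pos.2 (Nat.cast_pos.2 hn))
  have h3 := h1.tendsto_slope_zero_right.comp h0
  simpa [Function.comp_def, div_self hpos.ne'] using h3

lemma cubicPoly_sub_cubicPoly (D : Fin p → Fin p → ℝ) (T T' : Fin p → Fin p → Fin p → ℝ)
    (t : Fin p → ℝ) : cubicPoly 0 D T t - cubicPoly 0 D T' t
      = 1 / 6 * ∑ a, ∑ b, ∑ c, (T a b c - T' a b c) * (t a * t b * t c) := by
  simp only [cubicPoly, sub_mul, Finset.sum_sub_distrib]
  ring

/-! ### Convergence along a sample path -/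

/-- Along a sample path that is regular for all sample sizes in `S`, the posterior densities form a
Laplace setting. -/
lemma RegularModel.laplaceSetting (hm : RegularModel μ f Θ) (hp : RegularPrior μ f Θ π)
    (hΘ : MeasurableSet Θ) {θ : Fin p → ℝ} (hθ : θ ∈ interior Θ) {c δ MK M₀ ε : ℝ} (hc : 0 < c)
    (hcoer : ∀ t, c * ‖t‖ ^ 2 ≤ t ⬝ᵥ (fisher μ f θ).mulVec t) (hδ : 0 < δ)
    (hball : Metric.closedBall θ δ ⊆ interior Θ) (hMK : ∀ u v w, |K μ f θ u v w| ≤ MK)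
    (hMK0 : 0 ≤ MK) (hM₀ : 0 ≤ M₀)
    (hsmall : (p ^ 3 * (MK + 1) / 6) * δ ≤ c / 8)
    (hlip : ∀ η ∈ Metric.closedBall θ δ, |π η / π θ - 1| ≤ M₀ * ‖η - θ‖)
    {ω : ℕ → 𝒳} {S : Set ℕ} {m : ℕ}
    (hthird_one : ∀ᶠ n : ℕ in atTop, ∀ η ∈ Metric.closedBall θ δ, ∀ u v w,
      |(n : ℝ)⁻¹ * pd u (pd v (pd w (logLik f n ω))) η - K μ f θ u v w| ≤ 1)
    (hthird : ∀ κ > 0, ∃ s > 0, ∀ᶠ n : ℕ in atTop, ∀ η ∈ Metric.ball θ s, ∀ u v w,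
      |(n : ℝ)⁻¹ * pd u (pd v (pd w (logLik f n ω))) η - K μ f θ u v w| ≤ κ)
    (hS : ∀ n ∈ S, ‖normScore f θ ω n‖ ≤ M₀ ∧ ∀ u v, |normHess μ f θ ω n u v| ≤ M₀)
    (hint : IntegrableOn (fun η => (1 + ‖η‖) * (π η * jointDensity f m ω η)) Θ) (hε : 0 < ε)
    (hsep : ∀ n ∈ S, m ≤ n → ∀ η ∈ Θ, δ ≤ ‖η - θ‖ →
      logLik f (n - m) (fun i => ω (i + m)) η - logLik f (n - m) (fun i => ω (i + m)) θ
        ≤ -(ε * ((n - m : ℕ) : ℝ))) :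
    LaplaceSetting (atTop ⊓ 𝓟 S) (fisher μ f θ) (K μ f θ) (gradLogPrior π θ) Θ θ
      (fun η => π η / π θ) (fun n : ℕ => Real.sqrt n)
      (fun n η => logLik f n ω η - logLik f n ω θ) (normScore f θ ω) (normHess μ f θ ω) c δ M₀
      (p ^ 2 * M₀ / 2) (p ^ 3 * (MK + 1) / 6) := by
  have hθΘ := interior_subset hθ
  have hpos := hp.pos θ hθ
  have hr : Tendsto (fun n : ℕ => Real.sqrt n) (atTop ⊓ 𝓟 S) atTop :=
    (Real.tendsto_sqrt_atTop.comp tendsto_natCast_atTop_atTop).mono_left inf_le_left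
  -- The first `m` observations turn the prior into an integrable function with finite mean; the
  -- remaining `n - m` supply the exponential factor. The majorant is thus a fixed integrable
  -- function times a scalar that beats every power of `n`.
  have hfar : ∀ n ∈ S, m ≤ n → ∀ η ∈ Θ \ Metric.closedBall θ δ,
      (1 + ‖η - θ‖) * (π η / π θ * Real.exp (logLik f n ω η - logLik f n ω θ))
        ≤ Real.exp (-(ε * ((n - m : ℕ) : ℝ))) * ((1 + ‖θ‖) / (π θ * jointDensity f m ω θ)
          * ((1 + ‖η‖) * (π η * jointDensity f m ω η))) := by
    intro n hn hmn η hη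
    have hη2 : δ ≤ ‖η - θ‖ := by
      have := hη.2
      rw [Metric.mem_closedBall, dist_eq_norm, not_le] at this
      exact this.le
    obtain ⟨k, rfl⟩ := Nat.exists_eq_add_of_le hmn
    have h1 := hsep _ hn hmn η hη.1 hη2
    rw [Nat.add_sub_cancel_left] at h1 ⊢
    have h2 : Real.exp (logLik f (m + k) ω η - logLik f (m + k) ω θ)
        ≤ jointDensity f m ω η / jointDensity f m ω θ * Real.exp (-(ε * (k : ℝ))) := by
      rw [hm.logLik_add m k ω hη.1, hm.logLik_add m k ω hθΘ, ← hm.exp_logLik_sub m ω hη.1 hθΘ,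
        ← Real.exp_add]
      refine Real.exp_le_exp.2 ?_
      linarith
    have h3 : 1 + ‖η - θ‖ ≤ (1 + ‖θ‖) * (1 + ‖η‖) := by
      nlinarith [norm_sub_le η θ, norm_nonneg η, norm_nonneg θ,
        mul_nonneg (norm_nonneg η) (norm_nonneg θ)]
    have h4 := hp.nonneg η hη.1
    have h5 := hm.jointDensity_pos m ω hη.1
    have h6 := hm.jointDensity_pos m ω hθΘ
    calc (1 + ‖η - θ‖) * (π η / π θ * Real.exp (logLik f (m + k) ω η - logLik f (m + k) ω θ))
        ≤ ((1 + ‖θ‖) * (1 + ‖η‖)) * (π η / π θ *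
          (jointDensity f m ω η / jointDensity f m ω θ * Real.exp (-(ε * (k : ℝ))))) := by
          gcongr
      _ = _ := by field_simp
  have hdm : MeasurableSet (Θ \ Metric.closedBall θ δ) :=
    hΘ.diff Metric.isClosed_closedBall.measurableSet
  have hdom : ∀ n ∈ S, m ≤ n → ∀ᵐ η ∂(volume.restrict (Θ \ Metric.closedBall θ δ)),
      ‖(1 + ‖η - θ‖) * (π η / π θ * Real.exp (logLik f n ω η - logLik f n ω θ))‖
        ≤ Real.exp (-(ε * ((n - m : ℕ) : ℝ))) * ((1 + ‖θ‖) / (π θ * jointDensity f m ω θ)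
          * ((1 + ‖η‖) * (π η * jointDensity f m ω η))) := by
    intro n hn hmn
    filter_upwards [ae_restrict_mem hdm] with η hη
    rw [Real.norm_of_nonneg]
    · exact hfar n hn hmn η hη
    · have := hp.nonneg η hη.1
      positivity
  have hint' : IntegrableOn (fun η => (1 + ‖θ‖) / (π θ * jointDensity f m ω θ)
      * ((1 + ‖η‖) * (π η * jointDensity f m ω η))) (Θ \ Metric.closedBall θ δ) :=
    (hint.mono_set Set.sdiff_subset).const_mul _
  have hmL : ∀ n, Measurable fun η => logLik f n ω η - logLik f n ω θ := fun n =>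
    (hm.measurable_logLik n ω).sub_const _
  have hmρ : Measurable fun η => π η / π θ := hp.measurable.div_const _
  have heS : ∀ᶠ n in atTop ⊓ 𝓟 S, n ∈ S := eventually_inf_principal.2 (Eventually.of_forall
    fun _ h => h)
  have hle : ∀ {q : ℕ → Prop}, (∀ᶠ n in atTop, q n) → ∀ᶠ n in atTop ⊓ 𝓟 S, q n :=
    fun h => h.filter_mono inf_le_left
  refine ⟨hm.fisher_posDef hθ, hc, hcoer, hδ, by positivity, by positivity, hsmall, hΘ,
    hball.trans interior_subset, hmρ, hmL, fun η hη => div_nonneg (hp.nonneg η hη) hpos.le, hlip,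
    hr, fun t => (hp.tendsto_slope hθ t).mono_left inf_le_left, heS.mono fun n hn => (hS n hn).1,
    heS.mono fun n hn => (hS n hn).2, ?_, fun u v w => hm.K_comm_left u v w hθ,
    fun u v w => hm.K_comm_right u v w hθ, ?_, ?_, ?_, ?_⟩
  · intro n u v
    rw [normHess, normHess, fisher_comm u v, pd_comm isOpen_interior
      ((hm.contDiffOn_logLik n ω).of_le (by norm_num)) hθ]
  · filter_upwards [heS, hle hthird_one, hle (eventually_ne_atTop 0)] with n hn h1 hn0 t ht
    obtain ⟨ξ, hξ, e⟩ := hm.logLik_taylor hball ω hn0 ht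
    rw [e]
    have hs : 0 < Real.sqrt n := Real.sqrt_pos.2 (by exact_mod_cast Nat.pos_of_ne_zero hn0)
    have hmem : θ + ξ • (Real.sqrt n)⁻¹ • t ∈ Metric.closedBall θ δ := by
      rw [Metric.mem_closedBall, dist_eq_norm, add_sub_cancel_left, norm_smul,
        Real.norm_of_nonneg hξ.1.le]
      have : ‖(Real.sqrt n)⁻¹ • t‖ ≤ δ := by
        rw [norm_smul, Real.norm_of_nonneg (inv_pos.2 hs).le, inv_mul_le_iff₀ hs, mul_comm]
        exact ht
      calc ξ * ‖(Real.sqrt n)⁻¹ • t‖ ≤ 1 * δ :=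
            mul_le_mul hξ.2.le this (norm_nonneg _) zero_le_one
        _ = δ := one_mul δ
    have hT : ∀ u v w, |(n : ℝ)⁻¹ * pd u (pd v (pd w (logLik f n ω)))
        (θ + ξ • (Real.sqrt n)⁻¹ • t)| ≤ MK + 1 := by
      intro u v w
      have h2 := h1 _ hmem u v w
      have h3 := abs_add_le ((n : ℝ)⁻¹ * pd u (pd v (pd w (logLik f n ω)))
        (θ + ξ • (Real.sqrt n)⁻¹ • t) - K μ f θ u v w) (K μ f θ u v w)
      rw [sub_add_cancel] at h3
      linarith [hMK u v w]
    have b2 := abs_quadratic_le (hS n hn).2 t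
    have b3 := abs_cubic_le hT t
    simp only [cubicPoly, Pi.zero_apply, zero_mul, Finset.sum_const_zero, zero_add]
    refine (abs_add_le _ _).trans ?_
    rw [abs_mul, abs_mul, abs_of_nonneg (by norm_num : (0 : ℝ) ≤ 1 / 2),
      abs_of_nonneg (by norm_num : (0 : ℝ) ≤ 1 / 6)]
    have e2 : (p : ℝ) ^ 2 * M₀ / 2 * ‖t‖ ^ 2 = 1 / 2 * (p ^ 2 * (M₀ * ‖t‖ ^ 2)) := by ring
    have e3 : (p : ℝ) ^ 3 * (MK + 1) / 6 * ‖t‖ ^ 3 = 1 / 6 * (p ^ 3 * ((MK + 1) * ‖t‖ ^ 3)) := by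
      ring
    rw [e2, e3]
    exact add_le_add (mul_le_mul_of_nonneg_left b2 (by norm_num))
      (mul_le_mul_of_nonneg_left b3 (by norm_num))
  · intro t
    rw [Metric.tendsto_nhds]
    intro e he
    -- The cubic form is then at most `e`, and its factor `1/6` makes the final inequality strict.
    -- The `1` in the denominator covers `t = 0`.
    set κ : ℝ := e / (p ^ 3 * ‖t‖ ^ 3 + 1) with hκ
    have hden : 0 < (p : ℝ) ^ 3 * ‖t‖ ^ 3 + 1 := by positivity
    have hκ0 : 0 < κ := by positivity
    obtain ⟨s, hs, hev⟩ := hthird κ hκ0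
    have hbig : ∀ᶠ n : ℕ in atTop, ‖t‖ / min δ s < Real.sqrt n :=
      (Real.tendsto_sqrt_atTop.comp tendsto_natCast_atTop_atTop).eventually_gt_atTop _
    refine hle ?_
    filter_upwards [hev, hbig, eventually_ne_atTop 0] with n hn hn1 hn0
    have hms : 0 < min δ s := lt_min hδ hs
    rw [div_lt_iff₀ hms, mul_comm] at hn1
    have hs0 : 0 < Real.sqrt n := Real.sqrt_pos.2 (by exact_mod_cast Nat.pos_of_ne_zero hn0)
    have ht : ‖t‖ ≤ δ * Real.sqrt n :=
      hn1.le.trans (mul_le_mul_of_nonneg_right (min_le_left _ _) hs0.le)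
    obtain ⟨ξ, hξ, e1⟩ := hm.logLik_taylor hball ω hn0 ht
    rw [e1, cubicPoly_sub_cubicPoly, dist_zero_right, Real.norm_eq_abs, abs_mul,
      abs_of_nonneg (by norm_num : (0 : ℝ) ≤ 1 / 6)]
    have hmem : θ + ξ • (Real.sqrt n)⁻¹ • t ∈ Metric.ball θ s := by
      rw [Metric.mem_ball, dist_eq_norm, add_sub_cancel_left, norm_smul,
        Real.norm_of_nonneg hξ.1.le]
      have h1 : ‖(Real.sqrt n)⁻¹ • t‖ < s := by
        rw [norm_smul, Real.norm_of_nonneg (inv_pos.2 hs0).le, inv_mul_lt_iff₀ hs0, mul_comm]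
        exact hn1.trans_le (mul_le_mul_of_nonneg_right (min_le_right _ _) hs0.le)
      exact (mul_le_of_le_one_left (norm_nonneg _) hξ.2.le).trans_lt h1
    have b := abs_cubic_le (hn _ hmem) t
    have h2 : (p : ℝ) ^ 3 * (κ * ‖t‖ ^ 3) ≤ e := by
      have : (p : ℝ) ^ 3 * (κ * ‖t‖ ^ 3) = e * (p ^ 3 * ‖t‖ ^ 3 / (p ^ 3 * ‖t‖ ^ 3 + 1)) := by
        rw [hκ]; field_simp
      rw [this]
      exact mul_le_of_le_one_right he.le ((div_le_one hden).2 (by linarith))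
    linarith
  · filter_upwards [heS, hle (eventually_ge_atTop m)] with n hn hmn
    refine (hint'.const_mul (Real.exp (-(ε * ((n - m : ℕ) : ℝ))))).mono' ?_ (hdom n hn hmn)
    exact (by fun_prop : Measurable fun η : Fin p → ℝ => 1 + ‖η - θ‖).mul
      (hmρ.mul (hmL n).exp) |>.aestronglyMeasurable
  · set I : ℝ := ∫ η in Θ \ Metric.closedBall θ δ, (1 + ‖θ‖) / (π θ * jointDensity f m ω θ)
      * ((1 + ‖η‖) * (π η * jointDensity f m ω η))
    have hlim : Tendsto (fun n : ℕ => (n : ℝ) ^ (((p + 2 : ℕ) : ℝ) / 2) * Real.exp (-ε * n)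
        * (Real.exp (ε * m) * I)) atTop (𝓝 0) := by
      have := ((tendsto_rpow_mul_exp_neg_mul_atTop_nhds_zero (((p + 2 : ℕ) : ℝ) / 2) ε hε).comp
        tendsto_natCast_atTop_atTop).mul_const (Real.exp (ε * m) * I)
      simpa [Function.comp_def] using this
    refine squeeze_zero_norm' ?_ (hlim.mono_left inf_le_left)
    filter_upwards [heS, hle (eventually_ge_atTop m)] with n hn hmn
    have h1 := norm_integral_le_of_norm_le
      (hint'.const_mul (Real.exp (-(ε * ((n - m : ℕ) : ℝ))))) (hdom n hn hmn)
    rw [integral_const_mul] at h1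
    rw [norm_mul, Real.norm_of_nonneg (by positivity)]
    refine (mul_le_mul_of_nonneg_left h1 (by positivity)).trans (le_of_eq ?_)
    have e1 : Real.sqrt n ^ (p + 2) = (n : ℝ) ^ (((p + 2 : ℕ) : ℝ) / 2) := by
      rw [Real.sqrt_eq_rpow, ← Real.rpow_natCast, ← Real.rpow_mul n.cast_nonneg]
      congr 1; ring
    have e2 : Real.exp (-(ε * ((n - m : ℕ) : ℝ))) = Real.exp (-ε * n) * Real.exp (ε * m) := by
      rw [← Real.exp_add, Nat.cast_sub hmn]
      congr 1; ring
    rw [e1, e2]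
    ring

/-! ### The remainder along a sample path -/

/-- The algebra behind the stochastic expansion. -/
lemma cubicMean_add_score {J : Matrix (Fin p) (Fin p) ℝ} (hJ : IsUnit J.det)
    (a S : Fin p → ℝ) (H : Fin p → Fin p → ℝ) {T : Fin p → Fin p → Fin p → ℝ}
    (h12 : ∀ r s t, T r s t = T s r t) (h23 : ∀ r s t, T r s t = T r t s) {n : ℕ} (hn : n ≠ 0)
    (v : Fin p) :
    S v + cubicMean a (fun u w => Real.sqrt n * ((n : ℝ)⁻¹ * H u w + J u w)) T J⁻¹
        (J⁻¹.mulVec fun u => (Real.sqrt n)⁻¹ * S u) v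
      = a v + 2 * S v + (1 / 2) * ∑ r, ∑ s, J⁻¹ r s * (T v r s
        + 2 * ((n : ℝ)⁻¹ * (H v r * S s))
        + ∑ t, ∑ u, J⁻¹ t u * ((n : ℝ)⁻¹ * (S s * S u)) * T r t v) := by
  have hs : 0 < Real.sqrt n := Real.sqrt_pos.2 (by exact_mod_cast Nat.pos_of_ne_zero hn)
  have hs2 : (n : ℝ)⁻¹ = (Real.sqrt n)⁻¹ * (Real.sqrt n)⁻¹ := by
    rw [← mul_inv, Real.mul_self_sqrt n.cast_nonneg]
  set σ : ℝ := Real.sqrt n with hσ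
  set w : Fin p → ℝ := J⁻¹.mulVec S with hw
  have hy : (J⁻¹.mulVec fun u => σ⁻¹ * S u) = fun u => σ⁻¹ * w u := by
    have : (fun u => σ⁻¹ * S u) = σ⁻¹ • S := rfl
    rw [this, Matrix.mulVec_smul]
    rfl
  have hJw : ∀ u, ∑ s, J u s * w s = S u := by
    intro u
    have : J.mulVec w = S := by
      rw [hw, Matrix.mulVec_mulVec, Matrix.mul_nonsing_inv _ hJ, Matrix.one_mulVec]
    exact congrFun this u
  have hws : ∀ r, ∑ s, J⁻¹ r s * S s = w r := fun r => rfl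
  -- Since `J w = S`, the `J` part of the normalized Hessian reproduces the score. Together with the
  -- leading term this is the origin of `2 ℓ_n` in the expansion.
  have e1 : ∑ s, σ * ((n : ℝ)⁻¹ * H v s + J v s) * (σ⁻¹ * w s)
      = (n : ℝ)⁻¹ * (∑ s, H v s * w s) + S v := by
    rw [← hJw v, Finset.mul_sum, ← Finset.sum_add_distrib]
    refine Finset.sum_congr rfl fun s _ => ?_
    field_simp
  have e2 : ∑ r, ∑ s, J⁻¹ r s * (T v r s + 2 * ((n : ℝ)⁻¹ * (H v r * S s))
        + ∑ t, ∑ u, J⁻¹ t u * ((n : ℝ)⁻¹ * (S s * S u)) * T r t v)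
      = (∑ r, ∑ s, T v r s * J⁻¹ r s) + 2 * ((n : ℝ)⁻¹ * ∑ r, H v r * w r)
        + ∑ r, ∑ t, T v r t * ((n : ℝ)⁻¹ * (w r * w t)) := by
    simp only [mul_add, Finset.sum_add_distrib]
    congr 1
    · congr 1
      · exact Finset.sum_congr rfl fun r _ => Finset.sum_congr rfl fun s _ => mul_comm _ _
      · rw [Finset.mul_sum, Finset.mul_sum]
        refine Finset.sum_congr rfl fun r _ => ?_
        rw [← hws r, Finset.mul_sum, Finset.mul_sum, Finset.mul_sum]
        exact Finset.sum_congr rfl fun s _ => by ring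
    · refine Finset.sum_congr rfl fun r _ => ?_
      simp only [Finset.mul_sum]
      rw [Finset.sum_comm]
      refine Finset.sum_congr rfl fun t _ => ?_
      rw [← hws r, ← hws t, Finset.sum_mul_sum, Finset.mul_sum, Finset.mul_sum]
      refine Finset.sum_congr rfl fun s _ => ?_
      rw [Finset.mul_sum, Finset.mul_sum]
      refine Finset.sum_congr rfl fun u _ => ?_
      rw [h23 r t v, h12 r v t]
      ring
  rw [e2, cubicMean, hy, e1]
  have e3 : ∑ b, ∑ c, T v b c * (σ⁻¹ * w b * (σ⁻¹ * w c) + J⁻¹ b c)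
      = (∑ r, ∑ s, T v r s * J⁻¹ r s) + ∑ r, ∑ t, T v r t * ((n : ℝ)⁻¹ * (w r * w t)) := by
    rw [hs2]
    simp only [← Finset.sum_add_distrib]
    exact Finset.sum_congr rfl fun r _ => Finset.sum_congr rfl fun s _ => by ring
  rw [e3]
  ring

/-- Dividing the weight by its value at `θ` cancels in the ratio. Integrability of every coordinate
is required even for a single `v`, because the vector-valued integral is evaluated coordinatewise.
-/
lemma RegularModel.bayes_apply (hm : RegularModel μ f Θ) (hp : RegularPrior μ f Θ π)
    (hΘ : MeasurableSet Θ) {θ : Fin p → ℝ} (hθ : θ ∈ interior Θ) (n : ℕ) (ω : ℕ → 𝒳)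
    (hint : ∀ v, IntegrableOn
      (fun η => π η / π θ * Real.exp (logLik f n ω η - logLik f n ω θ) * η v) Θ) (v : Fin p) :
    bayes f Θ π n ω v =
      (∫ η in Θ, π η / π θ * Real.exp (logLik f n ω η - logLik f n ω θ))⁻¹ *
        ∫ η in Θ, π η / π θ * Real.exp (logLik f n ω η - logLik f n ω θ) * η v := by
  have hpos := hp.pos θ hθ
  have hj := hm.jointDensity_pos n ω (interior_subset hθ)
  set k : ℝ := π θ * jointDensity f n ω θ with hk
  have hk0 : 0 < k := mul_pos hpos hj
  have e : ∀ η ∈ Θ, π η * jointDensity f n ω η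
      = k * (π η / π θ * Real.exp (logLik f n ω η - logLik f n ω θ)) := by
    intro η hη
    rw [hm.exp_logLik_sub n ω hη (interior_subset hθ), hk]
    field_simp
  have e0 : ∫ η in Θ, π η * jointDensity f n ω η
      = k * ∫ η in Θ, π η / π θ * Real.exp (logLik f n ω η - logLik f n ω θ) := by
    rw [← integral_const_mul]
    exact setIntegral_congr_fun hΘ e
  have e1 : ∀ v, ∀ η ∈ Θ, ((π η * jointDensity f n ω η) • η) v
      = k * (π η / π θ * Real.exp (logLik f n ω η - logLik f n ω θ) * η v) := by
    intro v η hη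
    rw [Pi.smul_apply, smul_eq_mul, e η hη]
    ring
  have hi : ∀ v, Integrable (fun η => ((π η * jointDensity f n ω η) • η) v)
      (volume.restrict Θ) := by
    intro v
    refine ((hint v).const_mul k).congr ?_
    filter_upwards [ae_restrict_mem hΘ] with η hη
    exact (e1 v η hη).symm
  rw [bayes, Pi.smul_apply, eval_integral hi, smul_eq_mul, e0, setIntegral_congr_fun hΘ (e1 v),
    integral_const_mul]
  field_simp

/-- With `r = √n`, the quantity in `tendsto_mean` equals `n` times the remainder identically, not
just asymptotically, thanks to `cubicMean_add_score`. -/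
lemma RegularModel.tendsto_remainder (hm : RegularModel μ f Θ) (hp : RegularPrior μ f Θ π)
    (hΘ : MeasurableSet Θ) {θ : Fin p → ℝ} (hθ : θ ∈ interior Θ) {c δ M₀ M₁ M₂ : ℝ}
    {ω : ℕ → 𝒳} {S : Set ℕ}
    (h : LaplaceSetting (atTop ⊓ 𝓟 S) (fisher μ f θ) (K μ f θ) (gradLogPrior π θ) Θ θ
      (fun η => π η / π θ) (fun n : ℕ => Real.sqrt n)
      (fun n η => logLik f n ω η - logLik f n ω θ) (normScore f θ ω) (normHess μ f θ ω) c δ M₀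
      M₁ M₂) :
    Tendsto (fun n : ℕ => (n : ℝ) • remainder μ f Θ π θ n ω) (atTop ⊓ 𝓟 S) (𝓝 0) := by
  rw [tendsto_pi_nhds]
  intro v
  have hint := eventually_all.2 fun v => (h.tendsto_mean v).1
  refine (h.tendsto_mean v).2.congr' ?_
  filter_upwards [hint, (eventually_ne_atTop 0).filter_mono inf_le_left] with n hn hn0
  have hs2 : Real.sqrt n ^ 2 = n := Real.sq_sqrt n.cast_nonneg
  have hs : 0 < Real.sqrt n := Real.sqrt_pos.2 (by exact_mod_cast Nat.pos_of_ne_zero hn0)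
  have hn' : (n : ℝ) ≠ 0 := Nat.cast_ne_zero.2 hn0
  have hJ : IsUnit (fisher μ f θ).det := hm.fisher_nonsing θ hθ
  rw [← hm.bayes_apply hp hΘ hθ n ω hn v, hs2]
  have hvec : (fun v => gradLogPrior π θ v + 2 * pd v (logLik f n ω) θ
          + (1 / 2) * ∑ r, ∑ s, (fisher μ f θ)⁻¹ r s * An μ f θ n ω r s v)
      = (fun v => pd v (logLik f n ω) θ) + cubicMean (gradLogPrior π θ) (normHess μ f θ ω n)
        (K μ f θ) (fisher μ f θ)⁻¹ ((fisher μ f θ)⁻¹.mulVec (normScore f θ ω n)) := by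
    ext u
    have := cubicMean_add_score hJ (gradLogPrior π θ) (fun v => pd v (logLik f n ω) θ)
      (fun u v => pd u (pd v (logLik f n ω)) θ) (T := K μ f θ)
      (fun u v w => hm.K_comm_left u v w hθ) (fun u v w => hm.K_comm_right u v w hθ) hn0 u
    exact this.symm
  have hz : Real.sqrt n * (fisher μ f θ)⁻¹.mulVec (normScore f θ ω n) v
      = (fisher μ f θ)⁻¹.mulVec (fun v => pd v (logLik f n ω) θ) v := by
    have : (fun v => pd v (logLik f n ω) θ) = Real.sqrt n • normScore f θ ω n := by
      ext u
      simp [normScore, mul_inv_cancel_left₀ hs.ne']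
    rw [this, Matrix.mulVec_smul]
    rfl
  rw [hz, remainder, hvec, Matrix.mulVec_add]
  simp only [Pi.smul_apply, Pi.sub_apply, Pi.add_apply, smul_eq_mul]
  field_simp
  ring

end Path

/-! ### Convergence in probability -/

/-- A union bound that divides `ε` among the finitely many families. -/
lemma tight_normalized_sums {ι 𝒳 : Type*} [Finite ι] [MeasurableSpace 𝒳] {ν : Measure 𝒳}
    [IsProbabilityMeasure ν] {a : ι → 𝒳 → ℝ} (ha : ∀ i, Measurable (a i))
    (ha2 : ∀ i, MemLp (a i) 2 ν) (ha0 : ∀ i, ∫ x, a i x ∂ν = 0) {ε : ENNReal} (hε : 0 < ε) :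
    ∃ M : ℝ, 0 < M ∧ ∀ n : ℕ, (Measure.infinitePi fun _ : ℕ => ν)
      {ω | ∃ i, M < |(Real.sqrt n)⁻¹ * ∑ j ∈ Finset.range n, a i (ω j)|} ≤ ε := by
  have := Fintype.ofFinite ι
  obtain ⟨ε', hε', hsum⟩ := ENNReal.exists_pos_sum_of_countable' hε.ne' ι
  choose M hM hMn using fun i => tight_normalized_sum (ha i) (ha2 i) (ha0 i) (hε' i)
  refine ⟨1 + ∑ i, M i, add_pos_of_pos_of_nonneg one_pos
    (Finset.sum_nonneg fun i _ => (hM i).le), fun n => ?_⟩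
  have hsub : {ω : ℕ → 𝒳 | ∃ i, 1 + ∑ i, M i < |(Real.sqrt n)⁻¹ *
      ∑ j ∈ Finset.range n, a i (ω j)|} ⊆ ⋃ i, {ω : ℕ → 𝒳 | M i < |(Real.sqrt n)⁻¹ *
      ∑ j ∈ Finset.range n, a i (ω j)|} := by
    rintro ω ⟨i, hi⟩
    refine Set.mem_iUnion.2 ⟨i, lt_of_le_of_lt ?_ hi⟩
    have := Finset.single_le_sum (f := M) (fun i _ => (hM i).le) (Finset.mem_univ i)
    linarith
  calc _ ≤ _ := measure_mono hsub
    _ ≤ ∑' i, _ := measure_iUnion_le _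
    _ ≤ ∑' i, ε' i := ENNReal.tsum_le_tsum fun i => hMn i n
    _ ≤ ε := hsum.le

/-- Variables that converge almost surely along measurable events of probability close to one
converge in probability. -/
lemma tendstoInMeasure_zero_of_ae_on {Ω E : Type*} [MeasurableSpace Ω] {P : Measure Ω}
    [IsFiniteMeasure P] [NormedAddCommGroup E] {X : ℕ → Ω → E}
    (hX : ∀ n, AEStronglyMeasurable (X n) P)
    (h : ∀ τ : ENNReal, 0 < τ → ∃ G : ℕ → Set Ω, (∀ n, MeasurableSet (G n)) ∧
      (∀ᶠ n in atTop, P (G n)ᶜ ≤ τ) ∧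
      ∀ᵐ ω ∂P, Tendsto (fun n => X n ω) (atTop ⊓ 𝓟 {n | ω ∈ G n}) (𝓝 0)) :
    TendstoInMeasure P X atTop fun _ => 0 := by
  intro e he
  rw [ENNReal.tendsto_nhds_zero]
  intro τ hτ
  obtain ⟨G, hG, hGτ, hlim⟩ := h (τ / 2) (ENNReal.half_pos hτ.ne')
  -- Cutting off by the indicator of `G n` turns convergence along the indices with `ω ∈ G n` into
  -- convergence along all `n`; almost sure convergence then implies convergence in measure.
  have hind : TendstoInMeasure P (fun n => (G n).indicator (X n)) atTop fun _ => 0 := by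
    refine tendstoInMeasure_of_tendsto_ae (fun n => (hX n).indicator (hG n)) ?_
    filter_upwards [hlim] with ω hω
    refine tendsto_def.2 fun U hU => ?_
    have h1 := eventually_inf_principal.1 (hω.eventually (eventually_mem_set.2 hU))
    filter_upwards [h1] with n hn
    by_cases hmem : ω ∈ G n
    · simpa [hmem] using hn hmem
    · simpa [hmem] using mem_of_mem_nhds hU
  have h2 := (ENNReal.tendsto_nhds_zero.1 (hind e he)) (τ / 2) (ENNReal.half_pos hτ.ne')
  filter_upwards [h2, hGτ] with n hn1 hn2
  have hsub : {ω | e ≤ edist (X n ω) 0} ⊆ {ω | e ≤ edist ((G n).indicator (X n) ω) 0} ∪ (G n)ᶜ := by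
    intro ω hω
    by_cases hmem : ω ∈ G n
    · left
      simpa [hmem] using hω
    · exact Or.inr hmem
  calc _ ≤ _ := measure_mono hsub
    _ ≤ _ := measure_union_le _ _
    _ ≤ τ / 2 + τ / 2 := add_le_add hn1 hn2
    _ = τ := ENNReal.add_halves τ

section Probability

variable {p : ℕ} {𝒳 : Type*} [MeasurableSpace 𝒳] {μ : Measure 𝒳}
  {f : (Fin p → ℝ) → 𝒳 → ℝ} {Θ : Set (Fin p → ℝ)} {π : (Fin p → ℝ) → ℝ}

lemma RegularModel.normScore_eq (hm : RegularModel μ f Θ) {θ : Fin p → ℝ}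
    (hθ : θ ∈ interior Θ) (ω : ℕ → 𝒳) (n : ℕ) (v : Fin p) :
    normScore f θ ω n v
      = (Real.sqrt n)⁻¹ * ∑ i ∈ Finset.range n, pd v (logDensity f (ω i)) θ := by
  rw [normScore, hm.pd_logLik n ω v hθ]

/-- This exhibits the normalized Hessian as a normalized sum, whose summands are centred by the
information identity, so it is tight like the score. -/
lemma RegularModel.normHess_eq (hm : RegularModel μ f Θ) {θ : Fin p → ℝ}
    (hθ : θ ∈ interior Θ) (ω : ℕ → 𝒳) (n : ℕ) (u v : Fin p) :
    normHess μ f θ ω n u v = (Real.sqrt n)⁻¹ *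
      ∑ i ∈ Finset.range n, (pd u (pd v (logDensity f (ω i))) θ + fisher μ f θ u v) := by
  rw [normHess, hm.pd_pd_logLik n ω u v hθ, Finset.sum_add_distrib, Finset.sum_const,
    Finset.card_range, nsmul_eq_mul]
  rcases Nat.eq_zero_or_pos n with rfl | hn
  · simp
  have hs : 0 < Real.sqrt n := Real.sqrt_pos.2 (by exact_mod_cast hn)
  have hs2 : (n : ℝ) = Real.sqrt n * Real.sqrt n := (Real.mul_self_sqrt n.cast_nonneg).symm
  set σ := Real.sqrt n
  rw [hs2]
  field_simp

lemma RegularModel.tight_normScore_normHess (hm : RegularModel μ f Θ) {θ : Fin p → ℝ}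
    (hθ : θ ∈ interior Θ) {ε : ENNReal} (hε : 0 < ε) :
    ∃ M : ℝ, 0 < M ∧ ∀ n : ℕ, sampleLaw μ f θ
      {ω | ‖normScore f θ ω n‖ ≤ M ∧ ∀ u v, |normHess μ f θ ω n u v| ≤ M}ᶜ ≤ ε := by
  have := hm.isProbabilityMeasure_law (interior_subset hθ)
  obtain ⟨M, hM, h⟩ := tight_normalized_sums (ν := law μ f θ)
    (a := fun i : Fin p ⊕ (Fin p × Fin p) => i.elim (fun v x => pd v (logDensity f x) θ)
      (fun w x => pd w.1 (pd w.2 (logDensity f x)) θ + fisher μ f θ w.1 w.2))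
    (by
      rintro (v | ⟨u, v⟩)
      · exact hm.measurable_score v hθ
      · exact (hm.measurable_hess u v hθ).add_const _)
    (by
      rintro (v | ⟨u, v⟩)
      · exact hm.score_sq θ hθ v
      · exact (hm.hess_sq θ hθ u v).add (memLp_const _))
    (by
      rintro (v | ⟨u, v⟩)
      · exact hm.integral_score v hθ
      · simp only [Sum.elim_inr]
        rw [integral_add (hm.integrable_hess u v hθ) (integrable_const _), integral_const,
          hm.fisher_eq_neg_integral_hess u v hθ]
        simp) hε
  refine ⟨M, hM, fun n => (measure_mono ?_).trans (h n)⟩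
  intro ω hω
  by_contra hcon
  simp only [Set.mem_ofPred_eq, not_exists, not_lt] at hcon
  refine hω ⟨(pi_norm_le_iff_of_nonneg hM.le).2 fun v => ?_, fun u v => ?_⟩
  · rw [hm.normScore_eq hθ]
    exact hcon (Sum.inl v)
  · rw [hm.normHess_eq hθ]
    exact hcon (Sum.inr (u, v))

lemma RegularModel.measurableSet_normScore_normHess (hm : RegularModel μ f Θ) {θ : Fin p → ℝ}
    (hθ : θ ∈ interior Θ) (M : ℝ) (n : ℕ) : MeasurableSet
      {ω | ‖normScore f θ ω n‖ ≤ M ∧ ∀ u v, |normHess μ f θ ω n u v| ≤ M} := by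
  have h1 := fun v => hm.measurable_pd_logLik n v hθ
  have h2 := fun u v => hm.measurable_pd_pd_logLik n u v hθ
  have h3 : Measurable fun ω => normScore f θ ω n :=
    measurable_pi_lambda _ fun v => (h1 v).const_mul _
  have h4 : ∀ u v, Measurable fun ω => normHess μ f θ ω n u v := fun u v =>
    (((h2 u v).const_mul _).add_const _).const_mul _
  refine (measurableSet_le h3.norm measurable_const).inter ?_
  refine MeasurableSet.congr (MeasurableSet.iInter fun u => MeasurableSet.iInter fun v =>
    measurableSet_le (h4 u v).abs (measurable_const (a := M))) ?_
  ext ω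
  simp only [Set.mem_iInter]
  exact Iff.rfl

/-- The averaged third derivatives of the log-likelihood are uniformly close to their
expectations near the true value. -/
lemma RegularModel.eventually_third_near (hm : RegularModel μ f Θ) {θ : Fin p → ℝ}
    (hθ : θ ∈ interior Θ) {κ : ℝ} (hκ : 0 < κ) :
    ∀ᶠ s in 𝓝[>] (0 : ℝ), ∀ᵐ ω ∂(sampleLaw μ f θ), ∀ᶠ n : ℕ in atTop,
      ∀ η ∈ Metric.closedBall θ s, ∀ u v w,
        |(n : ℝ)⁻¹ * pd u (pd v (pd w (logLik f n ω))) η - K μ f θ u v w| ≤ κ := by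
  have := hm.isProbabilityMeasure_law (interior_subset hθ)
  have hball : ∀ᶠ s in 𝓝[>] (0 : ℝ), Metric.closedBall θ s ⊆ interior Θ := by
    obtain ⟨s₀, hs₀, h⟩ := Metric.nhds_basis_closedBall.mem_iff.1 (isOpen_interior.mem_nhds hθ)
    filter_upwards [Ioo_mem_nhdsGT hs₀] with s hs
    exact (Metric.closedBall_subset_closedBall hs.2.le).trans h
  have hone : ∀ u v w, ∀ᶠ s in 𝓝[>] (0 : ℝ), ∀ᵐ ω ∂(sampleLaw μ f θ), ∀ᶠ n : ℕ in atTop,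
      ∀ η ∈ Metric.closedBall θ s, |(n : ℝ)⁻¹ * ∑ i ∈ Finset.range n,
        pd u (pd v (pd w (logDensity f (ω i)))) η - K μ f θ u v w| ≤ κ := by
    intro u v w
    obtain ⟨ρ, hρ, h⟩ := uniform_strong_law_near isOpen_interior hθ
      (fun η hη => hm.measurable_third u v w hη) (fun x => (hm.smooth_three x u v w).continuousOn)
      (hm.dom_third θ hθ u v w) hκ
    filter_upwards [Ioo_mem_nhdsGT hρ] with s hs
    filter_upwards [h] with ω hω
    filter_upwards [hω] with n hn η hη
    exact hn η (Metric.closedBall_subset_ball hs.2 hη)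
  have hall := eventually_all.2 fun u => eventually_all.2 fun v => eventually_all.2 (hone u v)
  filter_upwards [hball, hall] with s hs h
  have h' := ae_all_iff.2 fun u => ae_all_iff.2 fun v => ae_all_iff.2 (h u v)
  filter_upwards [h'] with ω hω
  have hω' := eventually_all.2 fun u => eventually_all.2 fun v => eventually_all.2 (hω u v)
  filter_upwards [hω'] with n hn η hη u v w
  rw [hm.pd_pd_pd_logLik n ω u v w (hs hη)]
  exact hn u v w η hη

/-- Restricting to `κ = 1/(k+1)` leaves countably many null sets, which brings the quantifier over
`κ` inside the almost sure statement. -/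
lemma RegularModel.ae_third_near (hm : RegularModel μ f Θ) {θ : Fin p → ℝ}
    (hθ : θ ∈ interior Θ) :
    ∀ᵐ ω ∂(sampleLaw μ f θ), ∀ κ > 0, ∃ s > 0, ∀ᶠ n : ℕ in atTop,
      ∀ η ∈ Metric.ball θ s, ∀ u v w,
        |(n : ℝ)⁻¹ * pd u (pd v (pd w (logLik f n ω))) η - K μ f θ u v w| ≤ κ := by
  have h : ∀ k : ℕ, ∃ s > 0, ∀ᵐ ω ∂(sampleLaw μ f θ), ∀ᶠ n : ℕ in atTop,
      ∀ η ∈ Metric.closedBall θ s, ∀ u v w,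
        |(n : ℝ)⁻¹ * pd u (pd v (pd w (logLik f n ω))) η - K μ f θ u v w| ≤ 1 / ((k : ℝ) + 1) :=
    fun k => by
      obtain ⟨s, h1, h2⟩ := ((hm.eventually_third_near hθ (κ := 1 / ((k : ℝ) + 1))
        (by positivity)).and self_mem_nhdsWithin).exists
      exact ⟨s, h2, h1⟩
  choose s hs hae using h
  filter_upwards [ae_all_iff.2 hae] with ω hω κ hκ
  obtain ⟨k, hk⟩ := exists_nat_one_div_lt hκ
  refine ⟨s k, hs k, ?_⟩
  filter_upwards [hω k] with n hn η hη u v w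
  exact (hn η (Metric.ball_subset_closedBall hη) u v w).trans hk.le

/-- The remainder of the stochastic expansion of the posterior mean is `o_p(n⁻¹)`. -/
lemma RegularModel.tendstoInMeasure_remainder (hm : RegularModel μ f Θ)
    (hp : RegularPrior μ f Θ π) (hΘ : MeasurableSet Θ) {θ : Fin p → ℝ} (hθ : θ ∈ interior Θ) :
    TendstoInMeasure (sampleLaw μ f θ) (fun (n : ℕ) ω => (n : ℝ) • remainder μ f Θ π θ n ω)
      atTop (fun _ => 0) := by
  have := hm.isProbabilityMeasure_law (interior_subset hθ)
  have : IsProbabilityMeasure (sampleLaw μ f θ) := by unfold sampleLaw; infer_instance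
  obtain ⟨c, hc, hcoer⟩ := exists_pos_mul_norm_sq_le (hm.fisher_posDef hθ)
  obtain ⟨C, hC, δ₁, hδ₁, hlip⟩ := hp.exists_lip hθ
  obtain ⟨δ₂, hδ₂, hball⟩ := Metric.nhds_basis_closedBall.mem_iff.1
    (isOpen_interior.mem_nhds hθ)
  obtain ⟨MK, hMK0, hMK⟩ : ∃ MK, 0 ≤ MK ∧ ∀ u v w, |K μ f θ u v w| ≤ MK := by
    refine ⟨∑ u, ∑ v, ∑ w, |K μ f θ u v w|, by positivity, fun u v w => ?_⟩
    calc |K μ f θ u v w| ≤ ∑ w, |K μ f θ u v w| :=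
          Finset.single_le_sum (f := fun w => |K μ f θ u v w|) (fun _ _ => abs_nonneg _)
            (Finset.mem_univ w)
      _ ≤ ∑ v, ∑ w, |K μ f θ u v w| :=
          Finset.single_le_sum (f := fun v => ∑ w, |K μ f θ u v w|)
            (fun _ _ => by positivity) (Finset.mem_univ v)
      _ ≤ _ := Finset.single_le_sum (f := fun u => ∑ v, ∑ w, |K μ f θ u v w|)
            (fun _ _ => by positivity) (Finset.mem_univ u)
  -- The radius must respect the Lipschitz bound of the prior, the interior of `Θ`, the control of
  -- third derivatives and the smallness condition on the cubic error. Adding `1` avoids a zero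
  -- divisor in dimension zero.
  have hb0 : 0 < (p : ℝ) ^ 3 * (MK + 1) / 6 + 1 := by positivity
  obtain ⟨δ, hone, hδ, hδ'⟩ := ((hm.eventually_third_near hθ one_pos).and
    (Ioo_mem_nhdsGT (lt_min (lt_min hδ₁ hδ₂)
      (div_pos (by positivity : 0 < c / 8) hb0)))).exists
  have hδ1 : δ ≤ δ₁ := hδ'.le.trans ((min_le_left _ _).trans (min_le_left _ _))
  have hδ2 : δ ≤ δ₂ := hδ'.le.trans ((min_le_left _ _).trans (min_le_right _ _))
  have hsmall : (p : ℝ) ^ 3 * (MK + 1) / 6 * δ ≤ c / 8 := by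
    have h1 := (le_div_iff₀ hb0).1 (hδ'.le.trans (min_le_right _ _))
    linarith
  obtain ⟨ε, hε, hsep⟩ := hm.separated θ hθ δ hδ
  obtain ⟨m, hint⟩ := hp.proper θ hθ
  set B : ℕ → Set (ℕ → 𝒳) := fun n => {ω | ∃ θ' ∈ Θ, δ ≤ ‖θ' - θ‖ ∧
    -(ε * n) < logLik f n ω θ' - logLik f n ω θ}
  have hB : Tendsto (fun n => sampleLaw μ f θ (B n)) atTop (𝓝 0) := hsep
  -- The failure of separation is an uncountable union over parameters and may be non-measurable, so
  -- it is replaced by its measurable hull. The shift applies it to the observations after the first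
  -- `m`, at unchanged probability.
  set B' : ℕ → Set (ℕ → 𝒳) := fun n =>
    (fun (ω : ℕ → 𝒳) i => ω (i + m)) ⁻¹' toMeasurable (sampleLaw μ f θ) (B (n - m))
  have hshift : MeasurePreserving (fun (ω : ℕ → 𝒳) i => ω (i + m)) (sampleLaw μ f θ)
    (sampleLaw μ f θ) := measurePreserving_shift m
  have hB'm : ∀ n, MeasurableSet (B' n) := fun n =>
    hshift.measurable (measurableSet_toMeasurable _ _)
  have hB' : Tendsto (fun n => sampleLaw μ f θ (B' n)) atTop (𝓝 0) := by
    have e : ∀ n, sampleLaw μ f θ (B' n) = sampleLaw μ f θ (B (n - m)) := fun n => by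
      rw [hshift.measure_preimage (measurableSet_toMeasurable _ _).nullMeasurableSet,
        measure_toMeasurable]
    simp only [e]
    exact hB.comp (tendsto_sub_atTop_nat m)
  refine tendstoInMeasure_zero_of_ae_on (fun n => ((hm.measurable_remainder hp.measurable n
    hθ).fun_const_smul _).aestronglyMeasurable) fun τ hτ => ?_
  obtain ⟨M, hM, htight⟩ := hm.tight_normScore_normHess hθ (ENNReal.half_pos hτ.ne')
  refine ⟨fun n => {ω | ‖normScore f θ ω n‖ ≤ M ∧ ∀ u v, |normHess μ f θ ω n u v| ≤ M} ∩ (B' n)ᶜ,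
    fun n => (hm.measurableSet_normScore_normHess hθ M n).inter (hB'm n).compl, ?_, ?_⟩
  · filter_upwards [ENNReal.tendsto_nhds_zero.1 hB' _ (ENNReal.half_pos hτ.ne')] with n hn
    rw [Set.compl_inter, compl_compl]
    exact (measure_union_le _ _).trans ((add_le_add (htight n) hn).trans
      (ENNReal.add_halves τ).le)
  · filter_upwards [hone, hm.ae_third_near hθ, hint] with ω h1 h2 h3
    refine hm.tendsto_remainder hp hΘ hθ (hm.laplaceSetting hp hΘ hθ (M₀ := max M C) (m := m)
      hc hcoer hδ ((Metric.closedBall_subset_closedBall hδ2).trans hball) hMK hMK0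
      (hM.le.trans (le_max_left _ _)) hsmall (fun η hη => ?_) h1 h2 (fun n hn => ?_) h3 hε
      fun n hn hmn η hη hηδ => ?_)
    · exact (hlip η (Metric.closedBall_subset_closedBall hδ1 hη)).trans
        (mul_le_mul_of_nonneg_right (le_max_right _ _) (norm_nonneg _))
    · exact ⟨hn.1.1.trans (le_max_left _ _), fun u v => (hn.1.2 u v).trans (le_max_left _ _)⟩
    · by_contra hcon
      exact hn.2 (subset_toMeasurable _ _ ⟨η, hη, hηδ, not_le.1 hcon⟩)

end Probability

section Bias

variable {p : ℕ} {𝒳 : Type*} [MeasurableSpace 𝒳] {μ : Measure 𝒳}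
  {f : (Fin p → ℝ) → 𝒳 → ℝ} {Θ : Set (Fin p → ℝ)} {π : (Fin p → ℝ) → ℝ}

/-! ### Expectations of the terms of the stochastic expansion -/

lemma RegularModel.integrable_pd_logLik (hm : RegularModel μ f Θ) {θ : Fin p → ℝ}
    (hθ : θ ∈ interior Θ) (n : ℕ) (v : Fin p) :
    Integrable (fun ω => pd v (logLik f n ω) θ) (sampleLaw μ f θ) := by
  have := hm.isProbabilityMeasure_law (interior_subset hθ)
  simp only [hm.pd_logLik n _ v hθ]
  exact integrable_finsetSum _ fun i _ =>
    integrable_eval ((hm.score_sq θ hθ v).integrable one_le_two) i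

lemma RegularModel.integral_pd_logLik (hm : RegularModel μ f Θ) {θ : Fin p → ℝ}
    (hθ : θ ∈ interior Θ) (n : ℕ) (v : Fin p) :
    ∫ ω, pd v (logLik f n ω) θ ∂(sampleLaw μ f θ) = 0 := by
  have := hm.isProbabilityMeasure_law (interior_subset hθ)
  have hi := (hm.score_sq θ hθ v).integrable one_le_two
  simp only [hm.pd_logLik n _ v hθ]
  rw [sampleLaw, integral_finsetSum _ fun i _ => integrable_eval hi i]
  refine Finset.sum_eq_zero fun i _ => ?_
  rw [integral_eval (g := fun x => pd v (logDensity f x) θ) hi.aestronglyMeasurable,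
    hm.integral_score v hθ]

lemma RegularModel.integrable_In (hm : RegularModel μ f Θ) {θ : Fin p → ℝ}
    (hθ : θ ∈ interior Θ) (n : ℕ) (r s : Fin p) :
    Integrable (fun ω => In f θ n ω r s) (sampleLaw μ f θ) := by
  have := hm.isProbabilityMeasure_law (interior_subset hθ)
  simp only [In, hm.pd_logLik n _ _ hθ]
  exact integrable_sum_mul_sum (hm.measurable_score r hθ) (hm.measurable_score s hθ)
    (hm.score_sq θ hθ r) (hm.score_sq θ hθ s) n

lemma RegularModel.integral_In (hm : RegularModel μ f Θ) {θ : Fin p → ℝ}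
    (hθ : θ ∈ interior Θ) {n : ℕ} (hn : n ≠ 0) (r s : Fin p) :
    ∫ ω, In f θ n ω r s ∂(sampleLaw μ f θ) = fisher μ f θ r s := by
  have := hm.isProbabilityMeasure_law (interior_subset hθ)
  simp only [In, hm.pd_logLik n _ _ hθ]
  exact integral_sum_mul_sum (hm.measurable_score r hθ) (hm.measurable_score s hθ)
    (hm.score_sq θ hθ r) (hm.score_sq θ hθ s) (hm.integral_score s hθ) hn

lemma RegularModel.integrable_Jn (hm : RegularModel μ f Θ) {θ : Fin p → ℝ}
    (hθ : θ ∈ interior Θ) (n : ℕ) (r s t : Fin p) :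
    Integrable (fun ω => Jn f θ n ω r s t) (sampleLaw μ f θ) := by
  have := hm.isProbabilityMeasure_law (interior_subset hθ)
  simp only [Jn, hm.pd_logLik n _ _ hθ, hm.pd_pd_logLik n _ _ _ hθ]
  exact integrable_sum_mul_sum (hm.measurable_hess r s hθ) (hm.measurable_score t hθ)
    (hm.hess_sq θ hθ r s) (hm.score_sq θ hθ t) n

lemma RegularModel.integral_Jn (hm : RegularModel μ f Θ) {θ : Fin p → ℝ}
    (hθ : θ ∈ interior Θ) {n : ℕ} (hn : n ≠ 0) (r s t : Fin p) :
    ∫ ω, Jn f θ n ω r s t ∂(sampleLaw μ f θ)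
      = ∫ x, pd r (pd s (logDensity f x)) θ * pd t (logDensity f x) θ ∂(law μ f θ) := by
  have := hm.isProbabilityMeasure_law (interior_subset hθ)
  simp only [Jn, hm.pd_logLik n _ _ hθ, hm.pd_pd_logLik n _ _ _ hθ]
  exact integral_sum_mul_sum (hm.measurable_hess r s hθ) (hm.measurable_score t hθ)
    (hm.hess_sq θ hθ r s) (hm.score_sq θ hθ t) (hm.integral_score t hθ) hn

lemma RegularModel.integrable_An (hm : RegularModel μ f Θ) {θ : Fin p → ℝ}
    (hθ : θ ∈ interior Θ) (n : ℕ) (r s v : Fin p) :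
    Integrable (fun ω => An μ f θ n ω r s v) (sampleLaw μ f θ) := by
  have := hm.isProbabilityMeasure_law (interior_subset hθ)
  have : IsProbabilityMeasure (sampleLaw μ f θ) := by unfold sampleLaw; infer_instance
  exact ((integrable_const _).fun_add ((hm.integrable_Jn hθ n v r s).const_mul 2)).fun_add
    (integrable_finsetSum _ fun t _ => integrable_finsetSum _ fun u _ =>
      ((hm.integrable_In hθ n s u).const_mul _).mul_const _)

/-- In expectation the last sum collapses through `I⁻¹ I = 1` to another copy of `K`. By the
symmetry of `K`, the total is twice `K` plus the mean product of Hessian and score, which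
`pd_fisher` identifies with `-2 ∂_s I_{vr}`. -/
lemma RegularModel.integral_An (hm : RegularModel μ f Θ) {θ : Fin p → ℝ}
    (hθ : θ ∈ interior Θ) {n : ℕ} (hn : n ≠ 0) (r s v : Fin p) :
    ∫ ω, An μ f θ n ω r s v ∂(sampleLaw μ f θ)
      = -2 * pd s (fun θ' => fisher μ f θ' v r) θ := by
  have := hm.isProbabilityMeasure_law (interior_subset hθ)
  have : IsProbabilityMeasure (sampleLaw μ f θ) := by unfold sampleLaw; infer_instance
  have hI := hm.integrable_In hθ n s
  have hJ := (hm.integrable_Jn hθ n v r s).const_mul 2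
  have hIK := fun t u => ((hI u).const_mul ((fisher μ f θ)⁻¹ t u)).mul_const (K μ f θ r t v)
  have e : ∑ t, ∑ u, (fisher μ f θ)⁻¹ t u * fisher μ f θ s u * K μ f θ r t v = K μ f θ r s v := by
    have h1 : ∀ t, ∑ u, (fisher μ f θ)⁻¹ t u * fisher μ f θ s u
        = (1 : Matrix (Fin p) (Fin p) ℝ) t s := fun t => by
      rw [← Matrix.nonsing_inv_mul _ (hm.fisher_nonsing θ hθ), Matrix.mul_apply]
      exact Finset.sum_congr rfl fun u _ => by rw [fisher_comm]
    simp only [← Finset.sum_mul, h1, Matrix.one_apply, ite_mul, one_mul, zero_mul,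
      Finset.sum_ite_eq', Finset.mem_univ, if_true]
  simp only [An]
  rw [integral_add ((integrable_const _).fun_add hJ) (integrable_finsetSum _ fun t _ =>
      integrable_finsetSum _ fun u _ => hIK t u), integral_add (integrable_const _) hJ,
    integral_const, integral_const_mul, hm.integral_Jn hθ hn,
    integral_finsetSum _ fun t _ => integrable_finsetSum _ fun u _ => hIK t u]
  simp only [integral_finsetSum _ fun u _ => hIK _ u, integral_mul_const, integral_const_mul,
    hm.integral_In hθ hn]
  rw [e, hm.pd_fisher v r s hθ, probReal_univ, one_smul, hm.K_comm_right r s v hθ,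
    hm.K_comm_left r v s hθ, hm.K_comm_left s v r hθ, hm.K_comm_right v s r hθ]
  ring

lemma RegularModel.integral_expansion (hm : RegularModel μ f Θ) {θ : Fin p → ℝ}
    (hθ : θ ∈ interior Θ) {n : ℕ} (hn : n ≠ 0) (a : ℝ) (v : Fin p) :
    Integrable (fun ω => a + 2 * pd v (logLik f n ω) θ
        + (1 / 2) * ∑ r, ∑ s, (fisher μ f θ)⁻¹ r s * An μ f θ n ω r s v) (sampleLaw μ f θ) ∧
    ∫ ω, (a + 2 * pd v (logLik f n ω) θ
        + (1 / 2) * ∑ r, ∑ s, (fisher μ f θ)⁻¹ r s * An μ f θ n ω r s v) ∂(sampleLaw μ f θ)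
      = a - phi μ f θ v := by
  have := hm.isProbabilityMeasure_law (interior_subset hθ)
  have : IsProbabilityMeasure (sampleLaw μ f θ) := by unfold sampleLaw; infer_instance
  have h1 := (hm.integrable_pd_logLik hθ n v).const_mul 2
  have h2 := fun r s => (hm.integrable_An hθ n r s v).const_mul ((fisher μ f θ)⁻¹ r s)
  have h3 := integrable_finsetSum Finset.univ fun r _ =>
    integrable_finsetSum Finset.univ fun s _ => h2 r s
  have h4 := h3.const_mul (1 / 2)
  have h5 := (integrable_const a).fun_add h1
  refine ⟨h5.fun_add h4, ?_⟩
  rw [integral_add h5 h4, integral_add (integrable_const _) h1, integral_const, probReal_univ,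
    one_smul, integral_const_mul, hm.integral_pd_logLik hθ, integral_const_mul,
    integral_finsetSum _ fun r _ => integrable_finsetSum _ fun s _ => h2 r s]
  simp only [integral_finsetSum _ fun s _ => h2 _ s, integral_const_mul, hm.integral_An hθ hn]
  rw [phi, mul_zero, add_zero, sub_eq_add_neg, Finset.mul_sum, ← Finset.sum_neg_distrib]
  congr 1
  refine Finset.sum_congr rfl fun r _ => ?_
  rw [Finset.mul_sum, ← Finset.sum_neg_distrib]
  exact Finset.sum_congr rfl fun s _ => by ring

/-! ### The bias of the posterior mean -/

/-- An exact identity for each `n ≥ 1` with integrable estimator: all the asymptotics of the bias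
sit in the remainder. -/
lemma RegularModel.integral_remainder (hm : RegularModel μ f Θ) {θ : Fin p → ℝ}
    (hθ : θ ∈ interior Θ) {n : ℕ} (hn : n ≠ 0)
    (hb : Integrable (bayes f Θ π n) (sampleLaw μ f θ)) :
    ∫ ω, remainder μ f Θ π θ n ω ∂(sampleLaw μ f θ)
      = bias μ f Θ π θ n - (n : ℝ)⁻¹ • (fisher μ f θ)⁻¹.mulVec (fun t =>
          gradLogPrior π θ t - phi μ f θ t) := by
  have := hm.isProbabilityMeasure_law (interior_subset hθ)
  have : IsProbabilityMeasure (sampleLaw μ f θ) := by unfold sampleLaw; infer_instance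
  set Y : (ℕ → 𝒳) → Fin p → ℝ := fun ω v => gradLogPrior π θ v + 2 * pd v (logLik f n ω) θ
    + (1 / 2) * ∑ r, ∑ s, (fisher μ f θ)⁻¹ r s * An μ f θ n ω r s v with hY
  have hYi : ∀ v, Integrable (fun ω => Y ω v) (sampleLaw μ f θ) := fun v =>
    (hm.integral_expansion hθ hn (gradLogPrior π θ v) v).1
  have hYint : ∫ ω, Y ω ∂(sampleLaw μ f θ) = fun t => gradLogPrior π θ t - phi μ f θ t := by
    ext v
    rw [eval_integral hYi]
    exact (hm.integral_expansion hθ hn (gradLogPrior π θ v) v).2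
  set L : (Fin p → ℝ) →L[ℝ] (Fin p → ℝ) :=
    LinearMap.toContinuousLinearMap ((fisher μ f θ)⁻¹.mulVecLin)
  have hL : ∫ ω, L (Y ω) ∂(sampleLaw μ f θ) = L (∫ ω, Y ω ∂(sampleLaw μ f θ)) :=
    L.integral_comp_comm (Integrable.of_eval hYi)
  have hLi : Integrable (fun ω => L (Y ω)) (sampleLaw μ f θ) :=
    L.integrable_comp (Integrable.of_eval hYi)
  change ∫ ω, (bayes f Θ π n ω - θ - (n : ℝ)⁻¹ • L (Y ω)) ∂(sampleLaw μ f θ) = _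
  have hc : Integrable (fun _ : ℕ → 𝒳 => θ) (sampleLaw μ f θ) := integrable_const θ
  have hd : Integrable (fun ω => bayes f Θ π n ω - θ) (sampleLaw μ f θ) := hb.sub hc
  have hLn : Integrable (fun ω => (n : ℝ)⁻¹ • L (Y ω)) (sampleLaw μ f θ) := hLi.fun_smul _
  rw [integral_sub hd hLn, integral_sub hb hc, integral_const, probReal_univ, one_smul,
    integral_smul, hL, hYint]
  rfl

theorem bias_expansion (hm : RegularModel μ f Θ) (hp : RegularPrior μ f Θ π)
    (hΘ : MeasurableSet Θ) {θ : Fin p → ℝ} (hθ : θ ∈ interior Θ)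
    (hexp : ExpectationOfRemainder μ f Θ π θ) :
    (fun n : ℕ => bias μ f Θ π θ n - (n : ℝ)⁻¹ • (fisher μ f θ)⁻¹.mulVec (fun t =>
        gradLogPrior π θ t - phi μ f θ t)) =o[atTop] (fun n : ℕ => (n : ℝ)⁻¹) := by
  refine (hexp.2 (hm.tendstoInMeasure_remainder hp hΘ hθ)).congr' ?_ EventuallyEq.rfl
  filter_upwards [hexp.1, eventually_ne_atTop 0] with n hn hn0
  exact hm.integral_remainder hθ hn0 hn

/-- A fixed vector times `n⁻¹` is `o(n⁻¹)` only if the vector is zero, so the leading coefficient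
alone decides. -/
lemma isLittleO_inv_smul_iff {E : Type*} [NormedAddCommGroup E] [NormedSpace ℝ E] {b : ℕ → E}
    {w : E} (h : (fun n : ℕ => b n - (n : ℝ)⁻¹ • w) =o[atTop] fun n : ℕ => (n : ℝ)⁻¹) :
    b =o[atTop] (fun n : ℕ => (n : ℝ)⁻¹) ↔ w = 0 := by
  refine ⟨fun hb => ?_, fun hw => by simpa [hw] using h⟩
  have h1 : (fun n : ℕ => (n : ℝ)⁻¹ • w) =o[atTop] fun n : ℕ => (n : ℝ)⁻¹ := by
    simpa using hb.sub h
  rw [← norm_le_zero_iff]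
  refine le_of_forall_pos_le_add fun e he => ?_
  obtain ⟨n, hn, hn0⟩ := ((h1.bound he).and (eventually_gt_atTop 0)).exists
  have hpos : 0 < ‖(n : ℝ)⁻¹‖ := norm_pos_iff.2 (inv_ne_zero (Nat.cast_ne_zero.2 hn0.ne'))
  rw [norm_smul, mul_comm] at hn
  rw [zero_add]
  exact le_of_mul_le_mul_right hn hpos

/-- The leading coefficient is `I⁻¹` applied to the difference of the two sides, and multiplying by
`I` removes the inverse. -/
theorem secondOrderUnbiasedAt_iff (hm : RegularModel μ f Θ) (hp : RegularPrior μ f Θ π)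
    (hΘ : MeasurableSet Θ) {θ : Fin p → ℝ} (hθ : θ ∈ interior Θ)
    (hexp : ExpectationOfRemainder μ f Θ π θ) :
    SecondOrderUnbiasedAt μ f Θ π θ ↔ ∀ t, gradLogPrior π θ t = phi μ f θ t := by
  rw [SecondOrderUnbiasedAt, isLittleO_inv_smul_iff (bias_expansion hm hp hΘ hθ hexp)]
  constructor
  · intro h t
    have h1 := congrArg (fisher μ f θ).mulVec h
    rw [Matrix.mulVec_mulVec, Matrix.mul_nonsing_inv _ (hm.fisher_nonsing θ hθ),
      Matrix.one_mulVec, Matrix.mulVec_zero] at h1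
    exact sub_eq_zero.1 (congrFun h1 t)
  · intro h
    have : (fun t => gradLogPrior π θ t - phi μ f θ t) = 0 := funext fun t => sub_eq_zero.2 (h t)
    rw [this, Matrix.mulVec_zero]

end Bias

end IIDBayes

theorem mainTheorem6 {p : ℕ} {𝒳 : Type*} [MeasurableSpace 𝒳] (μ : Measure 𝒳) [SigmaFinite μ]
    (f : (Fin p → ℝ) → 𝒳 → ℝ) (Θ : Set (Fin p → ℝ)) (hΘ : MeasurableSet Θ)
    (π : (Fin p → ℝ) → ℝ)
    (hmodel : IIDBayes.RegularModel μ f Θ)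
    (hprior : IIDBayes.RegularPrior μ f Θ π)
    (hexp : ∀ θ ∈ interior Θ, IIDBayes.ExpectationOfRemainder μ f Θ π θ) :
    (∀ θ ∈ interior Θ,
      (fun n : ℕ => IIDBayes.bias μ f Θ π θ n
          - (n : ℝ)⁻¹ • (IIDBayes.fisher μ f θ)⁻¹.mulVec (fun t =>
              IIDBayes.gradLogPrior π θ t - IIDBayes.phi μ f θ t))
        =o[atTop] (fun n : ℕ => (n : ℝ)⁻¹)) ∧
    (∀ θ ∈ interior Θ,
      (IIDBayes.SecondOrderUnbiasedAt μ f Θ π θ ↔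
        ∀ t, IIDBayes.gradLogPrior π θ t = IIDBayes.phi μ f θ t)) ∧
    (IIDBayes.AsymptoticallyUnbiased μ f Θ π ↔
      ∀ θ ∈ interior Θ, ∀ t, IIDBayes.gradLogPrior π θ t = IIDBayes.phi μ f θ t) := by
  exact ⟨fun θ hθ => IIDBayes.bias_expansion hmodel hprior hΘ hθ (hexp θ hθ),
    fun θ hθ => IIDBayes.secondOrderUnbiasedAt_iff hmodel hprior hΘ hθ (hexp θ hθ),
    forall₂_congr fun θ hθ =>
      IIDBayes.secondOrderUnbiasedAt_iff hmodel hprior hΘ hθ (hexp θ hθ)⟩
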